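/- Let $p$ be a prime and $k$ a perfect field of characteristic $p$. Let $N=\mathbb{Z}^n$ with dual lattice $M=\mathrm{Hom}(N,\mathbb{Z})\cong\mathbb{Z}^n$, let $\sigma\subset N_{\mathbb{R}}$ be a full-dimensional strongly convex rational polyhedral cone, and let $\vec v_1,\dots,\vec v_r\in N$ be its primitive generators (the primitive lattice vectors on its rays). Put $S=\sigma^\vee\cap M$, let $R=k[S]$ be the coordinate ring of the affine toric variety of $\sigma$, $d=\dim R$, and $\mathfrak{m}$ its homogeneous maximal ideal, generated by the monomials $\chi^{\vec u}$ with $0\ne \vec u\in S$. Let $D_i$ be the torus-invariant prime divisor of $\vec v_i$, whose ideal is generated by the monomials $\chi^{\vec u}$ with $\vec u\cdot\vec v_i\neq 0$; let $D=\sum_i a_iD_i$ with rational $a_i\ge 0$; let $\mathfrak{a}\subset R$ be an ideal generated by monomials; and let $t>0$ be real. Put $$P_\sigma^D=\{\vec w\in M_{\mathbb{R}} : 0\le \vec w\cdot \vec v_i<1-a_i \text{ for all } i\},\qquad \mathrm{Newt}(\mathfrak{a})=\text{the convex hull in } M_{\mathbb{R}} \text{ of } \{\vec u\in S : \chi^{\vec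 u}\in\mathfrak{a}\}.$$ For an integral Weil divisor $E$ write $R(E)=\{f\in\mathrm{Frac}(R) : f=0 \text{ or } \mathrm{div} f+E\ge 0\}$. For $e\ge 0$ let $\mathfrak{D}_e=\mathrm{Hom}_R\big(R(\lceil (p^e-1)D\rceil)^{1/p^e},R\big)$, regarded by restriction as a submodule of $\mathrm{Hom}_R(R^{1/p^e},R)$, let $\mathfrak{D}'_e$ be the $R^{1/p^e}$-submodule generated by the maps $x\mapsto\phi(b^{1/p^e}x)$ with $\phi\in\mathfrak{D}_e$ and $b\in\mathfrak{a}^{\lceil (p^e-1)t\rceil}$, and let $I_e^{\mathfrak{a}}=\{f\in R : \psi(f^{1/p^e})\in\mathfrak{m} \text{ for all } \psi\in\mathfrak{D}'_e\}$. The $F$-signature of the triple is $$s(R,D,\mathfrak{a}^t)=\lim_{e\to\infty}\frac{\ell_R(R/I_e^{\mathfrak{a}})}{p^{ed}} .$$ Suppose that the pair $(R,D)$ is $\mathbb{Q}$-Gorenstein, that is, for a canonical divisor $K_X$ of $X=\mathrm{Spec}\,R$ some positive integer multiple of $K_X+D$ is an integral Cartier divisor. Then the limit exists and $$s(R,D,\mathfrak{a}^t)=\mathrm{Vol}\big(P_\sigma^D\cap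 t\cdot\mathrm{Newt}(\mathfrak{a})\big),$$ where $\mathrm{Vol}$ is Lebesgue measure on $M_{\mathbb{R}}$ normalised so that $M$ has covolume $1$. -/

import Mathlib

open MeasureTheory Filter Topology
open scoped ENNReal Pointwise KaehlerDifferential

noncomputable section

namespace FSig

/-! ### Weil divisors on the spectrum of a domain -/

section Divisors

variable (R : Type*) [CommRing R] [IsDomain R]

/-- The local ring `R_P`, as a subring of the fraction field of `R`. -/
abbrev localRing (P : Ideal R) [P.IsPrime] : Subalgebra R (FractionRing R) :=
  Localization.subalgebra.ofField (FractionRing R) P.primeCompl P.primeCompl_le_nonZeroDivisors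

/-- A prime divisor of `Spec R`: a prime of height one whose local ring is a discrete valuation
ring. For a normal Noetherian domain the last condition is automatic. -/
structure PrimeDivisor where
  ideal : Ideal R
  isPrime : ideal.IsPrime
  height_eq_one : ideal.height = 1
  isDVR : IsDiscreteValuationRing (localRing R ideal)

attribute [instance] PrimeDivisor.isPrime PrimeDivisor.isDVR

variable {R}

/-- The discrete valuation of the fraction field at a prime divisor, written multiplicatively. -/
def PrimeDivisor.val (P : PrimeDivisor R) : Valuation (FractionRing R) (WithZero (Multiplicative ℤ)) :=
  (IsDiscreteValuationRing.maximalIdeal (localRing R P.ideal)).valuation (FractionRing R)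

/-- The order of vanishing of a nonzero rational function along a prime divisor. -/
def PrimeDivisor.ord (P : PrimeDivisor R) (f : FractionRing R) : ℤ :=
  -WithZero.log (P.val f)

theorem PrimeDivisor.val_algebraMap_le_one (P : PrimeDivisor R) (r : R) :
    P.val (algebraMap R (FractionRing R) r) ≤ 1 :=
  (IsDiscreteValuationRing.maximalIdeal (localRing R P.ideal)).valuation_le_one
    (K := FractionRing R) (algebraMap R (localRing R P.ideal) r)

theorem PrimeDivisor.val_le_exp_iff (P : PrimeDivisor R) {f : FractionRing R} (hf : f ≠ 0)
    (m : ℤ) : P.val f ≤ WithZero.exp m ↔ 0 ≤ P.ord f + m := by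
  have h : P.val f ≠ 0 := (Valuation.ne_zero_iff _).2 hf
  rw [← WithZero.log_le_iff_le_exp h, PrimeDivisor.ord]
  omega

/-- The module of global sections of an integral Weil divisor `E`: all rational functions `f`
which are zero or satisfy `div f + E ≥ 0`. -/
def sections (E : PrimeDivisor R → ℤ) : Submodule R (FractionRing R) where
  carrier := {f | f ≠ 0 → ∀ P : PrimeDivisor R, 0 ≤ P.ord f + E P}
  zero_mem' := fun h => absurd rfl h
  add_mem' := by
    intro f g hf hg hfg P
    have key : ∀ h : FractionRing R, (h ≠ 0 → ∀ P : PrimeDivisor R, 0 ≤ P.ord h + E P) →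
        P.val h ≤ WithZero.exp (E P) := by
      intro h hh
      by_cases h0 : h = 0
      · simp [h0]
      · exact (P.val_le_exp_iff h0 _).2 (hh h0 P)
    exact (P.val_le_exp_iff hfg _).1 (P.val.map_add_le (key f hf) (key g hg))
  smul_mem' := by
    intro r f hf hrf P
    have h0 : f ≠ 0 := by
      rintro rfl
      exact hrf (smul_zero r)
    refine (P.val_le_exp_iff hrf _).1 ?_
    rw [Algebra.smul_def, map_mul]
    exact (mul_le_of_le_one_left' (P.val_algebraMap_le_one r)).trans
      ((P.val_le_exp_iff h0 _).2 (hf h0 P))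

/-- An integral Weil divisor is Cartier if it is locally principal. -/
def IsCartier (C : PrimeDivisor R → ℤ) : Prop :=
  ∀ x : PrimeSpectrum R, ∃ s : R, s ∉ x.asIdeal ∧ ∃ f : FractionRing R, f ≠ 0 ∧
    ∀ P : PrimeDivisor R, s ∉ P.ideal → P.ord f = C P

/-- The lattice of top differential forms that are regular at `P`: the `R_P`-submodule of the
rational `d`-forms generated by `df₁ ∧ ⋯ ∧ df_d` with all `fᵢ` in `R_P`. -/
def regularForms (k : Type*) [Field k] [Algebra k R] (d : ℕ) (P : PrimeDivisor R) :
    AddSubgroup (⋀[FractionRing R]^d (Ω[FractionRing R⁄k])) :=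
  AddSubgroup.closure {η | ∃ g ∈ localRing R P.ideal, ∃ f : Fin d → FractionRing R,
    (∀ i, f i ∈ localRing R P.ideal) ∧
      η = g • exteriorPower.ιMulti (FractionRing R) d
        (fun i => KaehlerDifferential.D k (FractionRing R) (f i))}

/-- `K` is a canonical divisor of `Spec R` over `k`: the divisor of a nonzero rational top
differential form `ω`. The order of `ω` along `P` is the integer `m` such that `f • ω` is regular
at `P` exactly when `ord_P f + m ≥ 0`. -/
def IsCanonicalDivisor (k : Type*) [Field k] [Algebra k R] (K : PrimeDivisor R → ℤ) : Prop :=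
  ∃ d : ℕ, ringKrullDim R = d ∧
    ∃ ω : ⋀[FractionRing R]^d (Ω[FractionRing R⁄k]), ω ≠ 0 ∧
      ∀ (P : PrimeDivisor R) (f : FractionRing R), f ≠ 0 →
        (f • ω ∈ regularForms k d P ↔ 0 ≤ P.ord f + K P)

/-- The pair `(R, D)` is `ℚ`-Gorenstein: some positive integer multiple of `K + D` is an integral
Cartier divisor, where `K` is a canonical divisor. -/
def IsQGorenstein (k : Type*) [Field k] [Algebra k R] (D : PrimeDivisor R → ℚ) : Prop :=
  ∃ K : PrimeDivisor R → ℤ, IsCanonicalDivisor k K ∧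
    ∃ m : ℕ, 0 < m ∧ ∃ C : PrimeDivisor R → ℤ,
      (∀ P, (C P : ℚ) = m * (K P + D P)) ∧ IsCartier C

end Divisors

/-! ### The `F`-signature of a triple -/

section Signature

variable {R : Type*} [CommRing R] [IsDomain R]

/-- `Hom_R(R(E)^{1/q}, R)`, viewed inside `Hom_R(R^{1/q}, R)` by restriction to `R^{1/q}`, for an
effective divisor `E`. An `R`-linear map out of `L^{1/q}` is written as an additive map `ψ` out of
`L` with `ψ (r ^ q • x) = r * ψ x`. -/
def frobHom (q : ℕ) (E : PrimeDivisor R → ℤ) : Set (R →+ R) :=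
  {φ | ∃ ψ : sections E →+ R, (∀ (r : R) (x : sections E), ψ (r ^ q • x) = r * ψ x) ∧
    ∀ (x : R) (y : sections E), (y : FractionRing R) = algebraMap R (FractionRing R) x →
      φ x = ψ y}

/-- The submodule generated by the maps `x ↦ φ (a x)` with `φ` in `frobHom q E` and `a ∈ J`; since
`J` is an ideal, the additive subgroup generated by these is stable under premultiplication. -/
def frobHomIdeal (q : ℕ) (E : PrimeDivisor R → ℤ) (J : Ideal R) : AddSubgroup (R →+ R) :=
  AddSubgroup.closure {χ | ∃ φ ∈ frobHom q E, ∃ a ∈ J, ∀ x, χ x = φ (a * x)}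

theorem comp_mulLeft_mem_frobHomIdeal (q : ℕ) (E : PrimeDivisor R → ℤ) (J : Ideal R) (c : R)
    {ψ : R →+ R} (hψ : ψ ∈ frobHomIdeal q E J) :
    ψ.comp (AddMonoidHom.mulLeft c) ∈ frobHomIdeal q E J := by
  induction hψ using AddSubgroup.closure_induction with
  | mem χ h =>
    obtain ⟨φ, hφ, a, ha, hχ⟩ := h
    refine AddSubgroup.subset_closure ⟨φ, hφ, a * c, J.mul_mem_right c ha, fun x => ?_⟩
    simp [hχ, mul_assoc]
  | zero => exact (frobHomIdeal q E J).zero_mem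
  | add f g _ _ hf hg => exact (frobHomIdeal q E J).add_mem hf hg
  | neg f _ hf => exact (frobHomIdeal q E J).neg_mem hf

/-- The ideal of all `r` such that every map in `frobHomIdeal q E J` sends `r ^ (1 / q)`
into `𝔪`. -/
def splittingIdeal (𝔪 : Ideal R) (q : ℕ) (E : PrimeDivisor R → ℤ) (J : Ideal R) : Ideal R where
  carrier := {r | ∀ ψ ∈ frobHomIdeal q E J, ψ r ∈ 𝔪}
  zero_mem' := fun ψ _ => by simp
  add_mem' := fun {r s} hr hs ψ hψ => by
    rw [map_add]
    exact 𝔪.add_mem (hr ψ hψ) (hs ψ hψ)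
  smul_mem' := fun c r hr ψ hψ => hr _ (comp_mulLeft_mem_frobHomIdeal q E J c hψ)

/-- The limit defining the `F`-signature of the triple `(R, D, 𝔞 ^ t)` exists and equals `s`; here
`𝔪` is the (homogeneous) maximal ideal of `R`, the divisor at level `e` is `⌈(p ^ e - 1) D⌉`, the
exponent of `𝔞` is `⌈(p ^ e - 1) t⌉`, and lengths are normalised by `p ^ (e * dim R)`. -/
def HasFSignature (p : ℕ) (𝔪 : Ideal R) (D : PrimeDivisor R → ℚ) (𝔞 : Ideal R) (t : ℝ)
    (s : ℝ≥0∞) : Prop :=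
  ∃ d : ℕ, ringKrullDim R = d ∧
    Tendsto (fun e : ℕ =>
      ((Module.length R (R ⧸ splittingIdeal 𝔪 (p ^ e) (fun P => ⌈((p : ℚ) ^ e - 1) * D P⌉)
        (𝔞 ^ ⌈((p : ℝ) ^ e - 1) * t⌉₊)) : ℕ∞) : ℝ≥0∞) / (p : ℝ≥0∞) ^ (e * d))
      atTop (𝓝 s)

end Signature

/-! ### Affine toric varieties

The lattice `N` is `ℤⁿ`, and `M = N*` is identified with `ℤⁿ` by the dot product. -/

section Toric

/-- The inclusion of the lattice `ℤⁿ` in `ℝⁿ`. -/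
def toReal {n : ℕ} (u : Fin n → ℤ) : Fin n → ℝ := fun j => (u j : ℝ)

/-- `v₁, …, v_r` are the primitive generators of the cone `σ`: they generate `σ`, none of them is
superfluous, and each is a primitive lattice vector. -/
structure IsPrimitiveGenerators {n r : ℕ} (σ : PointedCone ℝ (Fin n → ℝ))
    (v : Fin r → Fin n → ℤ) : Prop where
  span_eq : Submodule.span {c : ℝ // 0 ≤ c} (Set.range fun i => toReal (v i)) = σ
  minimal : ∀ i, toReal (v i) ∉
    Submodule.span {c : ℝ // 0 ≤ c} ((fun j => toReal (v j)) '' {j | j ≠ i})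
  primitive : ∀ (i : Fin r) (m : ℤ) (w : Fin n → ℤ), v i = m • w → IsUnit m

/-- The semigroup `S = σ^∨ ∩ M`. -/
def dualMonoid {n : ℕ} (σ : PointedCone ℝ (Fin n → ℝ)) : AddSubmonoid (Fin n → ℤ) where
  carrier := {u | ∀ x ∈ σ, 0 ≤ toReal u ⬝ᵥ x}
  zero_mem' := fun x _ => by simp [toReal, dotProduct]
  add_mem' := fun {u w} hu hw x hx => by
    have h : toReal (u + w) = toReal u + toReal w := by
      ext j
      simp [toReal]
    rw [h, add_dotProduct]
    exact add_nonneg (hu x hx) (hw x hx)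

/-- The coordinate ring `k[S]` of the affine toric variety of `σ`. -/
abbrev ToricRing (k : Type*) [Field k] {n : ℕ} (σ : PointedCone ℝ (Fin n → ℝ)) : Type _ :=
  AddMonoidAlgebra k (dualMonoid σ)

instance {n : ℕ} (σ : PointedCone ℝ (Fin n → ℝ)) : TwoUniqueSums (dualMonoid σ) :=
  TwoUniqueSums.of_injective_addHom (dualMonoid σ).subtype.toAddHom Subtype.val_injective
    inferInstance

instance (k : Type*) [Field k] {n : ℕ} (σ : PointedCone ℝ (Fin n → ℝ)) :
    IsDomain (ToricRing k σ) :=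
  NoZeroDivisors.to_isDomain _

variable (k : Type*) [Field k] {n r : ℕ} (σ : PointedCone ℝ (Fin n → ℝ))

/-- The monomial `χ^u`. -/
def monomial (u : dualMonoid σ) : ToricRing k σ := AddMonoidAlgebra.single u 1

/-- The homogeneous maximal ideal, generated by the monomials other than `1`. -/
def maxIdeal : Ideal (ToricRing k σ) := Ideal.span (monomial k σ '' {u | u ≠ 0})

/-- The ideal of the torus-invariant divisor `Dᵢ` of a primitive generator `vᵢ`, generated by the
monomials `χ^u` with `u ⬝ vᵢ ≠ 0`. -/
def rayIdeal (w : Fin n → ℤ) : Ideal (ToricRing k σ) :=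
  Ideal.span (monomial k σ '' {u | (u : Fin n → ℤ) ⬝ᵥ w ≠ 0})

open Classical in
/-- The torus-invariant `ℚ`-divisor `∑ aᵢ Dᵢ`. -/
def toricDivisor (v : Fin r → Fin n → ℤ) (a : Fin r → ℚ) :
    PrimeDivisor (ToricRing k σ) → ℚ :=
  fun P => ∑ i, if P.ideal = rayIdeal k σ (v i) then a i else 0

variable {k σ}

/-- An ideal generated by monomials. -/
def IsMonomialIdeal (𝔞 : Ideal (ToricRing k σ)) : Prop :=
  ∃ A : Set (dualMonoid σ), 𝔞 = Ideal.span (monomial k σ '' A)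

/-- The Newton polyhedron: the convex hull of the exponents of the monomials in `𝔞`. -/
def newton (𝔞 : Ideal (ToricRing k σ)) : Set (Fin n → ℝ) :=
  convexHull ℝ {x | ∃ u : dualMonoid σ, monomial k σ u ∈ 𝔞 ∧ x = toReal (u : Fin n → ℤ)}

/-- The polytope `P_σ^D` of `D = ∑ aᵢ Dᵢ`. -/
def polytope (v : Fin r → Fin n → ℤ) (a : Fin r → ℚ) : Set (Fin n → ℝ) :=
  {w | ∀ i, 0 ≤ w ⬝ᵥ toReal (v i) ∧ w ⬝ᵥ toReal (v i) < 1 - (a i : ℝ)}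

end Toric

end FSig

end

/-! Everything is graded by M, so the splitting ideal is spanned by monomials and its colength is a
lattice-point count. Put q = p^e. Some map in `frobHom q E` gives χ^u a nonzero constant term
exactly when u·v_i + E_i < q for all i. If the inequality fails at v_i, a factor χ^m with m·v_i = 1
can be pulled out of the image of χ^u (`coeff_zero_frobHom_single`). Otherwise the projection
`frobProj` onto the coset u + qM detects χ^u (`exists_frobHom_coeff`); it extracts q-th roots of
coefficients, which is where perfectness of k enters. Hence the surviving exponents are those u in S
for which some χ^b in 𝔞^⌈(q-1)t⌉ satisfies (u + b)·v_i + ⌈(q-1)a_i⌉ < q for all i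
(`mem_splittingIdeal`), and the length is their number (`length_quotient_cofaceIdeal`).

Divided by q, these conditions become, up to boundary, x ∈ σ^∨ and (x + z)·v_i ≤ 1 - a_i for some z
in t Newt(𝔞). The ℚ-Gorenstein hypothesis supplies a point w with w·v_i = 1 - a_i
(`IsQGorenstein.exists_dotProduct_eq`). The condition then reads w - x ∈ z + σ^∨, and since the
Newton polyhedron absorbs σ^∨ up to closure, it says w - x ∈ t Newt(𝔞). So the region is the image
of P ∩ t Newt(𝔞) under the volume-preserving reflection x ↦ w - x. All scaled exponents lie in
`outerRegion`, and each `innerRegion` has its scaled lattice points among them once q is large.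
Frontiers of convex sets are null, so the two bounds have the same volume and the count converges to
it (`tendsto_ncard_splittingExponents_div`).

The point w comes from differential forms. If the invariant form dlog x_1 ∧ … ∧ dlog x_n is nonzero,
it has a simple pole along each D_i and neither zero nor pole elsewhere
(`mem_regularForms_rayDivisor`, `mem_regularForms_of_isNontoric`), so K is known up to a principal
divisor. Near the torus-fixed point, a principal divisor that is trivial on the torus has the orders
of a character along the rays (`exists_character_of_locally_principal`). Forms of degree above n
vanish, which also bounds dim R by n. -/

noncomputable section

namespace FSig

/-! ### Combinatorics of the cone -/

section Cone

variable {n r : ℕ}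

theorem toReal_dotProduct_toReal (u w : Fin n → ℤ) :
    toReal u ⬝ᵥ toReal w = ((u ⬝ᵥ w : ℤ) : ℝ) := by
  simp [toReal, dotProduct]

theorem toReal_add (u w : Fin n → ℤ) : toReal (u + w) = toReal u + toReal w := by
  ext j
  simp [toReal]

theorem toReal_sub (u w : Fin n → ℤ) : toReal (u - w) = toReal u - toReal w := by
  ext j
  simp [toReal]

theorem toReal_zsmul (c : ℤ) (w : Fin n → ℤ) : toReal (c • w) = (c : ℝ) • toReal w := by
  ext j
  simp [toReal]

theorem toReal_nsmul (c : ℕ) (w : Fin n → ℤ) : toReal (c • w) = (c : ℝ) • toReal w := by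
  ext j
  simp [toReal]

theorem toReal_injective : Function.Injective (toReal : (Fin n → ℤ) → Fin n → ℝ) := by
  intro u w h
  ext j
  simpa [toReal] using congrFun h j

/-- Integral form of Gordan's alternative: a finite family of lattice vectors whose convex hull
misses the origin is positive for some integral linear form. -/
theorem exists_int_dotProduct_pos {ι : Type*} [Finite ι] (w : ι → Fin n → ℤ)
    (h : (0 : Fin n → ℝ) ∉ convexHull ℝ (Set.range fun j => toReal (w j))) :
    ∃ y : Fin n → ℤ, ∀ j, 0 < y ⬝ᵥ w j := by
  have hfin : (Set.range fun j => toReal (w j)).Finite := Set.finite_range _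
  obtain ⟨f, c, hf0, hf⟩ := geometric_hahn_banach_point_closed
    (convex_convexHull ℝ _) (hfin.isClosed_convexHull ℝ) h
  rw [map_zero] at hf0
  -- The separating functional is the dot product with its vector of values on the standard basis.
  set y : Fin n → ℝ := fun l => f (Pi.single l 1) with hy
  have hfy : ∀ x, f x = y ⬝ᵥ x := by
    intro x
    conv_lhs => rw [← Finset.univ_sum_single x]
    rw [map_sum, dotProduct]
    refine Finset.sum_congr rfl fun l _ => ?_
    rw [show (Pi.single l (x l) : Fin n → ℝ) = x l • Pi.single l 1 by
      rw [← Pi.single_smul, smul_eq_mul, mul_one], map_smul, smul_eq_mul, mul_comm]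
  have hpos : ∀ j, 0 < y ⬝ᵥ toReal (w j) := fun j => by
    rw [← hfy]
    exact hf0.trans (hf _ (subset_convexHull ℝ _ ⟨j, rfl⟩))
  have hev : ∀ j, ∀ᶠ N : ℕ in atTop, 0 < (fun l => ⌊(N : ℝ) * y l⌋) ⬝ᵥ w j := by
    intro j
    have ht : Tendsto (fun N : ℕ => (N : ℝ) * (y ⬝ᵥ toReal (w j))) atTop atTop :=
      tendsto_natCast_atTop_atTop.atTop_mul_const (hpos j)
    -- Rounding N y down changes its pairing with w j by at most ∑ |w j l|, a bound independent of
    -- N, while N (y·w j) tends to infinity.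
    filter_upwards [ht.eventually_gt_atTop (∑ l, |(w j l : ℝ)|)] with N hN
    have : (0 : ℝ) < (((fun l => ⌊(N : ℝ) * y l⌋) ⬝ᵥ w j : ℤ) : ℝ) := by
      rw [← toReal_dotProduct_toReal]
      have : (N : ℝ) * (y ⬝ᵥ toReal (w j)) - ∑ l, |(w j l : ℝ)| ≤
          toReal (fun l => ⌊(N : ℝ) * y l⌋) ⬝ᵥ toReal (w j) := by
        simp only [dotProduct, toReal, Finset.mul_sum, ← Finset.sum_sub_distrib]
        refine Finset.sum_le_sum fun l _ => ?_
        have h1 := Int.floor_le ((N : ℝ) * y l)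
        have h2 := Int.lt_floor_add_one ((N : ℝ) * y l)
        have h3 : ((N : ℝ) * y l - ⌊(N : ℝ) * y l⌋) * w j l ≤ |(w j l : ℝ)| := by
          refine (le_abs_self _).trans ?_
          rw [abs_mul]
          refine mul_le_of_le_one_left (abs_nonneg _) ?_
          rw [abs_le]
          constructor <;> linarith
        linarith
      linarith
    exact_mod_cast this
  obtain ⟨N, hN⟩ := (eventually_all.2 hev).exists
  exact ⟨_, hN⟩

variable {σ : PointedCone ℝ (Fin n → ℝ)} {v : Fin r → Fin n → ℤ}

theorem IsPrimitiveGenerators.mem_cone (hv : IsPrimitiveGenerators σ v) (i : Fin r) :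
    toReal (v i) ∈ σ := by
  rw [← hv.span_eq]
  exact Submodule.subset_span ⟨i, rfl⟩

theorem IsPrimitiveGenerators.forall_cone_nonneg_iff (hv : IsPrimitiveGenerators σ v)
    (u : Fin n → ℝ) : (∀ x ∈ σ, 0 ≤ u ⬝ᵥ x) ↔ ∀ i, 0 ≤ u ⬝ᵥ toReal (v i) := by
  refine ⟨fun h i => h _ (hv.mem_cone i), fun h x hx => ?_⟩
  rw [← hv.span_eq] at hx
  induction hx using Submodule.span_induction with
  | mem x hx => obtain ⟨i, rfl⟩ := hx; exact h i
  | zero => simp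
  | add x y _ _ hx hy => rw [dotProduct_add]; exact add_nonneg hx hy
  | smul c x _ hx =>
    rw [show c • x = (c : ℝ) • x from rfl, dotProduct_smul]
    exact mul_nonneg c.2 hx

theorem IsPrimitiveGenerators.mem_dualMonoid (hv : IsPrimitiveGenerators σ v)
    {u : Fin n → ℤ} : u ∈ dualMonoid σ ↔ ∀ i, 0 ≤ u ⬝ᵥ v i := by
  have : u ∈ dualMonoid σ ↔ ∀ x ∈ σ, 0 ≤ toReal u ⬝ᵥ x := Iff.rfl
  rw [this, hv.forall_cone_nonneg_iff]
  simp only [toReal_dotProduct_toReal, Int.cast_nonneg_iff]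

/-- Bézout: a generator of the ideal spanned by the coordinates divides the vector, so primitivity
makes it a unit. -/
theorem IsPrimitiveGenerators.exists_dotProduct_eq_one (hv : IsPrimitiveGenerators σ v)
    (i : Fin r) : ∃ m : Fin n → ℤ, m ⬝ᵥ v i = 1 := by
  set I : Ideal ℤ := Ideal.span (Set.range (v i)) with hI
  obtain ⟨g, hg⟩ := (inferInstance : I.IsPrincipal).principal
  have hdvd : ∀ j, g ∣ v i j := fun j => by
    rw [← Ideal.mem_span_singleton]
    have : v i j ∈ I := Ideal.subset_span ⟨j, rfl⟩
    rwa [hg] at this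
  choose w hw using hdvd
  have hunit : IsUnit g := hv.primitive i g w (by ext j; simpa using hw j)
  have h1 : (1 : ℤ) ∈ I := by
    have hgI : g ∈ I := by
      rw [hg]
      exact Submodule.mem_span_singleton_self g
    rw [Ideal.eq_top_of_isUnit_mem _ hgI hunit]
    trivial
  obtain ⟨m, hm⟩ := Ideal.mem_span_range_iff_exists_fun.1 h1
  exact ⟨m, hm⟩

theorem IsPrimitiveGenerators.ne_zero (hv : IsPrimitiveGenerators σ v) (i : Fin r) :
    toReal (v i) ≠ 0 := by
  intro h
  obtain ⟨m, hm⟩ := hv.exists_dotProduct_eq_one i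
  have := toReal_dotProduct_toReal m (v i)
  rw [h, hm] at this
  simp at this

/-- The facet of the dual cone cut out by a ray of a salient cone has a relatively interior lattice
point. -/
theorem IsPrimitiveGenerators.exists_facet (hv : IsPrimitiveGenerators σ v)
    (hσ : (σ : ConvexCone ℝ (Fin n → ℝ)).Salient) (i : Fin r) :
    ∃ m : Fin n → ℤ, m ⬝ᵥ v i = 0 ∧ ∀ j ≠ i, 0 < m ⬝ᵥ v j := by
  obtain ⟨m₁, hm₁⟩ := hv.exists_dotProduct_eq_one i
  -- These vectors represent the other generators modulo v i. A form y positive on them becomes,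
  -- after subtracting (y·v i) m₁, zero on v i and positive on every other v j.
  set w : {j // j ≠ i} → Fin n → ℤ := fun j => v j - (m₁ ⬝ᵥ v j) • v i with hw
  obtain ⟨y, hy⟩ := exists_int_dotProduct_pos w (by
    intro h0
    rw [convexHull_range_eq_exists_affineCombination] at h0
    obtain ⟨s, c, hc0, hc1, hc⟩ := h0
    rw [Finset.affineCombination_eq_linear_combination _ _ _ hc1] at hc
    have hcs : ∀ j ∈ s, 0 ≤ c j := hc0
    have key : ∑ j ∈ s, c j • toReal (v j) =
        (∑ j ∈ s, c j * ((m₁ ⬝ᵥ v j : ℤ) : ℝ)) • toReal (v i) := by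
      rw [← sub_eq_zero, Finset.sum_smul, ← Finset.sum_sub_distrib, ← hc]
      refine Finset.sum_congr rfl fun j _ => ?_
      simp only [hw, toReal_sub, toReal_zsmul, smul_sub, smul_smul]
    set C := ∑ j ∈ s, c j * ((m₁ ⬝ᵥ v j : ℤ) : ℝ) with hC
    -- The relation ∑ c_j v_j = C v_i is impossible for either sign: C > 0 makes v_i superfluous,
    -- and C ≤ 0 puts the negative of some c_j v_j with c_j > 0 into the cone, against salience.
    rcases lt_or_ge 0 C with hpos | hneg
    · refine hv.minimal i ?_
      have hvi : toReal (v i) = ∑ j ∈ s, (C⁻¹ * c j) • toReal (v j) := by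
        simp_rw [← smul_smul]
        rw [← Finset.smul_sum, key, smul_smul, inv_mul_cancel₀ hpos.ne', one_smul]
      rw [hvi]
      refine Submodule.sum_mem _ fun j hj => ?_
      exact Submodule.smul_mem _ (⟨C⁻¹ * c j, mul_nonneg (inv_nonneg.2 hpos.le) (hcs j hj)⟩ :
        {c : ℝ // 0 ≤ c}) (Submodule.subset_span ⟨j, j.2, rfl⟩)
    · obtain ⟨j₀, hj₀, hcj₀⟩ : ∃ j ∈ s, 0 < c j := by
        by_contra! hcon
        have : ∑ j ∈ s, c j ≤ 0 := Finset.sum_nonpos hcon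
        linarith
      have hmem : ∀ (a : ℝ) (_ : 0 ≤ a) (j : Fin r), a • toReal (v j) ∈ σ := fun a ha j =>
        Submodule.smul_mem σ (⟨a, ha⟩ : {c : ℝ // 0 ≤ c}) (hv.mem_cone j)
      classical
      refine hσ (c j₀ • toReal (v j₀)) (hmem _ hcj₀.le _)
        (smul_ne_zero hcj₀.ne' (hv.ne_zero _)) ?_
      have : -(c j₀ • toReal (v j₀)) =
          ∑ j ∈ s.erase j₀, c j • toReal (v j) + (-C) • toReal (v i) := by
        rw [neg_smul, ← key, ← Finset.add_sum_erase s _ hj₀]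
        abel
      rw [this]
      exact Submodule.add_mem σ (Submodule.sum_mem σ fun j hj =>
        hmem _ (hcs j (Finset.mem_of_mem_erase hj)) _) (hmem _ (by linarith) _))
  refine ⟨y - (y ⬝ᵥ v i) • m₁, ?_, fun j hj => ?_⟩
  · rw [sub_dotProduct, smul_dotProduct, hm₁, smul_eq_mul, mul_one, sub_self]
  · have := hy ⟨j, hj⟩
    simp only [hw, dotProduct_sub, dotProduct_smul, smul_eq_mul] at this
    simp only [sub_dotProduct, smul_dotProduct, smul_eq_mul]
    linarith

/-- There are lattice points at height one over the `i`-th facet and arbitrarily far from the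
others. -/
theorem IsPrimitiveGenerators.exists_height_one_ge (hv : IsPrimitiveGenerators σ v)
    (hσ : (σ : ConvexCone ℝ (Fin n → ℝ)).Salient) (i : Fin r) (c : ℤ) :
    ∃ m : Fin n → ℤ, m ⬝ᵥ v i = 1 ∧ ∀ j ≠ i, c ≤ m ⬝ᵥ v j := by
  obtain ⟨m₁, hm₁⟩ := hv.exists_dotProduct_eq_one i
  obtain ⟨m₀, hm₀, hm₀'⟩ := hv.exists_facet hσ i
  set N : ℤ := ∑ j, |c - m₁ ⬝ᵥ v j| with hN
  refine ⟨m₁ + N • m₀, by rw [add_dotProduct, smul_dotProduct, hm₁, hm₀, smul_zero, add_zero],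
    fun j hj => ?_⟩
  have h1 : c - m₁ ⬝ᵥ v j ≤ N := (le_abs_self _).trans
    (Finset.single_le_sum (f := fun j => |c - m₁ ⬝ᵥ v j|) (fun _ _ => abs_nonneg _)
      (Finset.mem_univ j))
  have h0 : 0 ≤ N := Finset.sum_nonneg fun _ _ => abs_nonneg _
  have h2 := hm₀' j hj
  rw [add_dotProduct, smul_dotProduct, smul_eq_mul]
  nlinarith

/-- Subtracting a multiple of the facet point instead of adding it. With c = 0, dividing a monomial
by such a character lowers its order along one ray divisor only. -/
theorem IsPrimitiveGenerators.exists_height_one_le (hv : IsPrimitiveGenerators σ v)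
    (hσ : (σ : ConvexCone ℝ (Fin n → ℝ)).Salient) (i : Fin r) (c : ℤ) :
    ∃ m : Fin n → ℤ, m ⬝ᵥ v i = 1 ∧ ∀ j ≠ i, m ⬝ᵥ v j ≤ c := by
  obtain ⟨m₁, hm₁⟩ := hv.exists_dotProduct_eq_one i
  obtain ⟨m₀, hm₀, hm₀'⟩ := hv.exists_facet hσ i
  set N : ℤ := ∑ j, |m₁ ⬝ᵥ v j - c| with hN
  refine ⟨m₁ - N • m₀, by rw [sub_dotProduct, smul_dotProduct, hm₁, hm₀, smul_zero, sub_zero],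
    fun j hj => ?_⟩
  have h1 : m₁ ⬝ᵥ v j - c ≤ N := (le_abs_self _).trans
    (Finset.single_le_sum (f := fun j => |m₁ ⬝ᵥ v j - c|) (fun _ _ => abs_nonneg _)
      (Finset.mem_univ j))
  have h0 : 0 ≤ N := Finset.sum_nonneg fun _ _ => abs_nonneg _
  have h2 := hm₀' j hj
  rw [sub_dotProduct, smul_dotProduct, smul_eq_mul]
  nlinarith

theorem IsPrimitiveGenerators.exists_interior (hv : IsPrimitiveGenerators σ v)
    (hσ : (σ : ConvexCone ℝ (Fin n → ℝ)).Salient) :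
    ∃ m : Fin n → ℤ, ∀ i, 0 < m ⬝ᵥ v i := by
  choose m hm hm' using fun i => hv.exists_height_one_ge hσ i 0
  refine ⟨∑ i, m i, fun j => ?_⟩
  rw [sum_dotProduct]
  refine Finset.sum_pos' (fun i _ => ?_) ⟨j, Finset.mem_univ j, by simp [hm]⟩
  rcases eq_or_ne j i with rfl | h
  · simp [hm]
  · exact hm' i j h

/-- Finitely many lattice points can be moved into the dual monoid by one of its elements. -/
theorem IsPrimitiveGenerators.exists_translate (hv : IsPrimitiveGenerators σ v)
    (hσ : (σ : ConvexCone ℝ (Fin n → ℝ)).Salient) (T : Finset (Fin n → ℤ)) :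
    ∃ s ∈ dualMonoid σ, ∀ u ∈ T, u + s ∈ dualMonoid σ := by
  obtain ⟨m, hm⟩ := hv.exists_interior hσ
  set N : ℤ := ∑ u ∈ T, ∑ j, |u ⬝ᵥ v j| with hN
  have h0 : 0 ≤ N := Finset.sum_nonneg fun _ _ => Finset.sum_nonneg fun _ _ => abs_nonneg _
  refine ⟨N • m, hv.mem_dualMonoid.2 fun i => ?_, fun u hu => hv.mem_dualMonoid.2 fun i => ?_⟩
  · rw [smul_dotProduct]
    exact mul_nonneg h0 (hm i).le
  · have h1 : |u ⬝ᵥ v i| ≤ N := by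
      refine (Finset.single_le_sum (f := fun j => |u ⬝ᵥ v j|) (fun _ _ => abs_nonneg _)
        (Finset.mem_univ i)).trans ?_
      exact Finset.single_le_sum (f := fun u => ∑ j, |u ⬝ᵥ v j|)
        (fun _ _ => Finset.sum_nonneg fun _ _ => abs_nonneg _) hu
    have h2 := neg_abs_le (u ⬝ᵥ v i)
    have h3 := hm i
    rw [add_dotProduct, smul_dotProduct, smul_eq_mul]
    nlinarith

/-- The facet version: lattice points that are nonnegative on `v i` can be moved into the dual
monoid by an element of the `i`-th facet. -/
theorem IsPrimitiveGenerators.exists_facet_translate (hv : IsPrimitiveGenerators σ v)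
    (hσ : (σ : ConvexCone ℝ (Fin n → ℝ)).Salient) (i : Fin r) (T : Finset (Fin n → ℤ))
    (hT : ∀ u ∈ T, 0 ≤ u ⬝ᵥ v i) :
    ∃ s ∈ dualMonoid σ, s ⬝ᵥ v i = 0 ∧ ∀ u ∈ T, u + s ∈ dualMonoid σ := by
  obtain ⟨m, hmi, hm⟩ := hv.exists_facet hσ i
  have hm0 : ∀ j, 0 ≤ m ⬝ᵥ v j := fun j => by
    rcases eq_or_ne j i with rfl | h
    · exact hmi.ge
    · exact (hm j h).le
  set N : ℤ := ∑ u ∈ T, ∑ j, |u ⬝ᵥ v j| with hN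
  have h0 : 0 ≤ N := Finset.sum_nonneg fun _ _ => Finset.sum_nonneg fun _ _ => abs_nonneg _
  refine ⟨N • m, hv.mem_dualMonoid.2 fun j => ?_, by rw [smul_dotProduct, hmi, smul_zero],
    fun u hu => hv.mem_dualMonoid.2 fun j => ?_⟩
  · rw [smul_dotProduct]
    exact mul_nonneg h0 (hm0 j)
  · rcases eq_or_ne j i with rfl | hj
    · rw [add_dotProduct, smul_dotProduct, hmi, smul_zero, add_zero]
      exact hT u hu
    have h1 : |u ⬝ᵥ v j| ≤ N := by
      refine (Finset.single_le_sum (f := fun j => |u ⬝ᵥ v j|) (fun _ _ => abs_nonneg _)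
        (Finset.mem_univ j)).trans ?_
      exact Finset.single_le_sum (f := fun u => ∑ j, |u ⬝ᵥ v j|)
        (fun _ _ => Finset.sum_nonneg fun _ _ => abs_nonneg _) hu
    have h2 := neg_abs_le (u ⬝ᵥ v j)
    have h3 := hm j hj
    rw [add_dotProduct, smul_dotProduct, smul_eq_mul]
    nlinarith

/-- The generators of a full-dimensional cone separate points. -/
theorem IsPrimitiveGenerators.eq_zero_of_forall_dotProduct (hv : IsPrimitiveGenerators σ v)
    (hfull : Submodule.span ℝ (σ : Set (Fin n → ℝ)) = ⊤) {y : Fin n → ℝ}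
    (hy : ∀ i, y ⬝ᵥ toReal (v i) = 0) : y = 0 := by
  have h1 : ∀ x ∈ σ, 0 ≤ y ⬝ᵥ x := (hv.forall_cone_nonneg_iff y).2 fun i => (hy i).ge
  have h2 : ∀ x ∈ σ, 0 ≤ (-y) ⬝ᵥ x := (hv.forall_cone_nonneg_iff (-y)).2 fun i => by
    rw [neg_dotProduct, hy i, neg_zero]
  have h3 : ∀ x, y ⬝ᵥ x = 0 := fun x => by
    have hx : x ∈ Submodule.span ℝ (σ : Set (Fin n → ℝ)) := hfull ▸ trivial
    induction hx using Submodule.span_induction with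
    | mem x hx =>
      have := h2 x hx
      rw [neg_dotProduct] at this
      exact le_antisymm (by linarith) (h1 x hx)
    | zero => simp
    | add x z _ _ hx hz => rw [dotProduct_add, hx, hz, add_zero]
    | smul c x _ hx => rw [dotProduct_smul, hx, smul_zero]
  exact dotProduct_self_eq_zero.1 (h3 y)

theorem IsPrimitiveGenerators.eq_zero_of_forall_dotProduct_int (hv : IsPrimitiveGenerators σ v)
    (hfull : Submodule.span ℝ (σ : Set (Fin n → ℝ)) = ⊤) {y : Fin n → ℤ}
    (hy : ∀ i, y ⬝ᵥ v i = 0) : y = 0 := by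
  refine toReal_injective ?_
  rw [hv.eq_zero_of_forall_dotProduct hfull (y := toReal y) fun i => by
    rw [toReal_dotProduct_toReal, hy i, Int.cast_zero]]
  ext j
  simp [toReal]

end Cone

/-! ### Prime divisors of a domain -/

section PrimeDivisors

variable {R : Type*} [CommRing R] [IsDomain R]

theorem mem_localRing {P : Ideal R} [P.IsPrime] {x : FractionRing R} :
    x ∈ localRing R P ↔ ∃ a s : R, s ∉ P ∧
      x = algebraMap R (FractionRing R) a * (algebraMap R (FractionRing R) s)⁻¹ := by
  constructor
  · rintro ⟨a, s, hs, rfl⟩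
    exact ⟨a, s, hs, rfl⟩
  · rintro ⟨a, s, hs, rfl⟩
    exact ⟨a, s, hs, rfl⟩

theorem algebraMap_mem_localRing {P : Ideal R} [P.IsPrime] (a : R) :
    algebraMap R (FractionRing R) a ∈ localRing R P :=
  (localRing R P).algebraMap_mem a

theorem inv_algebraMap_mem_localRing {P : Ideal R} [P.IsPrime] {s : R} (hs : s ∉ P) :
    (algebraMap R (FractionRing R) s)⁻¹ ∈ localRing R P :=
  mem_localRing.2 ⟨1, s, hs, by simp⟩

theorem algebraMap_fractionRing_ne_zero {R : Type*} [CommRing R] {a : R} (ha : a ≠ 0) :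
    algebraMap R (FractionRing R) a ≠ 0 := by
  simpa using ha

/-- A uniformizer at a prime: up to elements outside the prime, every nonzero element is one of its
powers. -/
def IsUniformizerAt (P : Ideal R) (ϖ : R) : Prop :=
  ϖ ∈ P ∧ ϖ ≠ 0 ∧ ∀ f : R, f ≠ 0 → ∃ j : ℕ, ∃ a ∉ P, ∃ s ∉ P, s * f = a * ϖ ^ j

/-- A nonzero prime strictly inside P would contain some a ϖ^j with a outside P, hence ϖ, hence all
of P, because every element of P is a multiple of ϖ up to a factor outside P. -/
theorem IsUniformizerAt.height_eq_one {P : Ideal R} [hP : P.IsPrime] {ϖ : R}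
    (h : IsUniformizerAt P ϖ) : P.height = 1 := by
  obtain ⟨hϖ, hϖ0, hf⟩ := h
  refine le_antisymm ?_ ?_
  · refine (Ideal.height_le_iff (n := 1)).2 fun Q hQ hQP => ?_
    have : Q = ⊥ := by
      by_contra hne
      obtain ⟨f, hfQ, hf0⟩ := Submodule.exists_mem_ne_zero_of_ne_bot hne
      obtain ⟨j, a, ha, s, hs, h⟩ := hf f hf0
      have hϖQ : ϖ ∈ Q := by
        have h1 : a * ϖ ^ j ∈ Q := h ▸ Q.mul_mem_left s hfQ
        rcases hQ.mem_or_mem h1 with h2 | h2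
        · exact absurd (hQP.le h2) ha
        · exact hQ.mem_of_pow_mem _ h2
      refine hQP.not_ge fun g hg => ?_
      rcases eq_or_ne g 0 with rfl | hg0
      · exact Q.zero_mem
      obtain ⟨j, a, ha, s, hs, h⟩ := hf g hg0
      have hj : j ≠ 0 := by
        rintro rfl
        rw [pow_zero, mul_one] at h
        exact ha (h ▸ P.mul_mem_left s hg)
      have h1 : s * g ∈ Q := h ▸ Q.mul_mem_left a (Q.pow_mem_of_mem hϖQ _ (Nat.pos_of_ne_zero hj))
      exact (hQ.mem_or_mem h1).resolve_left fun h2 => hs (hQP.le h2)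
    subst this
    simp
  · rw [Order.one_le_iff_ne_zero, Ne, Ideal.height_eq_zero_iff_eq_bot]
    rintro rfl
    exact hϖ0 hϖ

/-- Elements outside P become units, so every nonzero element of the local ring is associated to a
power of ϖ. If ϖ were a product of two non-units, both would involve ϖ and ϖ² would divide ϖ. -/
theorem IsUniformizerAt.isDVR {P : Ideal R} [hP : P.IsPrime] {ϖ : R}
    (h : IsUniformizerAt P ϖ) : IsDiscreteValuationRing (localRing R P) := by
  obtain ⟨hϖ, hϖ0, hf⟩ := h
  have hunit : ∀ s ∉ P, IsUnit (algebraMap R (localRing R P) s) := fun s hs =>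
    IsLocalization.map_units (M := P.primeCompl) (localRing R P) ⟨s, hs⟩
  set t : localRing R P := algebraMap R (localRing R P) ϖ with ht
  have htn : ¬ IsUnit t := by
    intro hu
    have := (IsLocalization.AtPrime.isUnit_to_map_iff (localRing R P) P ϖ).1 hu
    exact this hϖ
  have ht0 : t ≠ 0 := by
    rw [ht, Ne, FaithfulSMul.algebraMap_eq_zero_iff R (localRing R P)]
    exact hϖ0
  have hassoc : ∀ x : localRing R P, x ≠ 0 → ∃ j : ℕ, Associated (t ^ j) x := by
    intro x hx
    obtain ⟨⟨f, s₁⟩, hs₁⟩ := IsLocalization.surj P.primeCompl x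
    have hf0 : f ≠ 0 := by
      rintro rfl
      rw [map_zero] at hs₁
      exact hx ((hunit s₁ s₁.2).mul_left_eq_zero.1 hs₁)
    obtain ⟨j, a, ha, s, hs, h⟩ := hf f hf0
    refine ⟨j, ?_⟩
    have e : x * (algebraMap R (localRing R P) s₁ * algebraMap R (localRing R P) s) =
        t ^ j * algebraMap R (localRing R P) a := by
      rw [← mul_assoc, hs₁, ht, ← map_pow, ← map_mul, ← map_mul, mul_comm f, h, mul_comm]
    have e1 := associated_mul_unit_right x _ ((hunit s₁ s₁.2).mul (hunit s hs))
    have e2 := associated_mul_unit_right (t ^ j) _ (hunit a ha)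
    rw [e] at e1
    exact e2.trans e1.symm
  refine IsDiscreteValuationRing.ofHasUnitMulPowIrreducibleFactorization ⟨t, ⟨htn, ?_⟩,
    fun {x} hx => hassoc x hx⟩
  intro x y hxy
  have hx0 : x ≠ 0 := by rintro rfl; exact ht0 (by simpa using hxy)
  have hy0 : y ≠ 0 := by rintro rfl; exact ht0 (by simpa using hxy)
  obtain ⟨i, hi⟩ := hassoc x hx0
  obtain ⟨j, hj⟩ := hassoc y hy0
  rcases Nat.eq_zero_or_pos i with rfl | hi0
  · left
    rw [pow_zero] at hi
    exact hi.isUnit isUnit_one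
  rcases Nat.eq_zero_or_pos j with rfl | hj0
  · right
    rw [pow_zero] at hj
    exact hj.isUnit isUnit_one
  exfalso
  have h1 : t ^ 2 ∣ t := by
    have h2 := (hi.mul_mul hj).dvd
    rw [← pow_add, ← hxy] at h2
    exact (pow_dvd_pow t (by omega)).trans h2
  rw [sq] at h1
  obtain ⟨c, hc⟩ := h1
  have : t * c = 1 := mul_left_cancel₀ ht0 (by rw [← mul_assoc, ← hc, mul_one])
  exact htn (IsUnit.of_mul_eq_one c this)

/-- The prime divisor of a prime ideal with a uniformizer. -/
def IsUniformizerAt.primeDivisor {P : Ideal R} [P.IsPrime] {ϖ : R} (h : IsUniformizerAt P ϖ) :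
    PrimeDivisor R :=
  ⟨P, inferInstance, h.height_eq_one, h.isDVR⟩

theorem PrimeDivisor.ext_ideal {P Q : PrimeDivisor R} (h : P.ideal = Q.ideal) : P = Q := by
  cases P
  cases Q
  subst h
  rfl

variable (P : PrimeDivisor R)

theorem PrimeDivisor.ord_mul {f g : FractionRing R} (hf : f ≠ 0) (hg : g ≠ 0) :
    P.ord (f * g) = P.ord f + P.ord g := by
  rw [ord, ord, ord, map_mul, WithZero.log_mul ((Valuation.ne_zero_iff _).2 hf)
    ((Valuation.ne_zero_iff _).2 hg)]
  ring

theorem PrimeDivisor.ord_inv (f : FractionRing R) : P.ord f⁻¹ = -P.ord f := by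
  rw [ord, ord, map_inv₀, WithZero.log_inv]

theorem PrimeDivisor.ord_pow (f : FractionRing R) (m : ℕ) : P.ord (f ^ m) = m * P.ord f := by
  rw [ord, ord, map_pow, WithZero.log_pow]
  simp

theorem PrimeDivisor.ord_div {f g : FractionRing R} (hf : f ≠ 0) (hg : g ≠ 0) :
    P.ord (f / g) = P.ord f - P.ord g := by
  rw [div_eq_mul_inv, P.ord_mul hf (inv_ne_zero hg), P.ord_inv, sub_eq_add_neg]

theorem PrimeDivisor.ord_nonneg_iff {f : FractionRing R} (hf : f ≠ 0) :
    0 ≤ P.ord f ↔ f ∈ localRing R P.ideal := by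
  have h := P.val_le_exp_iff hf 0
  rw [add_zero, WithZero.exp_zero] at h
  rw [← h]
  constructor
  · intro h1
    obtain ⟨x, rfl⟩ := IsDiscreteValuationRing.exists_lift_of_le_one (A := localRing R P.ideal) h1
    exact x.2
  · intro h1
    exact (IsDiscreteValuationRing.maximalIdeal (localRing R P.ideal)).valuation_le_one
      (K := FractionRing R) ⟨f, h1⟩

theorem PrimeDivisor.ord_algebraMap_nonneg (a : R) :
    0 ≤ P.ord (algebraMap R (FractionRing R) a) := by
  rcases eq_or_ne a 0 with rfl | ha
  · simp [ord]
  exact (P.ord_nonneg_iff (algebraMap_fractionRing_ne_zero ha)).2 (algebraMap_mem_localRing a)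

theorem PrimeDivisor.ord_algebraMap_eq_zero {a : R} (ha : a ∉ P.ideal) :
    P.ord (algebraMap R (FractionRing R) a) = 0 := by
  have ha0 : a ≠ 0 := by rintro rfl; exact ha P.ideal.zero_mem
  refine le_antisymm ?_ (P.ord_algebraMap_nonneg a)
  have := (P.ord_nonneg_iff (inv_ne_zero (algebraMap_fractionRing_ne_zero ha0))).2
    (inv_algebraMap_mem_localRing ha)
  rw [P.ord_inv] at this
  omega

theorem PrimeDivisor.ord_algebraMap_pos {a : R} (ha : a ∈ P.ideal) (ha0 : a ≠ 0) :
    0 < P.ord (algebraMap R (FractionRing R) a) := by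
  refine lt_of_le_of_ne (P.ord_algebraMap_nonneg a) fun h => ?_
  have hne := algebraMap_fractionRing_ne_zero ha0
  have h1 : 0 ≤ P.ord (algebraMap R (FractionRing R) a)⁻¹ := by
    rw [P.ord_inv, ← h, neg_zero]
  obtain ⟨b, s, hs, hbs⟩ := mem_localRing.1 ((P.ord_nonneg_iff (inv_ne_zero hne)).1 h1)
  have hs0 : algebraMap R (FractionRing R) s ≠ 0 := by
    refine algebraMap_fractionRing_ne_zero ?_
    rintro rfl
    exact hs P.ideal.zero_mem
  have : s = b * a := by
    apply IsFractionRing.injective R (FractionRing R)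
    rw [map_mul]
    field_simp at hbs
    rw [hbs]
    ring
  exact hs (this ▸ P.ideal.mul_mem_left b ha)

theorem PrimeDivisor.exists_ord_eq_one : ∃ z : FractionRing R, z ≠ 0 ∧ P.ord z = 1 := by
  obtain ⟨z, hz⟩ := (IsDiscreteValuationRing.maximalIdeal
    (localRing R P.ideal)).valuation_exists_uniformizer (FractionRing R)
  have hz' : P.val z = WithZero.exp (-1 : ℤ) := hz
  refine ⟨z, ?_, ?_⟩
  · rintro rfl
    rw [map_zero] at hz'
    exact WithZero.exp_ne_zero hz'.symm
  · rw [ord, hz', WithZero.log_exp, neg_neg]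

theorem PrimeDivisor.exists_ord_eq (m : ℤ) : ∃ z : FractionRing R, z ≠ 0 ∧ P.ord z = m := by
  obtain ⟨z, hz0, hz⟩ := P.exists_ord_eq_one
  refine ⟨z ^ m, zpow_ne_zero _ hz0, ?_⟩
  have h1 : P.ord z = 1 := hz
  rw [ord, map_zpow₀, WithZero.log_zpow, smul_eq_mul, ← mul_neg]
  change m * P.ord z = m
  rw [h1, mul_one]

/-- Every order is an integer multiple of that of ϖ, and the value 1 is attained. -/
theorem PrimeDivisor.ord_uniformizer {ϖ : R} (h : IsUniformizerAt P.ideal ϖ) :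
    P.ord (algebraMap R (FractionRing R) ϖ) = 1 := by
  obtain ⟨hϖ, hϖ0, hf⟩ := h
  have hpos := P.ord_algebraMap_pos hϖ hϖ0
  have hmul : ∀ f : R, f ≠ 0 → ∃ j : ℕ, P.ord (algebraMap R (FractionRing R) f) =
      j * P.ord (algebraMap R (FractionRing R) ϖ) := by
    intro f hf0
    obtain ⟨j, a, ha, s, hs, e⟩ := hf f hf0
    refine ⟨j, ?_⟩
    have ha0 : a ≠ 0 := by rintro rfl; exact ha P.ideal.zero_mem
    have hs0 : s ≠ 0 := by rintro rfl; exact hs P.ideal.zero_mem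
    have e1 := congrArg (fun x => P.ord (algebraMap R (FractionRing R) x)) e
    simp only [map_mul, map_pow] at e1
    rw [P.ord_mul (algebraMap_fractionRing_ne_zero hs0) (algebraMap_fractionRing_ne_zero hf0),
      P.ord_mul (algebraMap_fractionRing_ne_zero ha0)
        (pow_ne_zero _ (algebraMap_fractionRing_ne_zero hϖ0)),
      P.ord_algebraMap_eq_zero ha, P.ord_algebraMap_eq_zero hs, P.ord_pow] at e1
    omega
  obtain ⟨z, hz0, hz⟩ := P.exists_ord_eq_one
  obtain ⟨f, g, hg, rfl⟩ := IsFractionRing.div_surjective R z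
  have hg0 : g ≠ 0 := nonZeroDivisors.ne_zero hg
  have hf0 : f ≠ 0 := by rintro rfl; simp at hz0
  obtain ⟨i, hi⟩ := hmul f hf0
  obtain ⟨j, hj⟩ := hmul g hg0
  rw [P.ord_div (algebraMap_fractionRing_ne_zero hf0) (algebraMap_fractionRing_ne_zero hg0),
    hi, hj, ← sub_mul] at hz
  exact Int.eq_one_of_mul_eq_one_left hpos.le hz

end PrimeDivisors

/-! ### Monoid algebras and their group algebras -/

section GroupAlgebra

/-- The Laurent polynomial ring `k[ℤⁿ]`. -/
abbrev Laurent (k : Type*) [Field k] (n : ℕ) : Type _ := AddMonoidAlgebra k (Fin n → ℤ)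

variable (k : Type*) [Field k]

/-- The algebra of a commutative group generated by a submonoid is the localization of the monoid
algebra at the monomials. -/
theorem isLocalization_monomials {A G : Type*} [AddCommMonoid A] [AddCommGroup G] (i : A →+ G)
    (hi : Function.Injective i) (h : ∀ g, ∃ a b, g + i b = i a) :
    letI := (AddMonoidAlgebra.mapDomainRingHom k i).toAlgebra
    IsLocalization (MonoidHom.mrange (AddMonoidAlgebra.of k A)) (AddMonoidAlgebra k G) := by
  let _ := (AddMonoidAlgebra.mapDomainRingHom k i).toAlgebra
  have halg : ∀ x, algebraMap (AddMonoidAlgebra k A) (AddMonoidAlgebra k G) x =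
      AddMonoidAlgebra.mapDomain i x := fun x => rfl
  rw [isLocalization_iff]
  refine ⟨?_, ?_, ?_⟩
  · rintro ⟨_, a, rfl⟩
    refine IsUnit.of_mul_eq_one (AddMonoidAlgebra.single (-(i a.toAdd)) 1) ?_
    rw [halg]
    change AddMonoidAlgebra.mapDomain i (AddMonoidAlgebra.single a.toAdd 1) * _ = _
    rw [AddMonoidAlgebra.mapDomain_single, AddMonoidAlgebra.single_mul_single, add_neg_cancel,
      mul_one]
    rfl
  · intro z
    suffices ∃ (f : AddMonoidAlgebra k A) (a : A),
        z * AddMonoidAlgebra.single (i a) 1 = AddMonoidAlgebra.mapDomain i f by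
      obtain ⟨f, a, hfa⟩ := this
      refine ⟨(f, ⟨AddMonoidAlgebra.single a 1, Multiplicative.ofAdd a, rfl⟩), ?_⟩
      rw [halg, halg, AddMonoidAlgebra.mapDomain_single]
      exact hfa
    induction z using AddMonoidAlgebra.induction_linear with
    | zero => exact ⟨0, 0, by simp⟩
    | add x y hx hy =>
      obtain ⟨f, a, hf⟩ := hx
      obtain ⟨g, b, hg⟩ := hy
      refine ⟨f * AddMonoidAlgebra.single b 1 + g * AddMonoidAlgebra.single a 1, a + b, ?_⟩
      rw [AddMonoidAlgebra.mapDomain_add, AddMonoidAlgebra.mapDomain_mul,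
        AddMonoidAlgebra.mapDomain_mul, ← hf, ← hg, AddMonoidAlgebra.mapDomain_single,
        AddMonoidAlgebra.mapDomain_single, map_add,
        ← one_mul (1 : k), ← AddMonoidAlgebra.single_mul_single, one_mul]
      ring
    | single g c =>
      obtain ⟨a, b, hab⟩ := h g
      refine ⟨AddMonoidAlgebra.single a c, b, ?_⟩
      rw [AddMonoidAlgebra.single_mul_single, AddMonoidAlgebra.mapDomain_single, hab, mul_one]
  · intro x y hxy
    refine ⟨1, ?_⟩
    rw [AddMonoidAlgebra.mapDomain_injective hi hxy]

/-- A localization of a polynomial ring. Unique factorization makes it possible to test poles on the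
torus one prime element at a time. -/
instance (n : ℕ) : UniqueFactorizationMonoid (Laurent k n) := by
  set i : (Fin n →₀ ℕ) →+ (Fin n → ℤ) :=
    { toFun := fun f j => (f j : ℤ)
      map_zero' := by ext; simp
      map_add' := fun f g => by ext; simp } with hi
  let _ := (AddMonoidAlgebra.mapDomainRingHom k i).toAlgebra
  have := isLocalization_monomials k i (fun f g h => by
    ext j
    have := congrFun h j
    simpa [hi] using this) (fun g => by
    refine ⟨Finsupp.equivFunOnFinite.symm fun j => (g j).toNat,
      Finsupp.equivFunOnFinite.symm fun j => (-g j).toNat, ?_⟩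
    ext j
    simp [hi]
    omega)
  have : UniqueFactorizationMonoid (AddMonoidAlgebra k (Fin n →₀ ℕ)) :=
    inferInstanceAs (UniqueFactorizationMonoid (MvPolynomial (Fin n) k))
  exact UniqueFactorizationMonoid.of_isLocalization
    (MonoidHom.mrange (AddMonoidAlgebra.of k (Fin n →₀ ℕ))) (Laurent k n)

variable {k} {n : ℕ}

theorem isUnit_single (u : Fin n → ℤ) :
    IsUnit (AddMonoidAlgebra.single u 1 : Laurent k n) := by
  refine IsUnit.of_mul_eq_one (AddMonoidAlgebra.single (-u) 1) ?_
  rw [AddMonoidAlgebra.single_mul_single, add_neg_cancel, mul_one]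
  rfl

theorem coeff_single_one_mul (u w : Fin n → ℤ) (f : Laurent k n) :
    (AddMonoidAlgebra.single u 1 * f).coeff w = f.coeff (w - u) := by
  rw [AddMonoidAlgebra.coeff_single_mul_apply, one_mul, neg_add_eq_sub]

end GroupAlgebra

/-! ### The toric ring inside the Laurent polynomial ring -/

section Toric

variable {k : Type*} [Field k] {n r : ℕ} {σ : PointedCone ℝ (Fin n → ℝ)}

variable (k σ) in
/-- The inclusion of the toric ring in the Laurent polynomial ring. -/
def incl : ToricRing k σ →+* Laurent k n :=
  AddMonoidAlgebra.mapDomainRingHom k (dualMonoid σ).subtype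

theorem incl_single (u : dualMonoid σ) (c : k) :
    incl k σ (AddMonoidAlgebra.single u c) = AddMonoidAlgebra.single (u : Fin n → ℤ) c :=
  AddMonoidAlgebra.mapDomain_single

theorem coeff_incl (f : ToricRing k σ) (u : dualMonoid σ) :
    (incl k σ f).coeff u = f.coeff u :=
  Finsupp.mapDomain_apply Subtype.val_injective f.coeff u

theorem coeff_incl_of_notMem (f : ToricRing k σ) {u : Fin n → ℤ} (hu : u ∉ dualMonoid σ) :
    (incl k σ f).coeff u = 0 :=
  Finsupp.mapDomain_of_notMem_range f.coeff u (by
    rintro ⟨w, rfl⟩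
    exact hu w.2)

theorem incl_injective : Function.Injective (incl k σ) :=
  AddMonoidAlgebra.mapDomain_injective Subtype.val_injective

theorem exists_incl_eq {f : Laurent k n} (hf : ∀ u ∈ f.coeff.support, u ∈ dualMonoid σ) :
    ∃ g, incl k σ g = f :=
  ⟨AddMonoidAlgebra.comapDomain Subtype.val Subtype.val_injective f,
    AddMonoidAlgebra.mapDomain_comapDomain (fun u hu => ⟨⟨u, hf u hu⟩, rfl⟩) _⟩

/-! ### Face ideals -/

/-- Since w is nonnegative on S, the exponents off the face u·w = 0 are closed under adding elements
of S. The ideal they generate is therefore exactly their span. -/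
theorem mem_rayIdeal {w : Fin n → ℤ} (hw : ∀ u ∈ dualMonoid σ, 0 ≤ u ⬝ᵥ w) {f : ToricRing k σ} :
    f ∈ rayIdeal k σ w ↔ ∀ u : dualMonoid σ, (u : Fin n → ℤ) ⬝ᵥ w = 0 → f.coeff u = 0 := by
  have h := AddMonoidAlgebra.mem_ideal_span_of'_image (k := k) (A := dualMonoid σ)
    (s := {u | (u : Fin n → ℤ) ⬝ᵥ w ≠ 0}) (x := f)
  refine h.trans ⟨fun h u hu => ?_, fun h u hu => ?_⟩
  · by_contra hne
    obtain ⟨m, hm, d, rfl⟩ := h u (Finsupp.mem_support_iff.2 hne)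
    have h1 := hw d d.2
    have h2 := hw m m.2
    have h3 : (m : Fin n → ℤ) ⬝ᵥ w ≠ 0 := hm
    rw [AddSubmonoid.coe_add, add_dotProduct] at hu
    omega
  · exact ⟨u, fun h0 => (Finsupp.mem_support_iff.1 hu) (h u h0), 0, (zero_add u).symm⟩

variable (k) in
open Classical in
/-- The projection of the toric ring onto the monomials on a face. -/
def faceProj {w : Fin n → ℤ} (hw : ∀ u ∈ dualMonoid σ, 0 ≤ u ⬝ᵥ w) :
    ToricRing k σ →ₐ[k] ToricRing k σ :=
  AddMonoidAlgebra.lift k (ToricRing k σ) (dualMonoid σ)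
    { toFun := fun u =>
        if (u.toAdd : Fin n → ℤ) ⬝ᵥ w = 0 then AddMonoidAlgebra.single u.toAdd 1 else 0
      map_one' := by simp [AddMonoidAlgebra.one_def]
      map_mul' := fun a b => by
        have ha := hw _ a.toAdd.2
        have hb := hw _ b.toAdd.2
        have h : ((a * b).toAdd : Fin n → ℤ) ⬝ᵥ w =
          (a.toAdd : Fin n → ℤ) ⬝ᵥ w + (b.toAdd : Fin n → ℤ) ⬝ᵥ w := by
          rw [toAdd_mul, AddSubmonoid.coe_add, add_dotProduct]
        rw [h]
        by_cases h1 : (a.toAdd : Fin n → ℤ) ⬝ᵥ w = 0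
        · by_cases h2 : (b.toAdd : Fin n → ℤ) ⬝ᵥ w = 0
          · rw [if_pos h1, if_pos h2, if_pos (by omega), AddMonoidAlgebra.single_mul_single,
              mul_one, toAdd_mul]
          · rw [if_neg h2, if_neg (by omega), mul_zero]
        · rw [if_neg h1, if_neg (by omega), zero_mul] }

open Classical in
theorem coeff_faceProj {w : Fin n → ℤ} (hw : ∀ u ∈ dualMonoid σ, 0 ≤ u ⬝ᵥ w)
    (f : ToricRing k σ) (u : dualMonoid σ) :
    (faceProj k hw f).coeff u = if (u : Fin n → ℤ) ⬝ᵥ w = 0 then f.coeff u else 0 := by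
  induction f using AddMonoidAlgebra.induction_linear with
  | zero => simp
  | add f g hf hg =>
    rw [map_add, AddMonoidAlgebra.coeff_add, Finsupp.add_apply, hf, hg]
    split_ifs <;> simp
  | single m c =>
    rw [faceProj, AddMonoidAlgebra.lift_single]
    simp only [MonoidHom.coe_mk, OneHom.coe_mk, toAdd_ofAdd]
    by_cases h : m = u
    · subst h
      split_ifs <;> simp
    · split_ifs <;> simp [h]

/-- The ideal is the kernel of the face projection, a ring homomorphism into a domain. -/
theorem isPrime_rayIdeal {w : Fin n → ℤ} (hw : ∀ u ∈ dualMonoid σ, 0 ≤ u ⬝ᵥ w) :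
    (rayIdeal k σ w).IsPrime := by
  classical
  have : rayIdeal k σ w = RingHom.ker (faceProj k hw) := by
    ext f
    rw [mem_rayIdeal hw, RingHom.mem_ker, ← AddMonoidAlgebra.coeff_inj, Finsupp.ext_iff]
    simp only [coeff_faceProj, AddMonoidAlgebra.coeff_zero, Finsupp.coe_zero, Pi.zero_apply,
      ite_eq_right_iff]
  rw [this]
  exact RingHom.ker_isPrime _

theorem monomial_mem_rayIdeal {w : Fin n → ℤ} (hw : ∀ u ∈ dualMonoid σ, 0 ≤ u ⬝ᵥ w)
    {u : dualMonoid σ} : monomial k σ u ∈ rayIdeal k σ w ↔ (u : Fin n → ℤ) ⬝ᵥ w ≠ 0 := by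
  rw [mem_rayIdeal hw]
  constructor
  · intro h h0
    simpa [monomial] using h u h0
  · intro h m hm
    rw [monomial, AddMonoidAlgebra.coeff_single, Finsupp.single_apply, if_neg]
    rintro rfl
    exact h hm

theorem monomial_ne_zero (u : dualMonoid σ) : monomial k σ u ≠ 0 := by
  simp [monomial]

theorem monomial_add (u w : dualMonoid σ) :
    monomial k σ (u + w) = monomial k σ u * monomial k σ w := by
  rw [monomial, monomial, monomial, AddMonoidAlgebra.single_mul_single, mul_one]

theorem monomial_zero : monomial k σ 0 = 1 := rfl

variable {v : Fin r → Fin n → ℤ} (hv : IsPrimitiveGenerators σ v)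

theorem IsPrimitiveGenerators.dotProduct_nonneg
    (hv : IsPrimitiveGenerators σ v) (i : Fin r) :
    ∀ u ∈ dualMonoid σ, 0 ≤ u ⬝ᵥ v i := fun _ hu => hv.mem_dualMonoid.1 hu i

/-- Two elements of S summing to zero pair to zero with every ray, so both vanish by
full-dimensionality. No nontrivial monomial therefore divides 1. -/
theorem IsPrimitiveGenerators.mem_maxIdeal
    (hv : IsPrimitiveGenerators σ v)
    (hfull : Submodule.span ℝ (σ : Set (Fin n → ℝ)) = ⊤) {f : ToricRing k σ} :
    f ∈ maxIdeal k σ ↔ f.coeff 0 = 0 := by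
  have h := AddMonoidAlgebra.mem_ideal_span_of'_image (k := k) (A := dualMonoid σ)
    (s := {u | u ≠ 0}) (x := f)
  refine h.trans ⟨fun h => ?_, fun h u hu => ?_⟩
  · by_contra hne
    obtain ⟨m, hm, d, hmd⟩ := h 0 (Finsupp.mem_support_iff.2 hne)
    refine hm (Subtype.ext (hv.eq_zero_of_forall_dotProduct_int hfull fun i => ?_))
    have h1 := hv.dotProduct_nonneg i d d.2
    have h2 := hv.dotProduct_nonneg i m m.2
    have h3 := congrArg (fun u : dualMonoid σ => (u : Fin n → ℤ) ⬝ᵥ v i) hmd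
    simp only [AddSubmonoid.coe_zero, zero_dotProduct, AddSubmonoid.coe_add, add_dotProduct] at h3
    omega
  · exact ⟨u, fun h0 => (Finsupp.mem_support_iff.1 hu) (h0 ▸ h), 0, (zero_add u).symm⟩

/-- The origin is the face of S cut out by the sum of all rays, so this is another face ideal. -/
theorem IsPrimitiveGenerators.isPrime_maxIdeal
    (hv : IsPrimitiveGenerators σ v)
    (hfull : Submodule.span ℝ (σ : Set (Fin n → ℝ)) = ⊤) : (maxIdeal k σ).IsPrime := by
  have hw : ∀ u ∈ dualMonoid σ, 0 ≤ u ⬝ᵥ ∑ i, v i := fun u hu => by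
    rw [dotProduct_sum]
    exact Finset.sum_nonneg fun i _ => hv.dotProduct_nonneg i u hu
  have : maxIdeal k σ = rayIdeal k σ (∑ i, v i) := by
    ext f
    rw [hv.mem_maxIdeal hfull, mem_rayIdeal hw]
    constructor
    · intro h u hu
      have : u = 0 := by
        refine Subtype.ext (hv.eq_zero_of_forall_dotProduct_int hfull fun i => ?_)
        rw [dotProduct_sum, Finset.sum_eq_zero_iff_of_nonneg
          fun i _ => hv.dotProduct_nonneg i u u.2] at hu
        exact hu i (Finset.mem_univ i)
      rw [this, h]
    · intro h
      exact h 0 (by simp)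
  rw [this]
  exact isPrime_rayIdeal hw

/-! ### The fraction field -/

variable (hσ : (σ : ConvexCone ℝ (Fin n → ℝ)).Salient)

theorem IsPrimitiveGenerators.isLocalization_incl
    (hv : IsPrimitiveGenerators σ v)
    (hσ : (σ : ConvexCone ℝ (Fin n → ℝ)).Salient) :
    letI := (incl k σ).toAlgebra
    IsLocalization (MonoidHom.mrange (AddMonoidAlgebra.of k (dualMonoid σ))) (Laurent k n) := by
  refine isLocalization_monomials k (dualMonoid σ).subtype Subtype.val_injective fun g => ?_
  obtain ⟨s, hs, h⟩ := hv.exists_translate hσ {g}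
  exact ⟨⟨g + s, h g (Finset.mem_singleton_self g)⟩, ⟨s, hs⟩, rfl⟩

variable (k) in
/-- The Laurent polynomial ring as a subring of the fraction field of the toric ring. -/
def toFrac : Laurent k n →+* FractionRing (ToricRing k σ) :=
  letI := (incl k σ).toAlgebra
  letI := hv.isLocalization_incl (k := k) hσ
  IsLocalization.lift (M := MonoidHom.mrange (AddMonoidAlgebra.of k (dualMonoid σ)))
    (g := algebraMap (ToricRing k σ) (FractionRing (ToricRing k σ))) (by
      rintro ⟨_, u, rfl⟩
      exact isUnit_iff_ne_zero.2 (algebraMap_fractionRing_ne_zero (monomial_ne_zero _)))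

theorem toFrac_incl (f : ToricRing k σ) :
    toFrac k hv hσ (incl k σ f) = algebraMap _ (FractionRing (ToricRing k σ)) f := by
  let _ := (incl k σ).toAlgebra
  let _ := hv.isLocalization_incl (k := k) hσ
  exact IsLocalization.lift_eq (M := MonoidHom.mrange (AddMonoidAlgebra.of k (dualMonoid σ))) _ f

theorem exists_incl_mul
    (hv : IsPrimitiveGenerators σ v)
    (hσ : (σ : ConvexCone ℝ (Fin n → ℝ)).Salient) (f : Laurent k n) :
    ∃ (s : dualMonoid σ) (g : ToricRing k σ),
      incl k σ g = AddMonoidAlgebra.single (s : Fin n → ℤ) 1 * f := by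
  obtain ⟨s, hs, h⟩ := hv.exists_translate hσ f.coeff.support
  obtain ⟨g, hg⟩ := exists_incl_eq (σ := σ) (f := AddMonoidAlgebra.single s 1 * f) (by
    intro u hu
    rw [Finsupp.mem_support_iff, coeff_single_one_mul] at hu
    have := h _ (Finsupp.mem_support_iff.2 hu)
    rwa [sub_add_cancel] at this)
  exact ⟨⟨s, hs⟩, g, hg⟩

theorem toFrac_single_ne_zero (u : Fin n → ℤ) :
    toFrac k hv hσ (AddMonoidAlgebra.single u 1) ≠ 0 :=
  ((isUnit_single u).map (toFrac k hv hσ)).ne_zero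

theorem toFrac_injective : Function.Injective (toFrac k hv hσ) := by
  rw [injective_iff_map_eq_zero]
  intro f hf
  obtain ⟨s, g, hg⟩ := exists_incl_mul hv hσ f
  have h := congrArg (toFrac k hv hσ) hg
  rw [toFrac_incl, map_mul, hf, mul_zero] at h
  have hg0 : g = 0 := by simpa using h
  rw [hg0, map_zero] at hg
  exact ((isUnit_single (k := k) (s : Fin n → ℤ)).mul_right_eq_zero.1 hg.symm)

theorem toFrac_ne_zero {f : Laurent k n} (hf : f ≠ 0) : toFrac k hv hσ f ≠ 0 := by
  rwa [Ne, map_eq_zero_iff _ (toFrac_injective hv hσ)]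

theorem toFrac_monomial (u : dualMonoid σ) :
    toFrac k hv hσ (AddMonoidAlgebra.single (u : Fin n → ℤ) 1) =
      algebraMap _ (FractionRing (ToricRing k σ)) (monomial k σ u) := by
  rw [← toFrac_incl hv hσ, monomial, incl_single]

theorem isFractionRing_toFrac :
    letI := (toFrac k hv hσ).toAlgebra
    IsFractionRing (Laurent k n) (FractionRing (ToricRing k σ)) := by
  let _ := (toFrac k hv hσ).toAlgebra
  have : FaithfulSMul (Laurent k n) (FractionRing (ToricRing k σ)) :=
    (faithfulSMul_iff_algebraMap_injective _ _).2 (toFrac_injective hv hσ)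
  refine IsFractionRing.of_field _ _ fun z => ?_
  obtain ⟨x, y, _, h⟩ := IsFractionRing.div_surjective (ToricRing k σ) z
  exact ⟨incl k σ x, incl k σ y, by
    change z = toFrac k hv hσ _ / toFrac k hv hσ _
    rw [toFrac_incl, toFrac_incl, h]⟩

end Toric

/-! ### Torus-invariant prime divisors -/

/-- The number of prime factors of b, counted with multiplicity, is a sufficient exponent. -/
theorem exists_dvd_pow_of_forall_prime_dvd {A : Type*} [CommRing A] [IsDomain A]
    [UniqueFactorizationMonoid A] {b s : A} (hb : b ≠ 0) (h : ∀ π, Prime π → π ∣ b → π ∣ s) :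
    ∃ N : ℕ, b ∣ s ^ N := by
  obtain ⟨m, hm, hmb⟩ := UniqueFactorizationMonoid.exists_prime_factors b hb
  refine ⟨m.card, hmb.symm.dvd.trans ?_⟩
  have hd : ∀ π ∈ m, π ∣ s := fun π hπ =>
    h π (hm π hπ) ((Multiset.dvd_prod hπ).trans hmb.dvd)
  clear hm hmb
  induction m using Multiset.induction_on with
  | empty => simp
  | cons a m ih =>
    rw [Multiset.prod_cons, Multiset.card_cons, pow_succ']
    exact mul_dvd_mul (hd a (Multiset.mem_cons_self a m))
      (ih fun π hπ => hd π (Multiset.mem_cons_of_mem hπ))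

section Toric

variable {k : Type*} [Field k] {n r : ℕ} {σ : PointedCone ℝ (Fin n → ℝ)}
  {v : Fin r → Fin n → ℤ} (hv : IsPrimitiveGenerators σ v)
  (hσ : (σ : ConvexCone ℝ (Fin n → ℝ)).Salient)

/-- A Laurent polynomial without pole along the `i`-th divisor lies in the local ring there. -/
theorem exists_facet_incl_mul
    (hv : IsPrimitiveGenerators σ v)
    (hσ : (σ : ConvexCone ℝ (Fin n → ℝ)).Salient) (i : Fin r) {f : Laurent k n}
    (hf : ∀ u ∈ f.coeff.support, 0 ≤ u ⬝ᵥ v i) :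
    ∃ (s : dualMonoid σ) (g : ToricRing k σ), (s : Fin n → ℤ) ⬝ᵥ v i = 0 ∧
      incl k σ g = AddMonoidAlgebra.single (s : Fin n → ℤ) 1 * f ∧
      ((∃ u ∈ f.coeff.support, u ⬝ᵥ v i = 0) → g ∉ rayIdeal k σ (v i)) := by
  obtain ⟨s, hs, hsi, h⟩ := hv.exists_facet_translate hσ i f.coeff.support hf
  obtain ⟨g, hg⟩ := exists_incl_eq (σ := σ) (f := AddMonoidAlgebra.single s 1 * f) (by
    intro u hu
    rw [Finsupp.mem_support_iff, coeff_single_one_mul] at hu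
    have := h _ (Finsupp.mem_support_iff.2 hu)
    rwa [sub_add_cancel] at this)
  refine ⟨⟨s, hs⟩, g, hsi, hg, ?_⟩
  rintro ⟨u, hu, hui⟩ hmem
  have h1 := (mem_rayIdeal (hv.dotProduct_nonneg i)).1 hmem ⟨u + s, h u hu⟩ (by
    rw [add_dotProduct, hui, hsi, add_zero])
  rw [← coeff_incl, hg, coeff_single_one_mul, add_sub_cancel_right] at h1
  exact Finsupp.mem_support_iff.1 hu h1

theorem isUniformizerAt_rayIdeal
    (hv : IsPrimitiveGenerators σ v)
    (hσ : (σ : ConvexCone ℝ (Fin n → ℝ)).Salient) (i : Fin r) {m : dualMonoid σ}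
    (hm : (m : Fin n → ℤ) ⬝ᵥ v i = 1) :
    IsUniformizerAt (rayIdeal k σ (v i)) (monomial k σ m) := by
  have hnn := hv.dotProduct_nonneg i
  refine ⟨(monomial_mem_rayIdeal hnn).2 (by rw [hm]; exact one_ne_zero), monomial_ne_zero m,
    fun f hf => ?_⟩
  have hf' : incl k σ f ≠ 0 := by
    rwa [Ne, map_eq_zero_iff _ incl_injective]
  have hne : (incl k σ f).coeff.support.Nonempty := by
    rw [Finsupp.support_nonempty_iff]
    exact fun h => hf' (AddMonoidAlgebra.coeff_eq_zero.1 h)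
  -- The exponent j of the uniformizer is the least height of a term of f. Dividing by χ^{jm} brings
  -- that term to height 0, so the quotient, moved into the ring by a facet monomial, is outside the
  -- ray ideal.
  obtain ⟨u₀, hu₀, hmin⟩ := Finset.exists_min_image _ (fun u => u ⬝ᵥ v i) hne
  have hu₀S : u₀ ∈ dualMonoid σ := by
    by_contra hcon
    exact Finsupp.mem_support_iff.1 hu₀ (coeff_incl_of_notMem f hcon)
  obtain ⟨j, hj⟩ := Int.eq_ofNat_of_zero_le (hnn u₀ hu₀S)
  have hjm : ((j : ℤ) • (m : Fin n → ℤ)) ⬝ᵥ v i = j := by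
    rw [smul_dotProduct, hm, smul_eq_mul, mul_one]
  obtain ⟨s, a, hs, ha, hau⟩ := exists_facet_incl_mul (k := k) hv hσ i
    (f := AddMonoidAlgebra.single (-((j : ℤ) • (m : Fin n → ℤ))) 1 * incl k σ f) (by
      intro u hu
      rw [Finsupp.mem_support_iff, coeff_single_one_mul] at hu
      have := hmin _ (Finsupp.mem_support_iff.2 hu)
      rw [sub_neg_eq_add, add_dotProduct, hjm, hj] at this
      omega)
  refine ⟨j, a, hau ⟨u₀ - (j : ℤ) • (m : Fin n → ℤ), ?_, ?_⟩, monomial k σ s, ?_, ?_⟩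
  · rw [Finsupp.mem_support_iff, coeff_single_one_mul, sub_neg_eq_add, sub_add_cancel]
    exact Finsupp.mem_support_iff.1 hu₀
  · rw [sub_dotProduct, hjm, hj, sub_self]
  · rw [monomial_mem_rayIdeal hnn, not_not]
    exact hs
  · apply incl_injective
    rw [map_mul, map_mul, ha, map_pow, monomial, monomial, incl_single, incl_single,
      AddMonoidAlgebra.single_pow, one_pow, mul_assoc, mul_right_comm _ (incl k σ f),
      AddMonoidAlgebra.single_mul_single, natCast_zsmul, neg_add_cancel, mul_one,
      ← AddMonoidAlgebra.one_def, one_mul]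

theorem exists_height_one_mem
    (hv : IsPrimitiveGenerators σ v)
    (hσ : (σ : ConvexCone ℝ (Fin n → ℝ)).Salient) (i : Fin r) :
    ∃ m : dualMonoid σ, (m : Fin n → ℤ) ⬝ᵥ v i = 1 := by
  obtain ⟨m, hm, hm'⟩ := hv.exists_height_one_ge hσ i 0
  refine ⟨⟨m, hv.mem_dualMonoid.2 fun j => ?_⟩, hm⟩
  rcases eq_or_ne j i with rfl | h
  · rw [hm]; exact zero_le_one
  · exact hm' j h

variable (k) in
/-- The torus-invariant prime divisor of the `i`-th ray. -/
def rayDivisor (i : Fin r) : PrimeDivisor (ToricRing k σ) :=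
  haveI := isPrime_rayIdeal (k := k) (hv.dotProduct_nonneg i)
  (isUniformizerAt_rayIdeal (k := k) hv hσ i (exists_height_one_mem hv hσ i).choose_spec).primeDivisor

theorem rayDivisor_ideal (i : Fin r) : (rayDivisor k hv hσ i).ideal = rayIdeal k σ (v i) := rfl

theorem ord_toFrac_single_add (P : PrimeDivisor (ToricRing k σ)) (u w : Fin n → ℤ) :
    P.ord (toFrac k hv hσ (AddMonoidAlgebra.single (u + w) 1)) =
      P.ord (toFrac k hv hσ (AddMonoidAlgebra.single u 1)) +
        P.ord (toFrac k hv hσ (AddMonoidAlgebra.single w 1)) := by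
  rw [← P.ord_mul (toFrac_single_ne_zero hv hσ u) (toFrac_single_ne_zero hv hσ w), ← map_mul,
    AddMonoidAlgebra.single_mul_single, mul_one]

theorem ord_toFrac_single_zsmul (P : PrimeDivisor (ToricRing k σ)) (j : ℤ) (u : Fin n → ℤ) :
    P.ord (toFrac k hv hσ (AddMonoidAlgebra.single (j • u) 1)) =
      j * P.ord (toFrac k hv hσ (AddMonoidAlgebra.single u 1)) := by
  have := map_zsmul (AddMonoidHom.mk' (fun u : Fin n → ℤ =>
    P.ord (toFrac k hv hσ (AddMonoidAlgebra.single u 1))) (ord_toFrac_single_add hv hσ P)) j u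
  simpa using this

theorem ord_toFrac_single_of_notMem (P : PrimeDivisor (ToricRing k σ)) {u : dualMonoid σ}
    (hu : monomial k σ u ∉ P.ideal) :
    P.ord (toFrac k hv hσ (AddMonoidAlgebra.single (u : Fin n → ℤ) 1)) = 0 := by
  rw [toFrac_monomial]
  exact P.ord_algebraMap_eq_zero hu

/-- Write u = (u·v i) m + w with χ^m a uniformizer and w of height 0. Then w is a difference of two
elements of S on the facet, whose monomials are units at the divisor. -/
theorem ord_rayDivisor_single (i : Fin r) (u : Fin n → ℤ) :
    (rayDivisor k hv hσ i).ord (toFrac k hv hσ (AddMonoidAlgebra.single u 1)) = u ⬝ᵥ v i := by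
  have hnn := hv.dotProduct_nonneg i
  obtain ⟨m, hm⟩ := exists_height_one_mem hv hσ i
  have hm1 : (rayDivisor k hv hσ i).ord
      (toFrac k hv hσ (AddMonoidAlgebra.single (m : Fin n → ℤ) 1)) = 1 := by
    rw [toFrac_monomial]
    exact (rayDivisor k hv hσ i).ord_uniformizer (isUniformizerAt_rayIdeal hv hσ i hm)
  have hface : ∀ s : dualMonoid σ, (s : Fin n → ℤ) ⬝ᵥ v i = 0 → (rayDivisor k hv hσ i).ord
      (toFrac k hv hσ (AddMonoidAlgebra.single (s : Fin n → ℤ) 1)) = 0 := fun s hs =>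
    ord_toFrac_single_of_notMem hv hσ _ (by
      rw [rayDivisor_ideal, monomial_mem_rayIdeal hnn, not_not]
      exact hs)
  set w := u - (u ⬝ᵥ v i) • (m : Fin n → ℤ) with hw
  have hwi : w ⬝ᵥ v i = 0 := by
    rw [hw, sub_dotProduct, smul_dotProduct, hm, smul_eq_mul, mul_one, sub_self]
  obtain ⟨s, hs, hsi, hsw⟩ := hv.exists_facet_translate hσ i {w} (by simp [hwi])
  have h1 := hface ⟨s, hs⟩ hsi
  have h2 := hface ⟨w + s, hsw w (Finset.mem_singleton_self w)⟩ (by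
    rw [add_dotProduct, hwi, hsi, add_zero])
  rw [ord_toFrac_single_add, h1, add_zero] at h2
  have h3 : u = w + (u ⬝ᵥ v i) • (m : Fin n → ℤ) := by rw [hw, sub_add_cancel]
  conv_lhs => rw [h3]
  rw [ord_toFrac_single_add, ord_toFrac_single_zsmul, h2, hm1, zero_add, mul_one]

/-- The order is in fact the least height of a term: after dividing by a term of least height, what
remains is a unit at the divisor up to a facet monomial. -/
theorem ord_rayDivisor_le (i : Fin r) {f : Laurent k n} {u : Fin n → ℤ}
    (hu : u ∈ f.coeff.support) :
    (rayDivisor k hv hσ i).ord (toFrac k hv hσ f) ≤ u ⬝ᵥ v i := by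
  have hnn := hv.dotProduct_nonneg i
  obtain ⟨u₀, hu₀, hmin⟩ := Finset.exists_min_image _ (fun u => u ⬝ᵥ v i) ⟨u, hu⟩
  refine le_trans (le_of_eq ?_) (hmin u hu)
  have hf0 : f ≠ 0 := by
    rintro rfl
    simp at hu
  obtain ⟨s, a, hs, ha, hau⟩ := exists_facet_incl_mul (k := k) hv hσ i
    (f := AddMonoidAlgebra.single (-u₀) 1 * f) (by
      intro w hw
      rw [Finsupp.mem_support_iff, coeff_single_one_mul] at hw
      have := hmin _ (Finsupp.mem_support_iff.2 hw)
      rw [sub_neg_eq_add, add_dotProduct] at this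
      omega)
  have haP := (rayDivisor k hv hσ i).ord_algebraMap_eq_zero (hau ⟨0, by
    rw [Finsupp.mem_support_iff, coeff_single_one_mul, sub_neg_eq_add, zero_add]
    exact Finsupp.mem_support_iff.1 hu₀, by simp⟩)
  rw [← toFrac_incl hv hσ, ha, map_mul, map_mul, PrimeDivisor.ord_mul _
    (toFrac_single_ne_zero hv hσ _) (mul_ne_zero (toFrac_single_ne_zero hv hσ _)
    (toFrac_ne_zero hv hσ hf0)), PrimeDivisor.ord_mul _
    (toFrac_single_ne_zero hv hσ _) (toFrac_ne_zero hv hσ hf0), ord_rayDivisor_single,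
    ord_rayDivisor_single, hs, neg_dotProduct] at haP
  omega

/-- A prime divisor is not torus-invariant if its ideal contains no monomials. -/
def IsNontoric (P : PrimeDivisor (ToricRing k σ)) : Prop :=
  ∀ u, monomial k σ u ∉ P.ideal

theorem IsNontoric.ord_single {P : PrimeDivisor (ToricRing k σ)} (hP : IsNontoric P)
    (u : Fin n → ℤ) : P.ord (toFrac k hv hσ (AddMonoidAlgebra.single u 1)) = 0 := by
  obtain ⟨s, hs, h⟩ := hv.exists_translate hσ {u}
  have h1 := ord_toFrac_single_of_notMem hv hσ P (hP ⟨s, hs⟩)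
  have h2 := ord_toFrac_single_of_notMem hv hσ P (hP ⟨u + s, h u (Finset.mem_singleton_self u)⟩)
  rw [ord_toFrac_single_add, h1, add_zero] at h2
  exact h2

/-- A prime divisor whose ideal contains a monomial is one of the divisors of the rays. -/
theorem isNontoric_or_eq_rayDivisor (P : PrimeDivisor (ToricRing k σ)) :
    IsNontoric P ∨ ∃ i, P = rayDivisor k hv hσ i := by
  by_cases hP : IsNontoric P
  · exact Or.inl hP
  right
  simp only [IsNontoric, not_forall, not_not] at hP
  obtain ⟨u, hu⟩ := hP
  -- Otherwise each ray has a monomial of positive height outside P. Their product has an exponent W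
  -- in the interior of the dual cone, so χ^u divides a power of χ^W. That power then lies in P,
  -- contradicting primality.
  obtain ⟨i, hi⟩ : ∃ i, rayIdeal k σ (v i) ≤ P.ideal := by
    by_contra! hcon
    have h1 : ∀ i, ∃ w : dualMonoid σ, (w : Fin n → ℤ) ⬝ᵥ v i ≠ 0 ∧ monomial k σ w ∉ P.ideal := by
      intro i
      by_contra! h
      refine hcon i (Ideal.span_le.2 ?_)
      rintro _ ⟨w, hw, rfl⟩
      exact h w hw
    choose w hw hwP using h1
    have hsum : ∀ s : Finset (Fin r), monomial k σ (∑ i ∈ s, w i) ∉ P.ideal := by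
      intro s
      induction s using Finset.induction_on with
      | empty =>
        rw [Finset.sum_empty, monomial_zero]
        exact fun h => P.isPrime.ne_top ((Ideal.eq_top_iff_one _).2 h)
      | insert a s ha ih =>
        rw [Finset.sum_insert ha, monomial_add]
        exact fun h => (P.isPrime.mem_or_mem h).elim (hwP a) ih
    set W := ∑ i, w i with hW
    have hWpos : ∀ i, 0 < (W : Fin n → ℤ) ⬝ᵥ v i := fun i => by
      rw [hW, AddSubmonoid.coe_finsetSum, sum_dotProduct]
      exact Finset.sum_pos' (fun j _ => hv.dotProduct_nonneg i _ (w j).2) ⟨i, Finset.mem_univ i,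
        lt_of_le_of_ne (hv.dotProduct_nonneg i _ (w i).2) (hw i).symm⟩
    set N : ℕ := ∑ i, ((u : Fin n → ℤ) ⬝ᵥ v i).toNat with hN
    have hmem : (N • (W : Fin n → ℤ) - u) ∈ dualMonoid σ := by
      refine hv.mem_dualMonoid.2 fun i => ?_
      have h1 : ((u : Fin n → ℤ) ⬝ᵥ v i).toNat ≤ N := Finset.single_le_sum
        (f := fun i => ((u : Fin n → ℤ) ⬝ᵥ v i).toNat) (fun _ _ => Nat.zero_le _)
        (Finset.mem_univ i)
      have h2 := hWpos i
      have h3 := hv.dotProduct_nonneg i _ u.2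
      have h4 : (u : Fin n → ℤ) ⬝ᵥ v i ≤ N := by omega
      rw [sub_dotProduct, smul_dotProduct, nsmul_eq_mul]
      nlinarith
    have h2 : monomial k σ W ^ N ∈ P.ideal := by
      have : monomial k σ W ^ N = monomial k σ u * monomial k σ ⟨_, hmem⟩ := by
        rw [← monomial_add, monomial, AddMonoidAlgebra.single_pow, one_pow, monomial]
        congr 1
        ext1
        simp
      rw [this]
      exact P.ideal.mul_mem_right _ hu
    exact hsum Finset.univ (P.isPrime.mem_of_pow_mem _ h2)
  -- Both primes have height one, so the inclusion cannot be strict.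
  refine ⟨i, PrimeDivisor.ext_ideal (Eq.symm (hi.eq_of_not_lt fun hlt => ?_))⟩
  have hpr := (rayDivisor k hv hσ i).isPrime
  have h1 := (Ideal.height_le_iff (n := 1)).1 P.height_eq_one.le _ hpr hlt
  rw [(rayDivisor k hv hσ i).height_eq_one] at h1
  exact lt_irrefl _ h1

theorem rayDivisor_injective : Function.Injective (rayDivisor k hv hσ) := by
  intro i j hij
  by_contra hne
  obtain ⟨m, hmi, hm⟩ := hv.exists_facet hσ i
  have h1 := ord_rayDivisor_single (k := k) hv hσ i m
  rw [hij, ord_rayDivisor_single, hmi] at h1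
  exact (hm j (Ne.symm hne)).ne' h1

theorem not_isNontoric_rayDivisor (i : Fin r) : ¬ IsNontoric (rayDivisor k hv hσ i) := by
  intro h
  obtain ⟨m, hm⟩ := exists_height_one_mem hv hσ i
  have := h.ord_single hv hσ m
  rw [ord_rayDivisor_single, hm] at this
  exact one_ne_zero this

theorem toricDivisor_rayDivisor (a : Fin r → ℚ) (i : Fin r) :
    toricDivisor k σ v a (rayDivisor k hv hσ i) = a i := by
  classical
  rw [toricDivisor, Finset.sum_eq_single i]
  · rw [if_pos (rayDivisor_ideal hv hσ i)]
  · intro j _ hj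
    rw [if_neg]
    intro h
    exact hj (rayDivisor_injective (k := k) hv hσ (PrimeDivisor.ext_ideal h)).symm
  · simp

theorem toricDivisor_of_isNontoric
    (hv : IsPrimitiveGenerators σ v)
    (hσ : (σ : ConvexCone ℝ (Fin n → ℝ)).Salient) (a : Fin r → ℚ) {P : PrimeDivisor (ToricRing k σ)}
    (hP : IsNontoric P) : toricDivisor k σ v a P = 0 := by
  classical
  refine Finset.sum_eq_zero fun i _ => if_neg fun h => ?_
  have : P = rayDivisor k hv hσ i := PrimeDivisor.ext_ideal h
  exact not_isNontoric_rayDivisor hv hσ i (this ▸ hP)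

/-! ### Rational functions without poles on the torus -/

/-- A rational function whose poles in the torus lie on `s = 0` becomes a Laurent polynomial after
multiplication by a power of `s`. -/
theorem exists_pow_mul_eq_toFrac (f : FractionRing (ToricRing k σ)) (s : ToricRing k σ)
    (h : ∀ P : PrimeDivisor (ToricRing k σ), IsNontoric P → s ∉ P.ideal → f ≠ 0 → 0 ≤ P.ord f) :
    ∃ (N : ℕ) (g : Laurent k n), toFrac k hv hσ g = algebraMap _ _ s ^ N * f := by
  rcases eq_or_ne f 0 with rfl | hf0
  · exact ⟨0, 0, by simp⟩
  let _ := (toFrac k hv hσ).toAlgebra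
  have := isFractionRing_toFrac (k := k) hv hσ
  have halg : ∀ x, algebraMap (Laurent k n) (FractionRing (ToricRing k σ)) x =
    toFrac k hv hσ x := fun _ => rfl
  -- With f = A/B in lowest terms, it suffices that every prime factor π of B divides s. Otherwise π
  -- contracts to a nontoric prime divisor avoiding s, where f is assumed to have no pole, forcing π
  -- to divide A.
  obtain ⟨A, B, hAB, hfAB⟩ := IsFractionRing.exists_reduced_fraction (A := Laurent k n) f
  have hB0 : (B : Laurent k n) ≠ 0 := nonZeroDivisors.ne_zero B.2
  have hBF : toFrac k hv hσ B ≠ 0 := toFrac_ne_zero hv hσ hB0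
  have hfB : f * toFrac k hv hσ B = toFrac k hv hσ A := by
    rw [← hfAB, ← halg, ← halg, IsLocalization.mk'_spec]
  obtain ⟨N, C, hC⟩ := exists_dvd_pow_of_forall_prime_dvd (s := incl k σ s) hB0 (by
    intro π hπ hπB
    by_contra hπs
    have hprime : (Ideal.span {π}).IsPrime := (Ideal.span_singleton_prime hπ.ne_zero).2 hπ
    have hP : (Ideal.comap (incl k σ) (Ideal.span {π})).IsPrime := Ideal.comap_isPrime _ _
    have hmem : ∀ x : ToricRing k σ, x ∈ Ideal.comap (incl k σ) (Ideal.span {π}) ↔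
        π ∣ incl k σ x := fun x => by rw [Ideal.mem_comap, Ideal.mem_span_singleton]
    have hmon : ∀ u, monomial k σ u ∉ Ideal.comap (incl k σ) (Ideal.span {π}) := by
      intro u hu
      rw [hmem, monomial, incl_single] at hu
      exact hπ.not_isUnit (isUnit_of_dvd_unit hu (isUnit_single _))
    -- Monomials are outside the contracted prime, so π times a monomial lying in the toric ring
    -- still serves as a uniformizer.
    obtain ⟨s', ϖ, hϖ⟩ := exists_incl_mul hv hσ π
    have hunif : IsUniformizerAt (Ideal.comap (incl k σ) (Ideal.span {π})) ϖ := by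
      refine ⟨?_, ?_, fun g hg => ?_⟩
      · rw [hmem, hϖ]
        exact dvd_mul_left _ _
      · rintro rfl
        rw [map_zero] at hϖ
        exact mul_ne_zero (isUnit_single (k := k) (s' : Fin n → ℤ)).ne_zero hπ.ne_zero hϖ.symm
      · have hg' : incl k σ g ≠ 0 := by
          rwa [Ne, map_eq_zero_iff _ incl_injective]
        obtain ⟨g', hg'π, hgg'⟩ :=
          (FiniteMultiplicity.of_prime_left hπ hg').exists_eq_pow_mul_and_not_dvd
        set j := multiplicity π (incl k σ g)
        obtain ⟨t, a, ha⟩ := exists_incl_mul (σ := σ) hv hσ g'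
        refine ⟨j, a, ?_, monomial k σ t * monomial k σ s' ^ j, ?_, ?_⟩
        · rw [hmem, ha, (isUnit_single _).dvd_mul_left]
          exact hgg'
        · intro hmem'
          rcases hP.mem_or_mem hmem' with h1 | h1
          · exact hmon _ h1
          · exact hmon _ (hP.mem_of_pow_mem _ h1)
        · apply incl_injective
          rw [map_mul, map_mul, map_mul, map_pow, map_pow, hϖ, ha, hg'π, monomial, monomial,
            incl_single, incl_single]
          ring
    have hord := h hunif.primeDivisor hmon (fun hs => hπs ((hmem s).1 hs)) hf0
    rw [PrimeDivisor.ord_nonneg_iff _ hf0, mem_localRing] at hord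
    obtain ⟨a, b, hb, hfab⟩ := hord
    have hb' : ¬ π ∣ incl k σ b := fun h1 => hb ((hmem b).2 h1)
    have hb0 : algebraMap _ (FractionRing (ToricRing k σ)) b ≠ 0 := by
      refine algebraMap_fractionRing_ne_zero ?_
      rintro rfl
      exact hb (Ideal.zero_mem _)
    have hcross : A * incl k σ b = incl k σ a * B := by
      apply toFrac_injective hv hσ
      rw [map_mul, map_mul, toFrac_incl, toFrac_incl, ← hfB, hfab]
      field_simp
    have hdvd : π ∣ A * incl k σ b := hcross ▸ dvd_mul_of_dvd_right hπB _
    rcases hπ.dvd_or_dvd hdvd with h1 | h1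
    · exact hπ.not_isUnit (hAB h1 hπB)
    · exact hb' h1)
  refine ⟨N, A * C, ?_⟩
  rw [map_mul, ← hfB, mul_assoc, ← map_mul, ← hC, map_pow, toFrac_incl, mul_comm]

end Toric

/-! ### The splitting ideals of a toric triple -/

section Splitting

variable {k : Type*} [Field k] {n r : ℕ} {σ : PointedCone ℝ (Fin n → ℝ)}

theorem IsMonomialIdeal.monomial_mem {J : Ideal (ToricRing k σ)} (hJ : IsMonomialIdeal J)
    {a : ToricRing k σ} (ha : a ∈ J) {b : dualMonoid σ} (hb : a.coeff b ≠ 0) :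
    monomial k σ b ∈ J := by
  obtain ⟨A, rfl⟩ := hJ
  obtain ⟨m, hm, d, rfl⟩ := (AddMonoidAlgebra.mem_ideal_span_of'_image (k := k)
    (A := dualMonoid σ) (s := A) (x := a)).1 ha b (Finsupp.mem_support_iff.2 hb)
  rw [monomial_add]
  exact Ideal.mul_mem_left _ _ (Ideal.subset_span ⟨m, hm, rfl⟩)

theorem IsMonomialIdeal.mul {I J : Ideal (ToricRing k σ)} (hI : IsMonomialIdeal I)
    (hJ : IsMonomialIdeal J) : IsMonomialIdeal (I * J) := by
  obtain ⟨A, rfl⟩ := hI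
  obtain ⟨B, rfl⟩ := hJ
  refine ⟨A + B, ?_⟩
  rw [Ideal.span_mul_span']
  congr 1
  ext x
  constructor
  · rintro ⟨_, ⟨a, ha, rfl⟩, _, ⟨b, hb, rfl⟩, rfl⟩
    exact ⟨a + b, ⟨a, ha, b, hb, rfl⟩, monomial_add a b⟩
  · rintro ⟨_, ⟨a, ha, b, hb, rfl⟩, rfl⟩
    exact ⟨_, ⟨a, ha, rfl⟩, _, ⟨b, hb, rfl⟩, (monomial_add a b).symm⟩

theorem IsMonomialIdeal.pow {I : Ideal (ToricRing k σ)} (hI : IsMonomialIdeal I) (m : ℕ) :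
    IsMonomialIdeal (I ^ m) := by
  induction m with
  | zero =>
    refine ⟨{0}, ?_⟩
    rw [Set.image_singleton, monomial_zero, pow_zero, Ideal.span_singleton_one, Ideal.one_eq_top]
  | succ m ih =>
    rw [pow_succ]
    exact ih.mul hI

variable {v : Fin r → Fin n → ℤ} (hv : IsPrimitiveGenerators σ v)
  (hσ : (σ : ConvexCone ℝ (Fin n → ℝ)).Salient)

theorem algebraMap_mem_sections {R : Type*} [CommRing R] [IsDomain R] {E : PrimeDivisor R → ℤ}
    (hE : ∀ P, 0 ≤ E P) (x : R) : algebraMap R (FractionRing R) x ∈ sections E :=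
  fun _ P => add_nonneg (P.ord_algebraMap_nonneg x) (hE P)

theorem toFrac_single_mem_sections {E : PrimeDivisor (ToricRing k σ) → ℤ}
    (hE : ∀ P, IsNontoric P → 0 ≤ E P) {w : Fin n → ℤ}
    (hw : ∀ i, 0 ≤ w ⬝ᵥ v i + E (rayDivisor k hv hσ i)) (c : k) :
    toFrac k hv hσ (AddMonoidAlgebra.single w c) ∈ sections E := by
  have h1 : toFrac k hv hσ (AddMonoidAlgebra.single w 1) ∈ sections E := by
    intro _ P
    rcases isNontoric_or_eq_rayDivisor hv hσ P with hP | ⟨i, rfl⟩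
    · rw [hP.ord_single, zero_add]
      exact hE P hP
    · rw [ord_rayDivisor_single]
      exact hw i
  have h2 : toFrac k hv hσ (AddMonoidAlgebra.single w c) =
      (AddMonoidAlgebra.single 0 c : ToricRing k σ) •
        toFrac k hv hσ (AddMonoidAlgebra.single w 1) := by
    rw [Algebra.smul_def, ← toFrac_incl hv hσ, ← map_mul, incl_single,
      AddMonoidAlgebra.single_mul_single, mul_one, AddSubmonoid.coe_zero, zero_add]
  rw [h2]
  exact Submodule.smul_mem _ _ h1

/-- A section has no pole on the torus, so it is a Laurent polynomial, and its order along a ray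
bounds the height of each term from below. Together with `toFrac_single_mem_sections` this describes
the sections by their monomials. -/
theorem exists_toFrac_eq_of_mem_sections {E : PrimeDivisor (ToricRing k σ) → ℤ}
    (hE : ∀ P, IsNontoric P → E P = 0) {y : FractionRing (ToricRing k σ)} (hy : y ∈ sections E) :
    ∃ g : Laurent k n, toFrac k hv hσ g = y ∧
      ∀ w ∈ g.coeff.support, ∀ i, 0 ≤ w ⬝ᵥ v i + E (rayDivisor k hv hσ i) := by
  obtain ⟨N, g, hg⟩ := exists_pow_mul_eq_toFrac hv hσ y 1 (fun P hP _ hy0 => by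
    have := hy hy0 P
    rwa [hE P hP, add_zero] at this)
  rw [map_one, one_pow, one_mul] at hg
  refine ⟨g, hg, fun w hw i => ?_⟩
  have hg0 : g ≠ 0 := by rintro rfl; simp at hw
  have h1 := hy (hg ▸ toFrac_ne_zero hv hσ hg0) (rayDivisor k hv hσ i)
  have h2 := ord_rayDivisor_le hv hσ i hw
  rw [hg] at h2
  omega

/-- Every map in `frobHom q E` sends the monomials outside a certain polytope to the homogeneous
maximal ideal. -/
theorem coeff_zero_frobHom_single {q : ℕ} {E : PrimeDivisor (ToricRing k σ) → ℤ}
    (hE : ∀ P, 0 ≤ E P) {φ : ToricRing k σ →+ ToricRing k σ} (hφ : φ ∈ frobHom q E)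
    {u : dualMonoid σ} {i : Fin r}
    (hu : (q : ℤ) ≤ (u : Fin n → ℤ) ⬝ᵥ v i + E (rayDivisor k hv hσ i)) (c : k) :
    (φ (AddMonoidAlgebra.single u c)).coeff 0 = 0 := by
  obtain ⟨ψ, hψ, hφψ⟩ := hφ
  -- With this m the monomial χ^{u-qm} is still a section of E, so formally φ(χ^u) = χ^m
  -- ψ(χ^{u-qm}). A constant term would need the exponent -m in S, but -m has height -1 on v i.
  obtain ⟨m, hm, hm'⟩ := hv.exists_height_one_le hσ i 0
  -- As m need not lie in S, linearity is applied to χ^s and χ^{m+s} instead.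
  obtain ⟨s, hs, hms⟩ := hv.exists_translate hσ {m}
  set s₁ : dualMonoid σ := ⟨s, hs⟩ with hs₁
  set s₂ : dualMonoid σ := ⟨m + s, hms m (Finset.mem_singleton_self m)⟩ with hs₂
  set x : sections E := ⟨_, algebraMap_mem_sections hE (AddMonoidAlgebra.single u c)⟩ with hx
  set y : sections E := ⟨_, toFrac_single_mem_sections hv hσ (fun P _ => hE P)
    (w := (u : Fin n → ℤ) - (q : ℤ) • m) (fun j => by
      rw [sub_dotProduct, smul_dotProduct, smul_eq_mul]
      rcases eq_or_ne j i with rfl | hj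
      · rw [hm]
        linarith
      · have h1 := hm' j hj
        have h2 := hv.dotProduct_nonneg j u u.2
        have h3 := hE (rayDivisor k hv hσ j)
        have h4 : (q : ℤ) * (m ⬝ᵥ v j) ≤ 0 :=
          mul_nonpos_of_nonneg_of_nonpos (Int.natCast_nonneg q) h1
        linarith) c⟩ with hy
  have hxy : monomial k σ s₁ ^ q • x = monomial k σ s₂ ^ q • y := by
    ext1
    rw [Submodule.coe_smul, Submodule.coe_smul, Algebra.smul_def, Algebra.smul_def, hx, hy]
    simp only
    rw [monomial, monomial, AddMonoidAlgebra.single_pow, AddMonoidAlgebra.single_pow,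
      ← toFrac_incl hv hσ, ← toFrac_incl hv hσ, ← toFrac_incl hv hσ, incl_single, incl_single,
      incl_single, ← map_mul, ← map_mul, AddMonoidAlgebra.single_mul_single,
      AddMonoidAlgebra.single_mul_single]
    congr 2
    change q • s + (u : Fin n → ℤ) = q • (m + s) + ((u : Fin n → ℤ) - (q : ℤ) • m)
    rw [natCast_zsmul, smul_add]
    abel
  have h1 : monomial k σ s₁ * φ (AddMonoidAlgebra.single u c) = monomial k σ s₂ * ψ y := by
    rw [hφψ _ x rfl, ← hψ, ← hψ, hxy]
  have h2 := congrArg (fun f => (incl k σ f).coeff s) h1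
  simp only [map_mul, monomial, incl_single, coeff_single_one_mul, hs₁, hs₂] at h2
  rw [sub_self, sub_add_cancel_right, coeff_incl_of_notMem (ψ y)] at h2
  · rw [← coeff_incl]
    exact h2
  · intro hmem
    have := hv.dotProduct_nonneg i _ hmem
    rw [neg_dotProduct, hm] at this
    omega

variable (p : ℕ) [Fact p.Prime] [CharP k p] [PerfectField k]

instance perfectRing_of_perfectField {k : Type*} [Field k] (p : ℕ) [Fact p.Prime] [CharP k p]
    [PerfectField k] : PerfectRing k p :=
  PerfectField.toPerfectRing p

/-- The trace-like map `∑ c_w χ^w ↦ ∑ c_{u+qm}^{1/q} χ^m` on Laurent polynomials, `q = p ^ e`. -/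
def frobProj (e : ℕ) (u : Fin n → ℤ) : Laurent k n →+ Laurent k n where
  toFun f := AddMonoidAlgebra.map ((iterateFrobeniusEquiv k p e).symm : k →+* k).toAddMonoidHom
    (AddMonoidAlgebra.comapDomain (fun m => u + (p ^ e) • m) (fun m m' h => by
      have h' : (p ^ e) • m = (p ^ e) • m' := add_left_cancel h
      ext j
      have := congrFun h' j
      simpa [(Fact.out : p.Prime).ne_zero] using this) f)
  map_zero' := by simp [AddMonoidAlgebra.map_zero]
  map_add' f g := by simp [AddMonoidAlgebra.map_add]

theorem coeff_frobProj (e : ℕ) (u m : Fin n → ℤ) (f : Laurent k n) :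
    (frobProj p e u f).coeff m =
      (iterateFrobeniusEquiv k p e).symm (f.coeff (u + (p ^ e) • m)) := rfl

/-- The p^e-th power map is additive in characteristic p, so only monomials g need checking. -/
theorem frobProj_pow_mul (e : ℕ) (u : Fin n → ℤ) (g f : Laurent k n) :
    frobProj p e u (g ^ p ^ e * f) = g * frobProj p e u f := by
  have : CharP (Laurent k n) p := charP_of_injective_algebraMap
    (algebraMap k (Laurent k n)).injective p
  induction g using AddMonoidAlgebra.induction_linear with
  | zero => simp [(Fact.out : p.Prime).ne_zero]
  | add g h hg hh => rw [add_pow_char_pow, add_mul, map_add, hg, hh, add_mul]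
  | single m c =>
    ext w
    rw [coeff_frobProj, AddMonoidAlgebra.single_pow, AddMonoidAlgebra.coeff_single_mul_apply,
      AddMonoidAlgebra.coeff_single_mul_apply, coeff_frobProj, map_mul, smul_add]
    congr 1
    · rw [← iterateFrobenius_def, ← coe_iterateFrobeniusEquiv, RingEquiv.symm_apply_apply]
    · congr 2
      simp only [smul_neg]
      abel

/-- For every monomial in the polytope there is a map in `frobHom q E` that detects it. -/
theorem exists_frobHom_coeff {e : ℕ} {E : PrimeDivisor (ToricRing k σ) → ℤ}
    (hE0 : ∀ P, IsNontoric P → E P = 0) (hE : ∀ P, 0 ≤ E P) {u : dualMonoid σ}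
    (hu : ∀ i, (u : Fin n → ℤ) ⬝ᵥ v i + E (rayDivisor k hv hσ i) < ((p ^ e : ℕ) : ℤ)) :
    ∃ φ ∈ frobHom (p ^ e) E, ∀ f : ToricRing k σ,
      (φ f).coeff 0 = (iterateFrobeniusEquiv k p e).symm (f.coeff u) := by
  have hex : ∀ y : sections E, ∃ h : ToricRing k σ, ∃ g : Laurent k n,
      toFrac k hv hσ g = y ∧ incl k σ h = frobProj p e u g := by
    intro y
    obtain ⟨g, hgy, hg⟩ := exists_toFrac_eq_of_mem_sections hv hσ hE0 y.2
    obtain ⟨h, hh⟩ := exists_incl_eq (σ := σ) (f := frobProj p e (u : Fin n → ℤ) g) (by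
      intro m hm
      refine hv.mem_dualMonoid.2 fun i => ?_
      rw [Finsupp.mem_support_iff, coeff_frobProj] at hm
      have hm' : g.coeff ((u : Fin n → ℤ) + (p ^ e) • m) ≠ 0 := fun h0 => hm (by rw [h0, map_zero])
      have h1 := hg _ (Finsupp.mem_support_iff.2 hm') i
      have h2 := hu i
      rw [add_dotProduct, smul_dotProduct, nsmul_eq_mul] at h1
      -- The section bound and the bound on u give q (m·v i) > -q, so the integer m·v i is
      -- nonnegative.
      by_contra! hneg
      have h3 : ((p ^ e : ℕ) : ℤ) * (m ⬝ᵥ v i) ≤ ((p ^ e : ℕ) : ℤ) * (-1) :=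
        mul_le_mul_of_nonneg_left (by omega) (Int.natCast_nonneg _)
      linarith)
    exact ⟨h, g, hgy, hh⟩
  choose ψ L hL hψ using hex
  have hLeq : ∀ (y : sections E) (g : Laurent k n), toFrac k hv hσ g = y → L y = g :=
    fun y g hg => toFrac_injective hv hσ ((hL y).trans hg.symm)
  let Ψ : sections E →+ ToricRing k σ := AddMonoidHom.mk' ψ (fun x y => by
    apply incl_injective
    rw [map_add, hψ, hψ, hψ, ← map_add, hLeq (x + y) (L x + L y)]
    rw [map_add, hL, hL, Submodule.coe_add])
  let ι : ToricRing k σ →+ sections E := AddMonoidHom.mk'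
    (fun x => ⟨_, algebraMap_mem_sections hE x⟩) (fun x y => by
      ext1
      simp)
  refine ⟨Ψ.comp ι, ⟨Ψ, fun g y => ?_, fun x y hxy => ?_⟩, fun f => ?_⟩
  · apply incl_injective
    change incl k σ (ψ _) = incl k σ (g * ψ y)
    rw [map_mul, hψ, hψ, ← frobProj_pow_mul, hLeq _ (incl k σ g ^ p ^ e * L y)]
    rw [map_mul, map_pow, toFrac_incl, hL, Submodule.coe_smul, Algebra.smul_def, map_pow]
  · have : ι x = y := Subtype.ext hxy.symm
    rw [AddMonoidHom.comp_apply, this]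
  · have h1 : incl k σ (ψ (ι f)) = frobProj p e u (incl k σ f) := by
      rw [hψ, hLeq _ (incl k σ f) (toFrac_incl hv hσ f)]
    change (ψ (ι f)).coeff 0 = _
    rw [← coeff_incl, h1, coeff_frobProj, AddSubmonoid.coe_zero, smul_zero, add_zero, coeff_incl]

/-- The exponents of the monomials outside the splitting ideal. -/
def splittingExponents (v : Fin r → Fin n → ℤ) (q : ℕ) (E : Fin r → ℤ)
    (J : Ideal (ToricRing k σ)) : Set (dualMonoid σ) :=
  {u | ∃ b : dualMonoid σ, monomial k σ b ∈ J ∧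
    ∀ i, ((u : Fin n → ℤ) + (b : Fin n → ℤ)) ⬝ᵥ v i + E i < q}

/-- Premultiplying by χ^b a map that detects χ^{u+b} reads off the coefficient of χ^u, up to a q-th
root. Conversely, every term of a f has exponent b + u with χ^b in J and u in the support of f. If
no such u is a splitting exponent, each term violates the inequality at some ray and is sent into
the maximal ideal. -/
theorem mem_splittingIdeal (hfull : Submodule.span ℝ (σ : Set (Fin n → ℝ)) = ⊤) {e : ℕ}
    {E : PrimeDivisor (ToricRing k σ) → ℤ} (hE0 : ∀ P, IsNontoric P → E P = 0)
    (hE : ∀ P, 0 ≤ E P) {J : Ideal (ToricRing k σ)} (hJ : IsMonomialIdeal J)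
    {f : ToricRing k σ} :
    f ∈ splittingIdeal (maxIdeal k σ) (p ^ e) E J ↔
      ∀ u ∈ splittingExponents v (p ^ e) (fun i => E (rayDivisor k hv hσ i)) J,
        f.coeff u = 0 := by
  constructor
  · rintro hf u ⟨b, hb, hu⟩
    obtain ⟨φ, hφ, hφc⟩ := exists_frobHom_coeff hv hσ p (u := u + b) hE0 hE hu
    have h1 := hf (φ.comp (AddMonoidHom.mulLeft (monomial k σ b)))
      (AddSubgroup.subset_closure ⟨φ, hφ, _, hb, fun x => rfl⟩)
    rw [hv.mem_maxIdeal hfull, AddMonoidHom.comp_apply, hφc] at h1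
    have h2 := (map_eq_zero_iff _ (RingEquiv.injective _)).1 h1
    rw [AddMonoidHom.coe_mulLeft, ← coeff_incl, map_mul, monomial, incl_single,
      coeff_single_one_mul, AddSubmonoid.coe_add, add_sub_cancel_right, coeff_incl] at h2
    exact h2
  · intro hf ψ hψ
    induction hψ using AddSubgroup.closure_induction with
    | mem χ h =>
      obtain ⟨φ, hφ, a, ha, hχ⟩ := h
      rw [hχ, ← AddMonoidAlgebra.sum_coeff_single (a * f), Finsupp.sum, map_sum]
      refine Ideal.sum_mem _ fun w hw => ?_
      classical
      obtain ⟨b, hb, u, hu, rfl⟩ := Finset.mem_add.1 (AddMonoidAlgebra.support_coeff_mul_subset a f hw)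
      rw [hv.mem_maxIdeal hfull]
      have hbJ := hJ.monomial_mem ha (Finsupp.mem_support_iff.1 hb)
      have hnot : u ∉ splittingExponents v (p ^ e) (fun i => E (rayDivisor k hv hσ i)) J :=
        fun h => Finsupp.mem_support_iff.1 hu (hf u h)
      have hex : ∃ i, ((p ^ e : ℕ) : ℤ) ≤
          ((b + u : dualMonoid σ) : Fin n → ℤ) ⬝ᵥ v i + E (rayDivisor k hv hσ i) := by
        by_contra! hcon
        refine hnot ⟨b, hbJ, fun i => ?_⟩
        rw [add_comm (u : Fin n → ℤ)]
        exact hcon i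
      obtain ⟨i, hi⟩ := hex
      exact coeff_zero_frobHom_single hv hσ hE hφ hi _
    | zero => simp
    | add f g _ _ hf hg =>
      rw [AddMonoidHom.add_apply]
      exact Ideal.add_mem _ hf hg
    | neg f _ hf =>
      rw [AddMonoidHom.neg_apply]
      exact Submodule.neg_mem _ hf

end Splitting

/-! ### Logarithmic differential forms -/

section ExteriorPower

variable {F V : Type*} [Field F] [AddCommGroup V] [Module F V] {n : ℕ}

/-- Both sides are alternating in the rows of M, so they need only be compared on permutations of
the standard basis. -/
theorem ιMulti_sum_smul (e : Fin n → V) (M : Matrix (Fin n) (Fin n) F) :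
    exteriorPower.ιMulti F n (fun j => ∑ l, M j l • e l) =
      M.det • exteriorPower.ιMulti F n e := by
  have h : (exteriorPower.ιMulti F n).compLinearMap (Fintype.linearCombination F e) =
      (LinearMap.toSpanSingleton F _ (exteriorPower.ιMulti F n e)).compAlternatingMap
        Matrix.detRowAlternating := by
    refine Module.Basis.ext_alternating (Pi.basisFun F (Fin n)) fun w hw => ?_
    set τ : Equiv.Perm (Fin n) := Equiv.ofBijective w (Finite.injective_iff_bijective.1 hw)
    have hτ : (fun i => (Pi.basisFun F (Fin n)) (w i)) = (Pi.basisFun F (Fin n)) ∘ τ := rfl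
    rw [hτ, AlternatingMap.map_perm, AlternatingMap.map_perm]
    congr 1
    have h1 : Matrix.detRowAlternating (Pi.basisFun F (Fin n)) = (1 : F) := by
      rw [← Pi.basisFun_det, Module.Basis.det_self]
    rw [LinearMap.compAlternatingMap_apply, h1, LinearMap.toSpanSingleton_apply, one_smul,
      AlternatingMap.compLinearMap_apply]
    congr 1
    ext j
    simp [Fintype.linearCombination_apply, Pi.single_apply]
  exact congrArg (fun f => f M) h

/-- More than n coefficient vectors in F^n are linearly dependent. -/
theorem ιMulti_sum_smul_eq_zero {d : ℕ} (hd : n < d) (e : Fin n → V) (M : Fin d → Fin n → F) :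
    exteriorPower.ιMulti F d (fun j => ∑ l, M j l • e l) = 0 := by
  have h := AlternatingMap.map_linearDependent
    ((exteriorPower.ιMulti F d).compLinearMap (Fintype.linearCombination F e)) M (by
      intro h
      have := h.fintype_card_le_finrank
      simp at this
      omega)
  simpa [Fintype.linearCombination_apply, Function.comp_def] using h

end ExteriorPower

/-! ### Differentials of characters and the invariant top form -/

section Forms

variable {k : Type*} [Field k] {n r : ℕ} {σ : PointedCone ℝ (Fin n → ℝ)}
  {v : Fin r → Fin n → ℤ} (hv : IsPrimitiveGenerators σ v)
  (hσ : (σ : ConvexCone ℝ (Fin n → ℝ)).Salient)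

variable (k) in
/-- The character `χ^u` as a rational function. -/
abbrev character (u : Fin n → ℤ) : FractionRing (ToricRing k σ) :=
  toFrac k hv hσ (AddMonoidAlgebra.single u 1)

variable (k) in
/-- The logarithmic differential of `χ^u`. -/
def dlog : (Fin n → ℤ) →+ Ω[FractionRing (ToricRing k σ)⁄k] :=
  AddMonoidHom.mk' (fun u => (character k hv hσ u)⁻¹ •
    KaehlerDifferential.D k (FractionRing (ToricRing k σ)) (character k hv hσ u)) (fun u w => by
      have hu := toFrac_single_ne_zero (k := k) hv hσ u
      have hw := toFrac_single_ne_zero (k := k) hv hσ w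
      have h : character k hv hσ (u + w) = character k hv hσ u * character k hv hσ w := by
        rw [character, character, ← map_mul, AddMonoidAlgebra.single_mul_single, mul_one]
      rw [h, Derivation.leibniz, smul_add, smul_smul, smul_smul, mul_inv, add_comm]
      congr 2
      · rw [mul_assoc, inv_mul_cancel₀ hw, mul_one]
      · rw [mul_right_comm, inv_mul_cancel₀ hu, one_mul])

variable (k) in
/-- The logarithmic differentials of the coordinates. -/
def dlogCoord (l : Fin n) : Ω[FractionRing (ToricRing k σ)⁄k] := dlog k hv hσ (Pi.single l 1)

variable (k) in
/-- The invariant top form on the torus. -/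
def torusForm : ⋀[FractionRing (ToricRing k σ)]^n (Ω[FractionRing (ToricRing k σ)⁄k]) :=
  exteriorPower.ιMulti _ n (dlogCoord k hv hσ)

/-- The logarithmic differential is additive on M, so dlog χ^u is the integral combination of the
coordinate ones with coefficients u. -/
theorem D_character (u : Fin n → ℤ) :
    KaehlerDifferential.D k (FractionRing (ToricRing k σ)) (character k hv hσ u) =
      ∑ l, (character k hv hσ u * (u l : FractionRing (ToricRing k σ))) • dlogCoord k hv hσ l := by
  have h1 : dlog k hv hσ u = ∑ l, (u l : FractionRing (ToricRing k σ)) • dlogCoord k hv hσ l := by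
    conv_lhs => rw [← Finset.univ_sum_single u]
    rw [map_sum]
    refine Finset.sum_congr rfl fun l _ => ?_
    rw [show (Pi.single l (u l) : Fin n → ℤ) = u l • Pi.single l 1 by
      rw [← Pi.single_smul, smul_eq_mul, mul_one], map_zsmul, Int.cast_smul_eq_zsmul]
    rfl
  have h2 : KaehlerDifferential.D k (FractionRing (ToricRing k σ)) (character k hv hσ u) =
      character k hv hσ u • dlog k hv hσ u := by
    change _ = character k hv hσ u • ((character k hv hσ u)⁻¹ •
      KaehlerDifferential.D k (FractionRing (ToricRing k σ)) (character k hv hσ u))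
    rw [smul_smul, mul_inv_cancel₀ (toFrac_single_ne_zero hv hσ u), one_smul]
  rw [h2, h1, Finset.smul_sum]
  simp_rw [smul_smul]

/-- A system of coordinates for differentials: a `B`-submodule of coefficient vectors containing
those of `dχ^u` contains those of all `df` with `f` a quotient of elements of the toric ring whose
denominator is a unit of `B`. -/
theorem exists_coeff_D (B : Subalgebra (ToricRing k σ) (FractionRing (ToricRing k σ)))
    (C : Submodule B (Fin n → FractionRing (ToricRing k σ)))
    (hC : ∀ u : dualMonoid σ, (fun l => character k hv hσ (u : Fin n → ℤ) *
      (((u : Fin n → ℤ) l : ℤ) : FractionRing (ToricRing k σ))) ∈ C)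
    (a s : ToricRing k σ) (hs : (algebraMap _ (FractionRing (ToricRing k σ)) s)⁻¹ ∈ B) :
    ∃ c ∈ C, KaehlerDifferential.D k (FractionRing (ToricRing k σ))
      (algebraMap _ _ a * (algebraMap _ _ s)⁻¹) = ∑ l, c l • dlogCoord k hv hσ l := by
  have hR : ∀ a : ToricRing k σ, ∃ c ∈ C, KaehlerDifferential.D k (FractionRing (ToricRing k σ))
      (algebraMap _ _ a) = ∑ l, c l • dlogCoord k hv hσ l := by
    intro a
    induction a using AddMonoidAlgebra.induction_linear with
    | zero => exact ⟨0, C.zero_mem, by simp⟩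
    | add f g hf hg =>
      obtain ⟨c, hc, hcf⟩ := hf
      obtain ⟨c', hc', hcg⟩ := hg
      refine ⟨c + c', C.add_mem hc hc', ?_⟩
      rw [map_add, map_add, hcf, hcg, ← Finset.sum_add_distrib]
      simp [add_smul]
    | single u x =>
      refine ⟨(algebraMap (ToricRing k σ) B (algebraMap k _ x)) • _, C.smul_mem _ (hC u), ?_⟩
      have h1 : algebraMap _ (FractionRing (ToricRing k σ)) (AddMonoidAlgebra.single u x) =
          x • character k hv hσ (u : Fin n → ℤ) := by
        rw [character, toFrac_monomial, ← IsScalarTower.coe_toAlgHom' k (ToricRing k σ)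
          (FractionRing (ToricRing k σ)), ← map_smul, monomial, AddMonoidAlgebra.smul_single,
          smul_eq_mul, mul_one]
      rw [h1, Derivation.map_smul, D_character, Finset.smul_sum]
      refine Finset.sum_congr rfl fun l _ => ?_
      rw [Pi.smul_apply, ← algebraMap_smul (FractionRing (ToricRing k σ)) x, smul_smul]
      congr 1
  obtain ⟨c, hc, hca⟩ := hR a
  obtain ⟨c', hc', hcs⟩ := hR s
  set s' : B := ⟨_, hs⟩
  -- The quotient rule: d(a/s) = s⁻¹ da - a s⁻² ds.
  refine ⟨s' • c - (algebraMap (ToricRing k σ) B a * s' ^ 2) • c',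
    C.sub_mem (C.smul_mem _ hc) (C.smul_mem _ hc'), ?_⟩
  rw [Derivation.leibniz, Derivation.leibniz_inv, hca, hcs, smul_smul, Finset.smul_sum,
    Finset.smul_sum, ← Finset.sum_add_distrib]
  refine Finset.sum_congr rfl fun l _ => ?_
  rw [smul_smul, smul_smul, ← add_smul]
  congr 1
  change _ = (algebraMap _ (FractionRing (ToricRing k σ)) s)⁻¹ * c l -
    (algebraMap _ (FractionRing (ToricRing k σ)) a *
      (algebraMap _ (FractionRing (ToricRing k σ)) s)⁻¹ ^ 2) * c' l
  ring

theorem exists_coeff (x : Ω[FractionRing (ToricRing k σ)⁄k]) :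
    ∃ c : Fin n → FractionRing (ToricRing k σ), x = ∑ l, c l • dlogCoord k hv hσ l := by
  have hx : x ∈ Submodule.span (FractionRing (ToricRing k σ)) (Set.range
      (KaehlerDifferential.D k (FractionRing (ToricRing k σ)))) := by
    rw [KaehlerDifferential.span_range_derivation]
    trivial
  induction hx using Submodule.span_induction with
  | mem x hx =>
    obtain ⟨f, rfl⟩ := hx
    obtain ⟨a, s, _, rfl⟩ := IsFractionRing.div_surjective (ToricRing k σ) f
    obtain ⟨c, -, hc⟩ := exists_coeff_D hv hσ ⊤ ⊤ (fun _ => trivial) a s trivial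
    exact ⟨c, by rw [div_eq_mul_inv, hc]⟩
  | zero => exact ⟨0, by simp⟩
  | add x y _ _ hx hy =>
    obtain ⟨c, rfl⟩ := hx
    obtain ⟨c', rfl⟩ := hy
    exact ⟨c + c', by simp [add_smul, Finset.sum_add_distrib]⟩
  | smul a x _ hx =>
    obtain ⟨c, rfl⟩ := hx
    exact ⟨a • c, by simp [Finset.smul_sum, smul_smul]⟩

/-- The n logarithmic differentials span all differentials, and expanding a wedge of n combinations
of them produces a determinant. -/
theorem exists_eq_smul_torusForm
    (ω : ⋀[FractionRing (ToricRing k σ)]^n (Ω[FractionRing (ToricRing k σ)⁄k])) :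
    ∃ g : FractionRing (ToricRing k σ), ω = g • torusForm k hv hσ := by
  have hω : ω ∈ Submodule.span (FractionRing (ToricRing k σ)) (Set.range
      (exteriorPower.ιMulti (FractionRing (ToricRing k σ)) n)) := by
    rw [exteriorPower.ιMulti_span]
    trivial
  induction hω using Submodule.span_induction with
  | mem x hx =>
    obtain ⟨f, rfl⟩ := hx
    choose c hc using fun j => exists_coeff hv hσ (f j)
    refine ⟨Matrix.det (Matrix.of c), ?_⟩
    rw [torusForm, ← ιMulti_sum_smul]
    congr 1
    ext1 j
    exact hc j
  | zero => exact ⟨0, by simp⟩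
  | add x y _ _ hx hy =>
    obtain ⟨c, rfl⟩ := hx
    obtain ⟨c', rfl⟩ := hy
    exact ⟨c + c', by rw [add_smul]⟩
  | smul a x _ hx =>
    obtain ⟨c, rfl⟩ := hx
    exact ⟨a * c, by rw [smul_smul]⟩

/-- Differentials are spanned by n elements, so higher exterior powers vanish. This gives the upper
bound for the dimension. -/
theorem le_of_exteriorPower_ne_zero
    (hv : IsPrimitiveGenerators σ v)
    (hσ : (σ : ConvexCone ℝ (Fin n → ℝ)).Salient) {d : ℕ}
    {ω : ⋀[FractionRing (ToricRing k σ)]^d (Ω[FractionRing (ToricRing k σ)⁄k])} (hω0 : ω ≠ 0) :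
    d ≤ n := by
  by_contra! hd
  refine hω0 ?_
  have hω : ω ∈ Submodule.span (FractionRing (ToricRing k σ)) (Set.range
      (exteriorPower.ιMulti (FractionRing (ToricRing k σ)) d)) := by
    rw [exteriorPower.ιMulti_span]
    trivial
  have h0 : Set.range (exteriorPower.ιMulti (FractionRing (ToricRing k σ)) d
      (M := Ω[FractionRing (ToricRing k σ)⁄k])) ⊆ {0} := by
    rintro _ ⟨f, rfl⟩
    choose c hc using fun j => exists_coeff hv hσ (f j)
    rw [show f = fun j => ∑ l, c j l • dlogCoord k hv hσ l from funext hc]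
    exact ιMulti_sum_smul_eq_zero hd _ _
  have := Submodule.span_mono h0 hω
  simpa using this

end Forms

/-! ### The canonical divisor of a toric variety -/

theorem valuation_det_le_one {K Γ : Type*} [Field K] [LinearOrderedCommGroupWithZero Γ]
    (ν : Valuation K Γ) {n : ℕ} {M : Matrix (Fin n) (Fin n) K} (hM : ∀ j l, ν (M j l) ≤ 1) :
    ν M.det ≤ 1 := by
  let M' : Matrix (Fin n) (Fin n) ν.integer := Matrix.of fun j l => ⟨M j l, hM j l⟩
  have : M.det = (M'.det : K) := (ν.integer.subtype.map_det M').symm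
  rw [this]
  exact M'.det.2

theorem valuation_adjugate_le_one {K Γ : Type*} [Field K] [LinearOrderedCommGroupWithZero Γ]
    (ν : Valuation K Γ) {n : ℕ} {M : Matrix (Fin n) (Fin n) K} (hM : ∀ j l, ν (M j l) ≤ 1)
    (j l : Fin n) : ν (M.adjugate j l) ≤ 1 := by
  let M' : Matrix (Fin n) (Fin n) ν.integer := Matrix.of fun j l => ⟨M j l, hM j l⟩
  have : M.adjugate j l = (M'.adjugate j l : K) :=
    (congrFun (congrFun (ν.integer.subtype.map_adjugate M') j) l).symm
  rw [this]
  exact (M'.adjugate j l).2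

/-- An integral matrix that sends a unimodular vector into the maximal ideal has its determinant
there. -/
theorem valuation_det_lt_one {K Γ : Type*} [Field K] [LinearOrderedCommGroupWithZero Γ]
    (ν : Valuation K Γ) {n : ℕ} {M : Matrix (Fin n) (Fin n) K} (hM : ∀ j l, ν (M j l) ≤ 1)
    {m w : Fin n → K} (hm : ∀ l, ν (m l) ≤ 1) (hmw : m ⬝ᵥ w = 1)
    (hMw : ∀ j, ν (M.mulVec w j) < 1) : ν M.det < 1 := by
  have h : M.det = ∑ l, m l * ∑ j, M.adjugate l j * M.mulVec w j := by
    -- Pairing this identity with m recovers det M as a combination of the entries of M w, which are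
    -- in the maximal ideal.
    have h1 : M.adjugate.mulVec (M.mulVec w) = M.det • w := by
      rw [Matrix.mulVec_mulVec, Matrix.adjugate_mul, Matrix.smul_mulVec, Matrix.one_mulVec]
    calc M.det = m ⬝ᵥ (M.det • w) := by rw [dotProduct_smul, hmw, smul_eq_mul, mul_one]
      _ = _ := by rw [← h1]; rfl
  rw [h]
  refine ν.map_sum_lt one_ne_zero fun l _ => ?_
  rw [map_mul]
  refine (mul_le_of_le_one_left' (hm l)).trans_lt (ν.map_sum_lt one_ne_zero fun j _ => ?_)
  rw [map_mul]
  exact (mul_le_of_le_one_left' (valuation_adjugate_le_one ν hM l j)).trans_lt (hMw j)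

theorem valuation_intCast_le_one {K Γ : Type*} [Field K] [LinearOrderedCommGroupWithZero Γ]
    (ν : Valuation K Γ) (m : ℤ) : ν (m : K) ≤ 1 :=
  (m : ν.integer).2.trans_eq' (by simp)

section

variable {R : Type*} [CommRing R] [IsDomain R] (P : PrimeDivisor R)

theorem PrimeDivisor.val_le_one_iff {f : FractionRing R} :
    P.val f ≤ 1 ↔ f ∈ localRing R P.ideal := by
  rcases eq_or_ne f 0 with rfl | hf
  · simp
  · rw [← P.ord_nonneg_iff hf, ← WithZero.exp_zero, P.val_le_exp_iff hf, add_zero]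

theorem PrimeDivisor.val_lt_one_iff {f : FractionRing R} :
    P.val f < 1 ↔ P.val f ≤ WithZero.exp (-1) := by
  rcases eq_or_ne f 0 with rfl | hf
  · simp
  · have h1 : P.val f ≠ 0 := (Valuation.ne_zero_iff _).2 hf
    rw [P.val_le_exp_iff hf, ← not_le, ← WithZero.exp_zero, ← WithZero.le_log_iff_exp_le h1]
    have : P.ord f = -WithZero.log (P.val f) := rfl
    omega

end

section Canonical

variable {k : Type*} [Field k] {n r : ℕ} {σ : PointedCone ℝ (Fin n → ℝ)}
  {v : Fin r → Fin n → ℤ} (hv : IsPrimitiveGenerators σ v)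
  (hσ : (σ : ConvexCone ℝ (Fin n → ℝ)).Salient)

/-- Upper bound for the regular forms, from a bound for determinants of coefficient vectors. -/
theorem exists_of_mem_regularForms (P : PrimeDivisor (ToricRing k σ)) (δ : ℤ)
    (C : Submodule (localRing _ P.ideal) (Fin n → FractionRing (ToricRing k σ)))
    (hC : ∀ u : dualMonoid σ, (fun l => character k hv hσ (u : Fin n → ℤ) *
      (((u : Fin n → ℤ) l : ℤ) : FractionRing (ToricRing k σ))) ∈ C)
    (hdet : ∀ M : Matrix (Fin n) (Fin n) (FractionRing (ToricRing k σ)), (∀ j, M j ∈ C) →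
      P.val M.det ≤ WithZero.exp (-δ))
    {η : ⋀[FractionRing (ToricRing k σ)]^n (Ω[FractionRing (ToricRing k σ)⁄k])}
    (hη : η ∈ regularForms k n P) :
    ∃ h, P.val h ≤ WithZero.exp (-δ) ∧ η = h • torusForm k hv hσ := by
  let A : AddSubgroup (FractionRing (ToricRing k σ)) :=
    { carrier := {h | P.val h ≤ WithZero.exp (-δ)}
      zero_mem' := by simp
      add_mem' := fun hx hy => P.val.map_add_le hx hy
      neg_mem' := fun {x} hx => (P.val.map_neg x).trans_le hx }
  suffices hle : regularForms k n P ≤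
      A.map (LinearMap.toSpanSingleton _ _ (torusForm k hv hσ)).toAddMonoidHom by
    obtain ⟨h, hh, e⟩ := hle hη
    exact ⟨h, hh, e.symm⟩
  refine (AddSubgroup.closure_le _).2 ?_
  rintro _ ⟨g, hg, f, hf, rfl⟩
  have : ∀ j, ∃ c ∈ C, KaehlerDifferential.D k (FractionRing (ToricRing k σ)) (f j) =
      ∑ l, c l • dlogCoord k hv hσ l := by
    intro j
    obtain ⟨a, s, hs, e⟩ := mem_localRing.1 (hf j)
    rw [e]
    exact exists_coeff_D hv hσ _ C hC a s (inv_algebraMap_mem_localRing hs)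
  choose c hc hcf using this
  refine ⟨g * Matrix.det (Matrix.of c), ?_, ?_⟩
  · change P.val _ ≤ _
    rw [map_mul]
    exact (mul_le_of_le_one_left' (P.val_le_one_iff.2 hg)).trans (hdet _ hc)
  · change (g * Matrix.det (Matrix.of c)) • torusForm k hv hσ = _
    rw [← smul_smul, torusForm, ← ιMulti_sum_smul]
    congr 2
    ext1 j
    exact (hcf j).symm

/-- Lower bound for the regular forms, from a basis of the character lattice. -/
theorem smul_torusForm_mem_regularForms (P : PrimeDivisor (ToricRing k σ))
    (U : Fin n → Fin n → ℤ) (hU : IsUnit (Matrix.of U).det)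
    (hU0 : ∀ j, 0 ≤ P.ord (character k hv hσ (U j))) {h : FractionRing (ToricRing k σ)}
    (hh : h ≠ 0) (hord : P.ord (character k hv hσ (∑ j, U j)) ≤ P.ord h) :
    h • torusForm k hv hσ ∈ regularForms k n P := by
  have hne : ∀ u, character k hv hσ u ≠ 0 := toFrac_single_ne_zero (k := k) hv hσ
  have hprod : ∏ j, character k hv hσ (U j) = character k hv hσ (∑ j, U j) := by
    rw [character, ← map_prod, AddMonoidAlgebra.prod_single, Finset.prod_const_one]
  -- The wedge of the dχ^{U_j} is ε χ^{∑ U_j} times the torus form, with ε = ±1. Dividing h by this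
  -- factor leaves a coefficient in the local ring.
  set ε : FractionRing (ToricRing k σ) := (((Matrix.of U).det : ℤ) : FractionRing (ToricRing k σ)) with hε
  have hεε : ε * ε = 1 := by
    rw [hε, ← Int.cast_mul, Int.isUnit_mul_self hU, Int.cast_one]
  have hmem : h * (character k hv hσ (∑ j, U j))⁻¹ * ε ∈ localRing _ P.ideal := by
    rw [← P.val_le_one_iff, map_mul]
    refine mul_le_one' ?_ (valuation_intCast_le_one _ _)
    rw [P.val_le_one_iff, ← P.ord_nonneg_iff (mul_ne_zero hh (inv_ne_zero (hne _))),
      P.ord_mul hh (inv_ne_zero (hne _)), P.ord_inv]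
    omega
  refine AddSubgroup.subset_closure ⟨_, hmem, fun j => character k hv hσ (U j),
    fun j => (P.ord_nonneg_iff (hne _)).1 (hU0 j), ?_⟩
  have hdet : Matrix.det (Matrix.of fun j l => character k hv hσ (U j) *
      ((U j l : ℤ) : FractionRing (ToricRing k σ))) = character k hv hσ (∑ j, U j) * ε := by
    rw [← hprod, hε]
    have h1 := Matrix.det_mul_column (fun j => character k hv hσ (U j))
      ((Matrix.of U).map (Int.castRingHom (FractionRing (ToricRing k σ))))
    have h2 := (Int.castRingHom (FractionRing (ToricRing k σ))).map_det (Matrix.of U)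
    rw [eq_intCast] at h2
    rw [h2]
    exact h1
  have h3 := ιMulti_sum_smul (dlogCoord k hv hσ) (Matrix.of fun j l => character k hv hσ (U j) *
      ((U j l : ℤ) : FractionRing (ToricRing k σ)))
  simp only [D_character]
  rw [hdet] at h3
  simp only [Matrix.of_apply] at h3
  rw [h3, smul_smul, torusForm]
  congr 1
  calc h = h * ((character k hv hσ (∑ j, U j))⁻¹ * character k hv hσ (∑ j, U j)) * (ε * ε) := by
        rw [hεε, inv_mul_cancel₀ (hne _), mul_one, mul_one]
    _ = _ := by ring

/-- Characters are units at P, so the coordinate characters show that the torus form is regular, and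
all coefficient vectors, hence all determinants, are integral. -/
theorem mem_regularForms_of_isNontoric {P : PrimeDivisor (ToricRing k σ)} (hP : IsNontoric P)
    {h : FractionRing (ToricRing k σ)} (hh : h ≠ 0) (hη : torusForm k hv hσ ≠ 0) :
    h • torusForm k hv hσ ∈ regularForms k n P ↔ 0 ≤ P.ord h := by
  constructor
  · intro hmem
    let C : Submodule (localRing _ P.ideal) (Fin n → FractionRing (ToricRing k σ)) :=
      { carrier := {c | ∀ l, P.val (c l) ≤ 1}
        zero_mem' := fun l => by simp
        add_mem' := fun hx hy l => P.val.map_add_le (hx l) (hy l)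
        smul_mem' := fun x c hc l => by
          change P.val ((x : FractionRing (ToricRing k σ)) * c l) ≤ 1
          rw [map_mul]
          exact mul_le_one' (P.val_le_one_iff.2 x.2) (hc l) }
    obtain ⟨h', hh', e⟩ := exists_of_mem_regularForms hv hσ P 0 C (fun u l => by
      rw [map_mul]
      refine mul_le_one' ?_ (valuation_intCast_le_one _ _)
      rw [P.val_le_one_iff, ← P.ord_nonneg_iff (toFrac_single_ne_zero hv hσ _), hP.ord_single])
      (fun M hM => by
        rw [neg_zero, WithZero.exp_zero]
        exact valuation_det_le_one _ hM) hmem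
    have : h = h' := smul_left_injective _ hη e
    subst this
    rwa [P.val_le_exp_iff hh, neg_zero, add_zero] at hh'
  · intro h0
    refine smul_torusForm_mem_regularForms hv hσ P (fun j => Pi.single j 1) (by
      rw [show (Matrix.of fun j => Pi.single j 1 : Matrix (Fin n) (Fin n) ℤ) = 1 by
        ext j l
        simp [Matrix.one_apply, Pi.single_apply, eq_comm], Matrix.det_one]
      exact isUnit_one) (fun j => ?_) hh ?_
    · exact (hP.ord_single hv hσ _).ge
    · exact (hP.ord_single hv hσ _).trans_le h0

/-- A primitive generator is part of a dual basis. -/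
theorem exists_unimodular (hv : IsPrimitiveGenerators σ v) (i : Fin r) :
    ∃ U : Fin n → Fin n → ℤ, IsUnit (Matrix.of U).det ∧
    (∀ j, 0 ≤ U j ⬝ᵥ v i) ∧ (∑ j, U j) ⬝ᵥ v i = 1 := by
  obtain ⟨m, hm⟩ := hv.exists_dotProduct_eq_one i
  let φ : (Fin n → ℤ) →ₗ[ℤ] ℤ :=
    { toFun := fun u => u ⬝ᵥ v i
      map_add' := fun u w => add_dotProduct u w _
      map_smul' := fun c u => smul_dotProduct c u _ }
  obtain ⟨d, b⟩ := Submodule.basisOfPid (Pi.basisFun ℤ (Fin n)) (LinearMap.ker φ)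
  have hφ : ∀ u : LinearMap.ker φ, (u : Fin n → ℤ) ⬝ᵥ v i = 0 := fun u => u.2
  -- A basis of the sublattice of height 0 is completed by m, which has height 1. The heights of the
  -- basis are then 1, 0, …, 0.
  let B := Module.Basis.mkFinCons m b (fun c x hx h => by
    have := congrArg φ h
    rw [map_add, LinearMap.mem_ker.1 hx, map_smul, map_zero, add_zero] at this
    change c * (m ⬝ᵥ v i) = 0 at this
    rwa [hm, mul_one] at this) (fun z => ⟨-φ z, by
    rw [LinearMap.mem_ker, map_add, map_smul]
    change φ z + -φ z * (m ⬝ᵥ v i) = 0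
    rw [hm]
    ring⟩)
  have hn : d + 1 = n := by
    have := Module.finrank_eq_card_basis B
    rw [Module.finrank_fin_fun, Fintype.card_fin] at this
    exact this.symm
  subst hn
  have hB : ∀ j, B j = Fin.cons (α := fun _ => Fin (d + 1) → ℤ) m
      (fun l => ((b l : LinearMap.ker φ) : Fin (d + 1) → ℤ)) j := fun j =>
    congrFun (Module.Basis.coe_mkFinCons _ _ _ _) j
  refine ⟨B, ?_, fun j => ?_, ?_⟩
  · have := Module.Basis.isUnit_det (Pi.basisFun ℤ (Fin (d + 1))) B
    rw [Pi.basisFun_det] at this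
    exact this
  · rw [hB]
    refine Fin.cases ?_ (fun l => ?_) j
    · rw [Fin.cons_zero, hm]
      exact zero_le_one
    · rw [Fin.cons_succ]
      exact (hφ (b l)).ge
  · rw [sum_dotProduct, Fin.sum_univ_succ]
    simp only [hB, Fin.cons_zero, Fin.cons_succ, hm]
    rw [Finset.sum_eq_zero fun l _ => hφ (b l), add_zero]

/-- The torus form has a simple pole along the ray divisor. The coefficient vector of dχ^u pairs
with v i to (u·v i) χ^u, which vanishes at the divisor: either u·v i = 0 or χ^u has positive order.
Modulo the maximal ideal all coefficient vectors thus lie in one hyperplane, so their determinants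
vanish there. Conversely, a lattice basis of heights 1, 0, …, 0 attains order one. -/
theorem mem_regularForms_rayDivisor (i : Fin r)
    {h : FractionRing (ToricRing k σ)} (hh : h ≠ 0) (hη : torusForm k hv hσ ≠ 0) :
    h • torusForm k hv hσ ∈ regularForms k n (rayDivisor k hv hσ i) ↔
      1 ≤ (rayDivisor k hv hσ i).ord h := by
  set P := rayDivisor k hv hσ i with hPdef
  constructor
  · intro hmem
    let C : Submodule (localRing _ P.ideal) (Fin n → FractionRing (ToricRing k σ)) :=
      { carrier := {c | (∀ l, P.val (c l) ≤ 1) ∧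
          P.val (c ⬝ᵥ fun l => ((v i l : ℤ) : FractionRing (ToricRing k σ))) < 1}
        zero_mem' := ⟨fun l => by simp, by simp⟩
        add_mem' := fun hx hy => ⟨fun l => P.val.map_add_le (hx.1 l) (hy.1 l), by
          rw [add_dotProduct]
          exact P.val.map_add_lt hx.2 hy.2⟩
        smul_mem' := fun x c hc => ⟨fun l => by
            change P.val ((x : FractionRing (ToricRing k σ)) * c l) ≤ 1
            rw [map_mul]
            exact mul_le_one' (P.val_le_one_iff.2 x.2) (hc.1 l), by
          change P.val (((x : FractionRing (ToricRing k σ)) • c) ⬝ᵥ _) < 1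
          rw [smul_dotProduct, smul_eq_mul, map_mul]
          exact (mul_le_of_le_one_left' (P.val_le_one_iff.2 x.2)).trans_lt hc.2⟩ }
    obtain ⟨m, hm⟩ := hv.exists_dotProduct_eq_one i
    obtain ⟨h', hh', e⟩ := exists_of_mem_regularForms hv hσ P 1 C (fun u => ⟨fun l => by
      rw [map_mul]
      refine mul_le_one' ?_ (valuation_intCast_le_one _ _)
      rw [P.val_le_one_iff, character, toFrac_monomial]
      exact algebraMap_mem_localRing _, by
      have e : (fun l => character k hv hσ (u : Fin n → ℤ) *
          (((u : Fin n → ℤ) l : ℤ) : FractionRing (ToricRing k σ))) ⬝ᵥ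
          (fun l => ((v i l : ℤ) : FractionRing (ToricRing k σ))) =
          character k hv hσ (u : Fin n → ℤ) *
            (((u : Fin n → ℤ) ⬝ᵥ v i : ℤ) : FractionRing (ToricRing k σ)) := by
        simp only [dotProduct, Int.cast_sum, Int.cast_mul, Finset.mul_sum, mul_assoc]
      rw [e, map_mul]
      rcases eq_or_ne ((u : Fin n → ℤ) ⬝ᵥ v i) 0 with h0 | h0
      · rw [h0, Int.cast_zero, map_zero, mul_zero]
        exact zero_lt_one
      · refine (mul_le_of_le_one_right' (valuation_intCast_le_one _ _)).trans_lt ?_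
        rw [P.val_lt_one_iff, P.val_le_exp_iff (toFrac_single_ne_zero hv hσ _),
          ord_rayDivisor_single]
        have := hv.dotProduct_nonneg i u u.2
        omega⟩)
      (fun M hM => by
        rw [← P.val_lt_one_iff]
        refine valuation_det_lt_one _ (fun j => (hM j).1)
          (m := fun l => ((m l : ℤ) : FractionRing (ToricRing k σ)))
          (fun l => valuation_intCast_le_one _ _) ?_ (fun j => (hM j).2)
        rw [dotProduct]
        simp only [← Int.cast_mul, ← Int.cast_sum]
        rw [← dotProduct, hm, Int.cast_one]) hmem
    have : h = h' := smul_left_injective _ hη e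
    subst this
    rw [P.val_le_exp_iff hh] at hh'
    omega
  · intro h0
    obtain ⟨U, hU, hU0, hU1⟩ := exists_unimodular hv i
    refine smul_torusForm_mem_regularForms hv hσ P U hU (fun j => ?_) hh ?_
    · rw [ord_rayDivisor_single]
      exact hU0 j
    · rw [ord_rayDivisor_single, hU1]
      exact h0

end Canonical

/-! ### The rational point of M attached to a ℚ-Gorenstein pair -/

section Gorenstein

variable {k : Type*} [Field k] {n r : ℕ} {σ : PointedCone ℝ (Fin n → ℝ)}
  {v : Fin r → Fin n → ℤ} (hv : IsPrimitiveGenerators σ v)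
  (hσ : (σ : ConvexCone ℝ (Fin n → ℝ)).Salient)

/-- A divisor that is principal near the torus-fixed point and trivial on the torus there is the
divisor of a character along the rays. -/
theorem exists_character_of_locally_principal
    (hv : IsPrimitiveGenerators σ v) (hσ : (σ : ConvexCone ℝ (Fin n → ℝ)).Salient)
    (hfull : Submodule.span ℝ (σ : Set (Fin n → ℝ)) = ⊤) {s : ToricRing k σ}
    (hs : s ∉ maxIdeal k σ) {f : FractionRing (ToricRing k σ)} (hf : f ≠ 0)
    (hford : ∀ P : PrimeDivisor (ToricRing k σ), IsNontoric P → s ∉ P.ideal → P.ord f = 0) :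
    ∃ u : Fin n → ℤ, ∀ i, u ⬝ᵥ v i = (rayDivisor k hv hσ i).ord f := by
  have hprime := hv.isPrime_maxIdeal (k := k) hfull
  have hs0 : algebraMap _ (FractionRing (ToricRing k σ)) s ≠ 0 :=
    algebraMap_fractionRing_ne_zero (by rintro rfl; exact hs (Ideal.zero_mem _))
  -- Both f and f⁻¹ become Laurent polynomials after multiplication by powers of s. The product of
  -- the two is a power of s and has a nonzero constant term, so some u in the first support has -u
  -- in the second. The support bounds for f and f⁻¹ then force equality along every ray, where s
  -- has order 0.
  obtain ⟨N₁, h₁, e₁⟩ := exists_pow_mul_eq_toFrac hv hσ f s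
    (fun P hP hsP _ => (hford P hP hsP).ge)
  obtain ⟨N₂, h₂, e₂⟩ := exists_pow_mul_eq_toFrac hv hσ f⁻¹ s
    (fun P hP hsP _ => by rw [P.ord_inv, hford P hP hsP, neg_zero])
  have hmul : h₁ * h₂ = incl k σ (s ^ (N₁ + N₂)) := by
    apply toFrac_injective hv hσ
    rw [map_mul, e₁, e₂, toFrac_incl, map_pow, pow_add]
    field_simp
  have hc : (h₁ * h₂).coeff 0 ≠ 0 := by
    rw [hmul]
    intro h0
    have h1 : (s ^ (N₁ + N₂)).coeff 0 = 0 := by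
      rw [← coeff_incl]
      exact h0
    exact hs (hprime.mem_of_pow_mem _ ((hv.mem_maxIdeal hfull).2 h1))
  classical
  obtain ⟨u, hu, w, hw, huw⟩ := Finset.mem_add.1
    (AddMonoidAlgebra.support_coeff_mul_subset h₁ h₂ (Finsupp.mem_support_iff.2 hc))
  refine ⟨u, fun i => ?_⟩
  have hsi : (rayDivisor k hv hσ i).ord (algebraMap _ _ s) = 0 := by
    refine PrimeDivisor.ord_algebraMap_eq_zero _ fun hmem => hs ?_
    rw [hv.mem_maxIdeal hfull]
    exact (mem_rayIdeal (hv.dotProduct_nonneg i)).1 hmem 0 (by simp)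
  have l₁ := ord_rayDivisor_le hv hσ i hu
  have l₂ := ord_rayDivisor_le hv hσ i hw
  rw [e₁, PrimeDivisor.ord_mul _ (pow_ne_zero _ hs0) hf, PrimeDivisor.ord_pow, hsi] at l₁
  rw [e₂, PrimeDivisor.ord_mul _ (pow_ne_zero _ hs0) (inv_ne_zero hf), PrimeDivisor.ord_pow, hsi,
    PrimeDivisor.ord_inv] at l₂
  have h3 := congrArg (· ⬝ᵥ v i) huw
  simp only [add_dotProduct, zero_dotProduct] at h3
  omega

/-- Regularity of f g times the torus form has one threshold in ord f computed from g and another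
from K. They agree because every integer occurs as an order. -/
theorem canonicalDivisor_eq {K : PrimeDivisor (ToricRing k σ) → ℤ}
    {g : FractionRing (ToricRing k σ)} (hg : g ≠ 0) (hη : torusForm k hv hσ ≠ 0)
    (hK : ∀ (P : PrimeDivisor (ToricRing k σ)) (f : FractionRing (ToricRing k σ)), f ≠ 0 →
      (f • g • torusForm k hv hσ ∈ regularForms k n P ↔ 0 ≤ P.ord f + K P)) :
    (∀ P, IsNontoric P → K P = P.ord g) ∧
      ∀ i, K (rayDivisor k hv hσ i) = (rayDivisor k hv hσ i).ord g - 1 := by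
  have key : ∀ (P : PrimeDivisor (ToricRing k σ)) (δ : ℤ),
      (∀ h : FractionRing (ToricRing k σ), h ≠ 0 →
        (h • torusForm k hv hσ ∈ regularForms k n P ↔ δ ≤ P.ord h)) → K P = P.ord g - δ := by
    intro P δ h
    have h1 : ∀ f : FractionRing (ToricRing k σ), f ≠ 0 →
        (δ ≤ P.ord f + P.ord g ↔ 0 ≤ P.ord f + K P) := fun f hf => by
      rw [← hK P f hf, smul_smul, h _ (mul_ne_zero hf hg), P.ord_mul hf hg]
    obtain ⟨z, hz0, hz⟩ := P.exists_ord_eq (-K P)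
    obtain ⟨z', hz'0, hz'⟩ := P.exists_ord_eq (δ - P.ord g)
    have h2 := (h1 z hz0).2 (by omega)
    have h3 := (h1 z' hz'0).1 (by omega)
    omega
  refine ⟨fun P hP => ?_, fun i => key _ 1 fun h hh => mem_regularForms_rayDivisor hv hσ i hh hη⟩
  rw [key P 0 fun h hh => mem_regularForms_of_isNontoric hv hσ hP hh hη, sub_zero]

/-- For a `ℚ`-Gorenstein pair `-(K + D)` is represented by a rational point of `M`. -/
theorem IsQGorenstein.exists_dotProduct_eq
    (hv : IsPrimitiveGenerators σ v) (hσ : (σ : ConvexCone ℝ (Fin n → ℝ)).Salient)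
    (hfull : Submodule.span ℝ (σ : Set (Fin n → ℝ)) = ⊤) (hdim : ringKrullDim (ToricRing k σ) = n)
    {a : Fin r → ℚ} (hD : IsQGorenstein k (toricDivisor k σ v a)) :
    ∃ w : Fin n → ℝ, ∀ i, w ⬝ᵥ toReal (v i) = 1 - (a i : ℝ) := by
  obtain ⟨K, ⟨d, hd, ω, hω0, hω⟩, m, hm, C, hC, hcart⟩ := hD
  have hdn : d = n := by
    rw [hdim] at hd
    exact_mod_cast hd.symm
  subst hdn
  obtain ⟨g, rfl⟩ := exists_eq_smul_torusForm hv hσ ω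
  have hg : g ≠ 0 := by rintro rfl; exact hω0 (zero_smul _ _)
  have hη : torusForm k hv hσ ≠ 0 := fun h => hω0 (by rw [h, smul_zero])
  obtain ⟨hK0, hK1⟩ := canonicalDivisor_eq hv hσ hg hη hω
  obtain ⟨s, hs, f, hf, hfC⟩ := hcart ⟨maxIdeal k σ, hv.isPrime_maxIdeal hfull⟩
  -- Dividing the local equation f of C by g^m removes the contribution of the rational form g. Off
  -- the rays D is zero and K is div g, so the quotient has order 0 there.
  obtain ⟨u, hu⟩ := exists_character_of_locally_principal hv hσ hfull hs
    (div_ne_zero hf (pow_ne_zero m hg)) (by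
      intro P hP hsP
      have h1 := hC P
      rw [toricDivisor_of_isNontoric hv hσ a hP, add_zero, hK0 P hP] at h1
      have h2 : C P = m * P.ord g := by exact_mod_cast h1
      rw [P.ord_div hf (pow_ne_zero m hg), P.ord_pow, hfC P hsP, h2, sub_self])
  have hm' : (m : ℝ) ≠ 0 := by exact_mod_cast hm.ne'
  -- Along the i-th ray f/g^m has order m(a_i - 1), whence the factor -1/m.
  refine ⟨-((m : ℝ)⁻¹ • toReal u), fun i => ?_⟩
  have hsi : s ∉ (rayDivisor k hv hσ i).ideal := fun hmem => hs (by
    change s ∈ maxIdeal k σ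
    rw [hv.mem_maxIdeal hfull]
    exact (mem_rayIdeal (hv.dotProduct_nonneg i)).1 hmem 0 (by simp))
  have h1 := hC (rayDivisor k hv hσ i)
  rw [toricDivisor_rayDivisor, hK1] at h1
  have h2 := hu i
  rw [PrimeDivisor.ord_div _ hf (pow_ne_zero m hg), PrimeDivisor.ord_pow, hfC _ hsi] at h2
  have h3 : ((u ⬝ᵥ v i : ℤ) : ℝ) = C (rayDivisor k hv hσ i) -
      m * ((rayDivisor k hv hσ i).ord g : ℝ) := by exact_mod_cast h2
  have h4 : ((C (rayDivisor k hv hσ i) : ℤ) : ℝ) =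
      m * ((((rayDivisor k hv hσ i).ord g : ℤ) : ℝ) - 1 + (a i : ℝ)) := by exact_mod_cast h1
  rw [neg_dotProduct, smul_dotProduct, toReal_dotProduct_toReal, h3, h4, smul_eq_mul]
  field_simp
  ring

end Gorenstein

/-! ### Dimension and length -/

section Dimension

variable {k : Type*} [Field k] {n r : ℕ} {σ : PointedCone ℝ (Fin n → ℝ)}
  {v : Fin r → Fin n → ℤ} (hv : IsPrimitiveGenerators σ v)
  (hσ : (σ : ConvexCone ℝ (Fin n → ℝ)).Salient)

/-- The projection of `ℤⁿ` killing the first `j` coordinates. -/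
def dropCoord (j : ℕ) : (Fin n → ℤ) →+ (Fin n → ℤ) where
  toFun u := fun l => if (l : ℕ) < j then 0 else u l
  map_zero' := by ext; simp
  map_add' u w := by
    ext l
    simp only [Pi.add_apply]
    split_ifs <;> simp

variable (k σ) in
/-- The homomorphism setting the first `j` coordinates of the torus to one. -/
def dropHom (j : ℕ) : ToricRing k σ →+* Laurent k n :=
  (AddMonoidAlgebra.mapDomainRingHom k (dropCoord j)).comp (incl k σ)

theorem dropHom_monomial (j : ℕ) (u : dualMonoid σ) :
    dropHom k σ j (monomial k σ u) = AddMonoidAlgebra.single (dropCoord j (u : Fin n → ℤ)) 1 := by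
  rw [dropHom, RingHom.comp_apply, monomial, incl_single]
  exact AddMonoidAlgebra.mapDomain_single

theorem dropHom_succ (j : ℕ) : dropHom k σ (j + 1) =
    (AddMonoidAlgebra.mapDomainRingHom k (dropCoord (j + 1))).comp (dropHom k σ j) := by
  rw [dropHom, dropHom, ← RingHom.comp_assoc, ← AddMonoidAlgebra.mapDomainRingHom_comp]
  congr 2
  ext u l
  simp [dropCoord]
  split_ifs <;> first | rfl | omega

/-- Setting successive coordinates of the torus to one gives a chain of n + 1 primes. It is strict
because χ^{e_j + s} - χ^s is killed only once the coordinate j has been set to one. -/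
theorem le_ringKrullDim
    (hv : IsPrimitiveGenerators σ v)
    (hσ : (σ : ConvexCone ℝ (Fin n → ℝ)).Salient) : (n : WithBot ℕ∞) ≤ ringKrullDim (ToricRing k σ) := by
  let c : LTSeries (PrimeSpectrum (ToricRing k σ)) :=
    { length := n
      toFun := fun j => ⟨RingHom.ker (dropHom k σ j), RingHom.ker_isPrime _⟩
      step := fun j => by
        change RingHom.ker (dropHom k σ j.castSucc) < RingHom.ker (dropHom k σ j.succ)
        rw [Fin.val_castSucc, Fin.val_succ]
        refine lt_of_le_not_ge (fun f hf => ?_) fun hle => ?_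
        · rw [RingHom.mem_ker] at hf ⊢
          rw [dropHom_succ, RingHom.comp_apply, hf, map_zero]
        · obtain ⟨s, hs, h⟩ := hv.exists_translate hσ {Pi.single j 1}
          have hs' := h _ (Finset.mem_singleton_self _)
          have h1 : monomial k σ ⟨_, hs'⟩ - monomial k σ ⟨s, hs⟩ ∈
              RingHom.ker (dropHom k σ (j + 1)) := by
            rw [RingHom.mem_ker, map_sub, dropHom_monomial, dropHom_monomial, sub_eq_zero]
            congr 1
            ext l
            simp only [dropCoord, AddMonoidHom.coe_mk, ZeroHom.coe_mk, Pi.add_apply]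
            split_ifs with hl
            · rfl
            · rw [Pi.single_eq_of_ne, zero_add]
              rintro rfl
              omega
          have h2 := hle h1
          rw [RingHom.mem_ker, map_sub, dropHom_monomial, dropHom_monomial, sub_eq_zero,
            AddMonoidAlgebra.single_left_inj one_ne_zero] at h2
          have h3 := congrFun h2 j
          simp [dropCoord] at h3 }
  exact Order.LTSeries.length_le_krullDim c

/-- The nonzero form defining K has degree equal to the dimension, and nonzero forms have degree at
most n. -/
theorem IsQGorenstein.ringKrullDim_eq
    (hv : IsPrimitiveGenerators σ v)
    (hσ : (σ : ConvexCone ℝ (Fin n → ℝ)).Salient) {D : PrimeDivisor (ToricRing k σ) → ℚ}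
    (hD : IsQGorenstein k D) : ringKrullDim (ToricRing k σ) = n := by
  obtain ⟨K, ⟨d, hd, ω, hω0, -⟩, -⟩ := hD
  refine le_antisymm ?_ (le_ringKrullDim hv hσ)
  rw [hd]
  exact_mod_cast le_of_exteriorPower_ne_zero hv hσ hω0

/-- The ideal of all elements without terms in a set of exponents closed under passing to
divisors. -/
def cofaceIdeal (T : Set (dualMonoid σ)) (hT : ∀ u d, u + d ∈ T → u ∈ T) :
    Ideal (ToricRing k σ) where
  carrier := {f | ∀ u ∈ T, f.coeff u = 0}
  zero_mem' := fun u _ => rfl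
  add_mem' := fun {f g} hf hg u hu => by
    rw [AddMonoidAlgebra.coeff_add, Finsupp.add_apply, hf u hu, hg u hu, add_zero]
  smul_mem' := fun c f hf u hu => by
    classical
    by_contra hne
    obtain ⟨b, hb, w, hw, rfl⟩ := Finset.mem_add.1
      (AddMonoidAlgebra.support_coeff_mul_subset c f (Finsupp.mem_support_iff.2 hne))
    exact Finsupp.mem_support_iff.1 hw (hf w (hT w b (by rwa [add_comm])))

theorem isMaximal_maxIdeal (hv : IsPrimitiveGenerators σ v)
    (hfull : Submodule.span ℝ (σ : Set (Fin n → ℝ)) = ⊤) :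
    (maxIdeal k σ).IsMaximal := by
  refine Ideal.isMaximal_iff.2 ⟨?_, fun J x hJ hx hxJ => ?_⟩
  · rw [hv.mem_maxIdeal hfull, AddMonoidAlgebra.one_def]
    simp
  · rw [hv.mem_maxIdeal hfull] at hx
    have h1 : AddMonoidAlgebra.single 0 (x.coeff 0)⁻¹ * x ∈ J := J.mul_mem_left _ hxJ
    have h2 : AddMonoidAlgebra.single 0 (x.coeff 0)⁻¹ * x - 1 ∈ J := by
      refine hJ ((hv.mem_maxIdeal hfull).2 ?_)
      rw [AddMonoidAlgebra.coeff_sub, Finsupp.sub_apply, AddMonoidAlgebra.coeff_single_zero_mul,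
        inv_mul_cancel₀ hx, AddMonoidAlgebra.one_def]
      simp
    simpa using J.sub_mem h1 h2

/-- Remove from T an exponent u of greatest total height. No other element of T is a multiple of it,
so the class of χ^u has annihilator the maximal ideal and spans the kernel of the quotient map for
the smaller set. Each step costs length one. -/
theorem length_quotient_cofaceIdeal
    (hv : IsPrimitiveGenerators σ v) (hfull : Submodule.span ℝ (σ : Set (Fin n → ℝ)) = ⊤)
    (m : ℕ) (T : Finset (dualMonoid σ)) (hm : T.card = m)
    (hT : ∀ u d, u + d ∈ (T : Set (dualMonoid σ)) → u ∈ (T : Set (dualMonoid σ))) :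
    Module.length (ToricRing k σ) (ToricRing k σ ⧸ cofaceIdeal (k := k) (T : Set _) hT) = m := by
  classical
  induction m generalizing T with
  | zero =>
    obtain rfl := Finset.card_eq_zero.1 hm
    have : cofaceIdeal (k := k) ((∅ : Finset (dualMonoid σ)) : Set (dualMonoid σ)) hT = ⊤ := by
      rw [Ideal.eq_top_iff_one]
      exact fun u hu => by simp at hu
    rw [Nat.cast_zero, Module.length_eq_zero_iff, this]
    exact Submodule.Quotient.subsingleton_iff.2 rfl
  | succ m ih =>
    have hne : T.Nonempty := Finset.card_pos.1 (by omega)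
    obtain ⟨u, hu, hmax⟩ := Finset.exists_max_image T
      (fun u : dualMonoid σ => ∑ i, (u : Fin n → ℤ) ⬝ᵥ v i) hne
    have htop : ∀ d, u + d ∈ T → d = 0 := by
      intro d hd
      have h1 := hmax _ hd
      simp only [AddSubmonoid.coe_add, add_dotProduct, Finset.sum_add_distrib] at h1
      have h2 : ∑ i, (d : Fin n → ℤ) ⬝ᵥ v i = 0 := le_antisymm (by omega)
        (Finset.sum_nonneg fun i _ => hv.dotProduct_nonneg i d d.2)
      rw [Finset.sum_eq_zero_iff_of_nonneg fun i _ => hv.dotProduct_nonneg i d d.2] at h2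
      exact Subtype.ext (hv.eq_zero_of_forall_dotProduct_int hfull
        fun i => h2 i (Finset.mem_univ i))
    have hT' : ∀ w d, w + d ∈ ((T.erase u : Finset _) : Set (dualMonoid σ)) →
        w ∈ ((T.erase u : Finset _) : Set (dualMonoid σ)) := by
      intro w d hwd
      rw [Finset.mem_coe, Finset.mem_erase] at hwd ⊢
      refine ⟨?_, hT w d hwd.2⟩
      rintro rfl
      exact hwd.1 (by rw [htop d hwd.2, add_zero])
    have hle : cofaceIdeal (k := k) (T : Set _) hT ≤ cofaceIdeal _ hT' :=
      fun f hf w hw => hf w (Finset.mem_of_mem_erase hw)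
    have hmul : ∀ f : ToricRing k σ, f * monomial k σ u ∈ cofaceIdeal (k := k) (T : Set _) hT ↔
        f ∈ maxIdeal k σ := by
      intro f
      rw [hv.mem_maxIdeal hfull]
      constructor
      · intro hf
        have h1 := hf u hu
        have h2 := AddMonoidAlgebra.coeff_mul_single_add f (1 : k) u 0
        rw [zero_add, mul_one] at h2
        exact h2.symm.trans h1
      · intro hf w hw
        by_cases hex : ∃ d, d + u = w
        · obtain ⟨d, rfl⟩ := hex
          rw [monomial, AddMonoidAlgebra.coeff_mul_single_add, mul_one,
            htop d (by rw [add_comm]; exact hw), hf]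
        · push Not at hex
          exact AddMonoidAlgebra.coeff_mul_single_of_forall_add_ne _ _ hex
    have := isMaximal_maxIdeal (k := k) hv hfull
    have hsimple : IsSimpleModule (ToricRing k σ) (ToricRing k σ ⧸ maxIdeal k σ) :=
      isSimpleModule_iff_isCoatom.2 this.out
    let φ : (ToricRing k σ ⧸ maxIdeal k σ) →ₗ[ToricRing k σ]
        (ToricRing k σ ⧸ cofaceIdeal (k := k) (T : Set _) hT) :=
      Submodule.mapQ _ _ (LinearMap.toSpanSingleton _ _ (monomial k σ u))
        (fun f hf => (hmul f).2 hf)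
    let ψ : (ToricRing k σ ⧸ cofaceIdeal (k := k) (T : Set _) hT) →ₗ[ToricRing k σ]
        (ToricRing k σ ⧸ cofaceIdeal (k := k) _ hT') := Submodule.factor hle
    have hφmk : ∀ f, φ (Submodule.Quotient.mk f) = Submodule.Quotient.mk (f * monomial k σ u) :=
      fun f => rfl
    have hφ : Function.Injective φ := by
      rw [← LinearMap.ker_eq_bot, Submodule.eq_bot_iff]
      intro x hx
      obtain ⟨f, rfl⟩ := Submodule.Quotient.mk_surjective _ x
      rw [LinearMap.mem_ker, hφmk, Submodule.Quotient.mk_eq_zero] at hx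
      exact (Submodule.Quotient.mk_eq_zero _).2 ((hmul f).1 hx)
    have hψ : Function.Surjective ψ := Submodule.factor_surjective hle
    have hexact : Function.Exact φ ψ := by
      intro x
      obtain ⟨f, rfl⟩ := Submodule.Quotient.mk_surjective _ x
      constructor
      · intro hx
        have hf : f ∈ cofaceIdeal (k := k) _ hT' := (Submodule.Quotient.mk_eq_zero _).1 hx
        refine ⟨Submodule.Quotient.mk (AddMonoidAlgebra.single 0 (f.coeff u)), ?_⟩
        rw [hφmk, Submodule.Quotient.eq]
        intro w hw
        rw [AddMonoidAlgebra.coeff_sub, Finsupp.sub_apply,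
          AddMonoidAlgebra.coeff_single_zero_mul, monomial,
          AddMonoidAlgebra.coeff_single, Finsupp.single_apply]
        split_ifs with h
        · rw [h, mul_one, sub_self]
        · rw [mul_zero, zero_sub, neg_eq_zero]
          exact hf w (Finset.mem_erase.2 ⟨Ne.symm h, hw⟩)
      · rintro ⟨y, hy⟩
        obtain ⟨g, rfl⟩ := Submodule.Quotient.mk_surjective _ y
        rw [← hy, hφmk]
        refine (Submodule.Quotient.mk_eq_zero _).2 fun w hw => ?_
        by_cases hex : ∃ d, d + u = w
        · obtain ⟨d, rfl⟩ := hex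
          have h1 := Finset.mem_erase.1 hw
          exact absurd (by rw [htop d (by rw [add_comm]; exact h1.2), zero_add]) h1.1
        · push Not at hex
          exact AddMonoidAlgebra.coeff_mul_single_of_forall_add_ne _ _ hex
    rw [Module.length_eq_add_of_exact φ ψ hφ hψ hexact, ih (T.erase u)
      (by rw [Finset.card_erase_of_mem hu, hm, Nat.add_sub_cancel]) hT', Module.length_eq_one,
      Nat.cast_succ, add_comm]

end Dimension

/-! ### Newton polyhedra -/

section Newton

variable {k : Type*} [Field k] {n r : ℕ} {σ : PointedCone ℝ (Fin n → ℝ)}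

theorem convex_newton (𝔞 : Ideal (ToricRing k σ)) : Convex ℝ (newton 𝔞) :=
  convex_convexHull ℝ _

theorem toReal_mem_newton {𝔞 : Ideal (ToricRing k σ)} {b : dualMonoid σ}
    (hb : monomial k σ b ∈ 𝔞) : toReal (b : Fin n → ℤ) ∈ newton 𝔞 :=
  subset_convexHull ℝ _ ⟨b, hb, rfl⟩

theorem IsMonomialIdeal.exists_add_of_mem_mul {I J : Ideal (ToricRing k σ)}
    (hI : IsMonomialIdeal I) (hJ : IsMonomialIdeal J) {b : dualMonoid σ}
    (hb : monomial k σ b ∈ I * J) :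
    ∃ c d, monomial k σ c ∈ I ∧ monomial k σ d ∈ J ∧ c + d = b := by
  obtain ⟨A, rfl⟩ := hI
  obtain ⟨B, rfl⟩ := hJ
  have himage : monomial k σ '' A * monomial k σ '' B = monomial k σ '' (A + B) := by
    ext x
    constructor
    · rintro ⟨_, ⟨a, ha, rfl⟩, _, ⟨b, hb, rfl⟩, rfl⟩
      exact ⟨a + b, ⟨a, ha, b, hb, rfl⟩, monomial_add a b⟩
    · rintro ⟨_, ⟨a, ha, b, hb, rfl⟩, rfl⟩
      exact ⟨_, ⟨a, ha, rfl⟩, _, ⟨b, hb, rfl⟩, (monomial_add a b).symm⟩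
  rw [Ideal.span_mul_span', himage] at hb
  obtain ⟨_, ⟨c, hc, d, hd, rfl⟩, s, hs⟩ := (AddMonoidAlgebra.mem_ideal_span_of'_image (k := k)
    (A := dualMonoid σ) (s := A + B) (x := monomial k σ b)).1 hb b
      (Finsupp.mem_support_iff.2 (by simp [monomial]))
  refine ⟨s + c, d, ?_, Ideal.subset_span ⟨d, hd, rfl⟩, by rw [hs, add_assoc]⟩
  rw [monomial_add]
  exact Ideal.mul_mem_left _ _ (Ideal.subset_span ⟨c, hc, rfl⟩)

/-- Convexity turns a sum of dilates into a dilate. The exponent must be positive: the zeroth power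
is the unit ideal, while the zeroth dilate is at most the origin. -/
theorem toReal_mem_smul_newton {𝔞 : Ideal (ToricRing k σ)} (h𝔞 : IsMonomialIdeal 𝔞) (m : ℕ)
    {b : dualMonoid σ} (hb : monomial k σ b ∈ 𝔞 ^ (m + 1)) :
    toReal (b : Fin n → ℤ) ∈ ((m : ℝ) + 1) • newton 𝔞 := by
  induction m generalizing b with
  | zero => simpa using toReal_mem_newton (by simpa using hb)
  | succ m ih =>
    obtain ⟨c, d, hc, hd, rfl⟩ := (h𝔞.pow (m + 1)).exists_add_of_mem_mul h𝔞
      (by rwa [← pow_succ])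
    rw [Nat.cast_succ, (convex_newton 𝔞).add_smul (by positivity) zero_le_one, one_smul,
      AddSubmonoid.coe_add, toReal_add]
    exact Set.add_mem_add (ih hc) (toReal_mem_newton hd)

/-- Natural multiples of s are absorbed because 𝔞 is an ideal; real ones follow by interpolating
between y and a far natural translate. -/
theorem newton_add_smul_mem {𝔞 : Ideal (ToricRing k σ)} {y : Fin n → ℝ} (hy : y ∈ newton 𝔞)
    (s : dualMonoid σ) {c : ℝ} (hc : 0 ≤ c) :
    y + c • toReal (s : Fin n → ℤ) ∈ newton 𝔞 := by
  have hnat : ∀ N : ℕ, y + (N : ℝ) • toReal (s : Fin n → ℤ) ∈ newton 𝔞 := by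
    intro N
    refine convexHull_min (t := (fun x => x + (N : ℝ) • toReal (s : Fin n → ℤ)) ⁻¹' newton 𝔞)
      ?_ ?_ hy
    · rintro _ ⟨b, hb, rfl⟩
      have : monomial k σ (N • s + b) ∈ 𝔞 := by
        rw [monomial_add]
        exact Ideal.mul_mem_left _ _ hb
      have h := toReal_mem_newton this
      rwa [AddSubmonoid.coe_add, toReal_add, AddSubmonoidClass.coe_nsmul, toReal_nsmul, add_comm] at h
    · exact (convex_newton 𝔞).translate_preimage_left _
  obtain ⟨N, hN⟩ := exists_nat_ge (c + 1)
  have hN0 : (0 : ℝ) < N := by linarith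
  have h := (convex_newton 𝔞) hy (hnat N) (a := 1 - c / N) (b := c / N)
    (sub_nonneg.2 ((div_le_one hN0).2 (by linarith))) (by positivity) (by ring)
  convert h using 1
  rw [smul_add, ← add_assoc, ← add_smul, smul_smul, div_mul_cancel₀ _ hN0.ne']
  simp

/-- Write c y = y + (c - 1) y and expand the second y as a convex combination of elements of S, each
of which is absorbed. Dilates of the polyhedron therefore decrease. -/
theorem smul_mem_newton {𝔞 : Ideal (ToricRing k σ)} {y : Fin n → ℝ} (hy : y ∈ newton 𝔞)
    {c : ℝ} (hc : 1 ≤ c) : c • y ∈ newton 𝔞 := by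
  have h : y ∈ (fun x => y + (c - 1) • x) ⁻¹' newton 𝔞 := by
    refine convexHull_min ?_ ?_ hy
    · rintro _ ⟨b, hb, rfl⟩
      exact newton_add_smul_mem hy b (sub_nonneg.2 hc)
    · exact ((convex_newton 𝔞).translate_preimage_right y).smul_preimage (c - 1)
  have h2 : y + (c - 1) • y ∈ newton 𝔞 := h
  convert h2 using 1
  rw [sub_smul, one_smul, add_sub_cancel]

theorem smul_newton_subset {𝔞 : Ideal (ToricRing k σ)} {s t : ℝ} (hs : 0 < s) (hst : s ≤ t) :
    t • newton 𝔞 ⊆ s • newton 𝔞 := by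
  rintro _ ⟨y, hy, rfl⟩
  refine ⟨(t / s) • y, smul_mem_newton hy ((one_le_div hs).2 hst), ?_⟩
  simp only [smul_smul]
  rw [mul_div_cancel₀ _ hs.ne']

variable {v : Fin r → Fin n → ℤ}

/-- A real vector of the dual cone is a limit of nonnegative multiples of elements of the dual
monoid. -/
theorem exists_tendsto_smul_toReal (hv : IsPrimitiveGenerators σ v)
    (hσ : (σ : ConvexCone ℝ (Fin n → ℝ)).Salient) {x : Fin n → ℝ}
    (hx : ∀ i, 0 ≤ x ⬝ᵥ toReal (v i)) :
    ∃ s : ℕ → dualMonoid σ, Tendsto (fun N : ℕ => ((N : ℝ) + 1)⁻¹ •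
      toReal (s N : Fin n → ℤ)) atTop (𝓝 x) := by
  obtain ⟨m, hm⟩ := hv.exists_interior hσ
  set C : ℤ := ∑ i, ∑ j, |v i j| with hC
  -- The fixed interior vector C m makes up for the rounding error, which is at most C on every ray;
  -- after rescaling its effect tends to zero.
  have hmem : ∀ N : ℕ, (fun j => ⌊((N : ℝ) + 1) * x j⌋) + C • m ∈ dualMonoid σ := by
    intro N
    rw [hv.mem_dualMonoid]
    intro i
    have h1 : -(C : ℝ) ≤ (toReal (fun j => ⌊((N : ℝ) + 1) * x j⌋)
        - ((N : ℝ) + 1) • x) ⬝ᵥ toReal (v i) := by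
      have h2 : ∑ j, |v i j| ≤ C :=
        Finset.single_le_sum (f := fun i => ∑ j, |v i j|)
          (fun i _ => Finset.sum_nonneg fun j _ => abs_nonneg _) (Finset.mem_univ i)
      have h3 : (∑ j, |(v i j : ℝ)|) ≤ C := by exact_mod_cast h2
      refine (neg_le_neg h3).trans ?_
      rw [dotProduct, ← Finset.sum_neg_distrib]
      refine Finset.sum_le_sum fun j _ => ?_
      refine (neg_le_neg ?_).trans (neg_abs_le _)
      rw [abs_mul]
      refine mul_le_of_le_one_left (abs_nonneg _) ?_
      simp only [toReal, Pi.sub_apply, Pi.smul_apply, smul_eq_mul]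
      rw [abs_sub_comm, abs_of_nonneg (sub_nonneg.2 (Int.floor_le _))]
      linarith [Int.lt_floor_add_one (((N : ℝ) + 1) * x j)]
    rw [sub_dotProduct, smul_dotProduct, toReal_dotProduct_toReal, smul_eq_mul] at h1
    have h4 : 0 ≤ ((N : ℝ) + 1) * (x ⬝ᵥ toReal (v i)) := mul_nonneg (by positivity) (hx i)
    have h5 : -C ≤ (fun j => ⌊((N : ℝ) + 1) * x j⌋) ⬝ᵥ v i := by
      have : -(C : ℝ) ≤ (((fun j => ⌊((N : ℝ) + 1) * x j⌋) ⬝ᵥ v i : ℤ) : ℝ) := by linarith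
      exact_mod_cast this
    have hC0 : 0 ≤ C := Finset.sum_nonneg fun i _ => Finset.sum_nonneg fun j _ => abs_nonneg _
    rw [add_dotProduct, smul_dotProduct, smul_eq_mul]
    nlinarith [hm i]
  refine ⟨fun N => ⟨_, hmem N⟩, ?_⟩
  rw [tendsto_pi_nhds]
  intro j
  have hN : Tendsto (fun N : ℕ => ((N : ℝ) + 1)⁻¹) atTop (𝓝 0) := by
    simpa only [one_div] using tendsto_one_div_add_atTop_nhds_zero_nat (𝕜 := ℝ)
  refine tendsto_of_tendsto_of_tendsto_of_le_of_le
    (g := fun N : ℕ => x j + ((N : ℝ) + 1)⁻¹ * (C * m j - 1))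
    (h := fun N : ℕ => x j + ((N : ℝ) + 1)⁻¹ * (C * m j)) ?_ ?_ ?_ ?_
  · simpa using (hN.mul_const ((C : ℝ) * m j - 1)).const_add (x j)
  · simpa using (hN.mul_const ((C : ℝ) * m j)).const_add (x j)
  all_goals
    intro N
    have hpos : (0 : ℝ) < (N : ℝ) + 1 := by positivity
    simp only [toReal, Pi.add_apply, Pi.smul_apply, smul_eq_mul, Int.cast_add, Int.cast_mul]
    have hxj : x j = ((N : ℝ) + 1)⁻¹ * (((N : ℝ) + 1) * x j) := by field_simp
    conv in x j + _ => rw [hxj]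
    rw [← mul_add]
    refine mul_le_mul_of_nonneg_left ?_ (by positivity)
  · linarith [Int.lt_floor_add_one (((N : ℝ) + 1) * x j)]
  · linarith [Int.floor_le (((N : ℝ) + 1) * x j)]

/-- Approximating x by multiples of elements of S avoids finite generation of S. The price is a
closure, which changes the volume of a convex set by nothing. -/
theorem add_mem_closure_smul_newton (hv : IsPrimitiveGenerators σ v)
    (hσ : (σ : ConvexCone ℝ (Fin n → ℝ)).Salient) {𝔞 : Ideal (ToricRing k σ)} {t : ℝ}
    (ht : 0 < t) {z x : Fin n → ℝ} (hz : z ∈ t • newton 𝔞) (hx : ∀ i, 0 ≤ x ⬝ᵥ toReal (v i)) :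
    z + x ∈ closure (t • newton 𝔞) := by
  obtain ⟨s, hs⟩ := exists_tendsto_smul_toReal hv hσ hx
  refine mem_closure_of_tendsto (hs.const_add z) (Eventually.of_forall fun N => ?_)
  obtain ⟨y, hy, rfl⟩ := hz
  refine ⟨y + (t⁻¹ * ((N : ℝ) + 1)⁻¹) • toReal (s N : Fin n → ℤ),
    newton_add_smul_mem hy _ (by positivity), ?_⟩
  simp only [smul_add, smul_smul]
  rw [mul_inv_cancel_left₀ ht.ne']

theorem dotProduct_nonneg_of_mem_newton (hv : IsPrimitiveGenerators σ v)
    {𝔞 : Ideal (ToricRing k σ)} {y : Fin n → ℝ} (hy : y ∈ newton 𝔞) (i : Fin r) :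
    0 ≤ y ⬝ᵥ toReal (v i) := by
  refine convexHull_min (t := {y | 0 ≤ y ⬝ᵥ toReal (v i)}) ?_ ?_ hy
  · rintro _ ⟨b, hb, rfl⟩
    rw [Set.mem_ofPred_eq, toReal_dotProduct_toReal]
    exact_mod_cast hv.dotProduct_nonneg i b b.2
  · exact convex_halfSpace_ge ⟨fun x y => add_dotProduct x y _,
      fun c x => smul_dotProduct c x _⟩ 0

end Newton

/-! ### Counting lattice points -/

section Counting

variable {n r : ℕ}

theorem finite_setOf_inv_smul_toReal_mem {s : Set (Fin n → ℝ)} (hs : Bornology.IsBounded s)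
    {q : ℝ} (hq : 0 < q) : {u : Fin n → ℤ | q⁻¹ • toReal u ∈ s}.Finite := by
  obtain ⟨C, hC⟩ := hs.subset_closedBall 0
  refine (Set.finite_Icc (fun _ => -⌈q * C⌉ : Fin n → ℤ) (fun _ => ⌈q * C⌉)).subset ?_
  intro u hu
  have h1 : ‖q⁻¹ • toReal u‖ ≤ C := by simpa using hC hu
  have h2 : ∀ j, |u j| ≤ ⌈q * C⌉ := by
    intro j
    have h3 := (norm_le_pi_norm (q⁻¹ • toReal u) j).trans h1
    rw [Pi.smul_apply, norm_smul, Real.norm_of_nonneg (by positivity), Real.norm_eq_abs,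
      inv_mul_le_iff₀ hq, toReal] at h3
    have h4 : ((|u j| : ℤ) : ℝ) ≤ (⌈q * C⌉ : ℤ) := by
      rw [Int.cast_abs]
      exact h3.trans (Int.le_ceil _)
    exact_mod_cast h4
  exact ⟨fun j => (abs_le.1 (h2 j)).1, fun j => (abs_le.1 (h2 j)).2⟩

theorem tendsto_ncard_lattice_div {s : Set (Fin n → ℝ)} (hs : Bornology.IsBounded s)
    (hms : MeasurableSet s) (hfs : volume (frontier s) = 0) {p : ℕ} (hp : 1 < p) :
    Tendsto (fun e : ℕ => (({u : Fin n → ℤ | ((p : ℝ) ^ e)⁻¹ • toReal u ∈ s}.ncard : ℕ) : ℝ≥0∞)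
      / (p : ℝ≥0∞) ^ (e * n)) atTop (𝓝 (volume s)) := by
  have h1 := (tendsto_card_div_pow_atTop_volume s hs hms hfs).comp
    (tendsto_pow_atTop_atTop_of_one_lt hp)
  have h2 := ENNReal.tendsto_ofReal h1
  rw [measureReal_def, ENNReal.ofReal_toReal hs.measure_lt_top.ne] at h2
  refine h2.congr fun e => ?_
  have hp0 : (0 : ℝ) < (p : ℝ) ^ e := by positivity
  rw [Function.comp_apply, ENNReal.ofReal_div_of_pos (by positivity), ENNReal.ofReal_natCast,
    Fintype.card_fin]
  congr 1
  · congr 1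
    rw [← Set.ncard_image_of_injective _ (f := fun u : Fin n → ℤ => ((p : ℝ) ^ e)⁻¹ • toReal u)
      (fun u w huw => toReal_injective (smul_right_injective _ (inv_ne_zero hp0.ne') huw)),
      Nat.card_coe_set_eq]
    congr 1
    ext x
    constructor
    · rintro ⟨hx, y, hy, rfl⟩
      rw [SetLike.mem_coe, Module.Basis.mem_span_iff_repr_mem] at hy
      choose u hu using hy
      have huy : toReal u = y := by
        ext j
        simpa [toReal] using hu j
      refine ⟨u, ?_, ?_⟩
      · simpa [huy] using hx
      · simp [huy]
    · rintro ⟨u, hu, rfl⟩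
      refine ⟨hu, toReal u, ?_, by simp⟩
      rw [SetLike.mem_coe, Module.Basis.mem_span_iff_repr_mem]
      intro j
      exact ⟨u j, by simp [toReal]⟩
  · rw [ENNReal.ofReal_pow (by positivity), ENNReal.ofReal_natCast, pow_mul, Nat.cast_pow]

/-- Applied to an m positive on all rays, this turns the weak inequalities defining a region into
strict ones at its interior points. -/
theorem exists_pos_add_sub_smul_mem {A : Set (Fin n → ℝ)} {y : Fin n → ℝ} (hy : y ∈ interior A)
    (m : Fin n → ℝ) : ∃ δ : ℝ, 0 < δ ∧ y + δ • m ∈ A ∧ y - δ • m ∈ A := by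
  have h1 : Tendsto (fun δ : ℝ => y + δ • m) (𝓝[>] 0) (𝓝 y) := by
    have : Continuous fun δ : ℝ => y + δ • m := by fun_prop
    simpa using (this.tendsto 0).mono_left nhdsWithin_le_nhds
  have h2 : Tendsto (fun δ : ℝ => y - δ • m) (𝓝[>] 0) (𝓝 y) := by
    have : Continuous fun δ : ℝ => y - δ • m := by fun_prop
    simpa using (this.tendsto 0).mono_left nhdsWithin_le_nhds
  have hA := mem_interior_iff_mem_nhds.1 hy
  obtain ⟨δ, ⟨hδ1, hδ2⟩, hδ⟩ :=
    (((h1.eventually hA).and (h2.eventually hA)).and self_mem_nhdsWithin).exists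
  exact ⟨δ, hδ, hδ1, hδ2⟩

theorem volume_le_volume_interior {s : Set (Fin n → ℝ)} (hs : Convex ℝ s) :
    volume s ≤ volume (interior s) := by
  calc volume s ≤ volume (interior s ∪ frontier s) :=
        measure_mono fun x hx => by
          by_cases h : x ∈ interior s
          · exact Or.inl h
          · exact Or.inr ⟨subset_closure hx, h⟩
    _ ≤ volume (interior s) + volume (frontier s) := measure_union_le _ _
    _ = volume (interior s) := by rw [hs.addHaar_frontier volume, add_zero]

theorem convex_setOf_dotProduct_le (w : Fin n → ℝ) (c : ℝ) : Convex ℝ {x | x ⬝ᵥ w ≤ c} :=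
  convex_halfSpace_le ⟨fun x y => add_dotProduct x y _, fun c x => smul_dotProduct c x _⟩ c

theorem convex_setOf_le_dotProduct (w : Fin n → ℝ) (c : ℝ) : Convex ℝ {x | c ≤ x ⬝ᵥ w} :=
  convex_halfSpace_ge ⟨fun x y => add_dotProduct x y _, fun c x => smul_dotProduct c x _⟩ c

theorem convex_polytope (v : Fin r → Fin n → ℤ) (a : Fin r → ℚ) : Convex ℝ (polytope v a) := by
  intro x hx y hy α β hα hβ hαβ i
  refine ⟨convex_setOf_le_dotProduct _ 0 (hx i).1 (hy i).1 hα hβ hαβ, ?_⟩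
  exact convex_halfSpace_lt (f := fun x : Fin n → ℝ => x ⬝ᵥ toReal (v i))
    ⟨fun x y => add_dotProduct x y _, fun c x => smul_dotProduct c x _⟩ (1 - (a i : ℝ))
    (hx i).2 (hy i).2 hα hβ hαβ

theorem continuous_dotProduct_right (w : Fin n → ℝ) :
    Continuous fun x : Fin n → ℝ => x ⬝ᵥ w := by
  unfold dotProduct
  fun_prop

variable {σ : PointedCone ℝ (Fin n → ℝ)} {v : Fin r → Fin n → ℤ}

/-- The pairings with the rays form an injective linear map of finite-dimensional spaces, so
preimages of bounded sets are bounded. -/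
theorem IsPrimitiveGenerators.isBounded_setOf_abs_dotProduct_le
    (hv : IsPrimitiveGenerators σ v)
    (hfull : Submodule.span ℝ (σ : Set (Fin n → ℝ)) = ⊤) (C : ℝ) :
    Bornology.IsBounded {x : Fin n → ℝ | ∀ i, |x ⬝ᵥ toReal (v i)| ≤ C} := by
  let φ : (Fin n → ℝ) →ₗ[ℝ] (Fin r → ℝ) :=
    { toFun := fun x i => x ⬝ᵥ toReal (v i)
      map_add' := fun x y => by
        ext i
        exact add_dotProduct x y _
      map_smul' := fun c x => by
        ext i
        exact smul_dotProduct c x _ }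
  have hφ : φ.ker = ⊥ := by
    rw [LinearMap.ker_eq_bot']
    intro x hx
    exact hv.eq_zero_of_forall_dotProduct hfull fun i => congrFun hx i
  obtain ⟨K, -, hK⟩ := φ.exists_antilipschitzWith hφ
  refine (hK.isBounded_preimage (Metric.isBounded_closedBall (x := 0) (r := |C|))).subset ?_
  intro x hx
  rw [Set.mem_preimage, mem_closedBall_zero_iff, pi_norm_le_iff_of_nonneg (abs_nonneg C)]
  exact fun i => (hx i).trans (le_abs_self C)

end Counting

/-! ### The upper bound for the number of splitting exponents -/

section UpperBound

variable {k : Type*} [Field k] {n r : ℕ} {σ : PointedCone ℝ (Fin n → ℝ)}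
  {v : Fin r → Fin n → ℤ} {a : Fin r → ℚ} {𝔞 : Ideal (ToricRing k σ)} {t : ℝ}

theorem dotProduct_nonneg_of_mem_closure (hv : IsPrimitiveGenerators σ v) (ht : 0 < t)
    {y : Fin n → ℝ} (hy : y ∈ closure (t • newton 𝔞)) (i : Fin r) :
    0 ≤ y ⬝ᵥ toReal (v i) := by
  have hcl : IsClosed {y : Fin n → ℝ | 0 ≤ y ⬝ᵥ toReal (v i)} :=
    isClosed_le continuous_const (continuous_dotProduct_right _)
  refine closure_minimal ?_ hcl hy
  rintro _ ⟨y, hy, rfl⟩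
  simp only [Set.mem_ofPred_eq, smul_dotProduct, smul_eq_mul]
  exact mul_nonneg ht.le (dotProduct_nonneg_of_mem_newton hv hy i)

/-- The reflection of the closure of `P ∩ t • Newt(𝔞)` in `w / 2`. -/
def outerRegion (v : Fin r → Fin n → ℤ) (𝔞 : Ideal (ToricRing k σ)) (t : ℝ) (w : Fin n → ℝ) :
    Set (Fin n → ℝ) :=
  {x | (∀ i, 0 ≤ x ⬝ᵥ toReal (v i)) ∧ w - x ∈ closure (t • newton 𝔞)}

theorem isClosed_outerRegion (w : Fin n → ℝ) : IsClosed (outerRegion v 𝔞 t w) := by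
  refine IsClosed.inter ?_ (isClosed_closure.preimage (continuous_const.sub continuous_id))
  have : {x : Fin n → ℝ | ∀ i, 0 ≤ x ⬝ᵥ toReal (v i)} =
      ⋂ i, {x | 0 ≤ x ⬝ᵥ toReal (v i)} := by
    ext x
    simp
  change IsClosed {x : Fin n → ℝ | ∀ i, 0 ≤ x ⬝ᵥ toReal (v i)}
  rw [this]
  exact isClosed_iInter fun i => isClosed_le continuous_const (continuous_dotProduct_right _)

theorem convex_outerRegion (w : Fin n → ℝ) : Convex ℝ (outerRegion v 𝔞 t w) := by
  intro x hx y hy α β hα hβ hαβ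
  refine ⟨fun i => convex_setOf_le_dotProduct _ 0 (hx.1 i) (hy.1 i) hα hβ hαβ, ?_⟩
  have h := (((convex_newton 𝔞).smul t).closure) hx.2 hy.2 hα hβ hαβ
  convert h using 1
  rw [smul_sub, smul_sub, sub_add_sub_comm, ← add_smul, hαβ, one_smul]

theorem isBounded_outerRegion (hv : IsPrimitiveGenerators σ v)
    (hfull : Submodule.span ℝ (σ : Set (Fin n → ℝ)) = ⊤) (ht : 0 < t) (ha : ∀ i, 0 ≤ a i)
    {w : Fin n → ℝ} (hw : ∀ i, w ⬝ᵥ toReal (v i) = 1 - (a i : ℝ)) :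
    Bornology.IsBounded (outerRegion v 𝔞 t w) := by
  refine (hv.isBounded_setOf_abs_dotProduct_le hfull 1).subset fun x hx i => ?_
  have h1 := dotProduct_nonneg_of_mem_closure hv ht hx.2 i
  have h2 : (0 : ℝ) ≤ a i := by exact_mod_cast ha i
  rw [sub_dotProduct, hw] at h1
  rw [abs_of_nonneg (hx.1 i)]
  linarith

/-- The reflection x ↦ w - x carries the region into P ∩ t Newt(𝔞), apart from points on the
frontier of one of two convex sets. -/
theorem volume_outerRegion_le (hv : IsPrimitiveGenerators σ v)
    (hσ : (σ : ConvexCone ℝ (Fin n → ℝ)).Salient) (ht : 0 < t)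
    {w : Fin n → ℝ} (hw : ∀ i, w ⬝ᵥ toReal (v i) = 1 - (a i : ℝ)) :
    volume (outerRegion v 𝔞 t w) ≤ volume (polytope v a ∩ t • newton 𝔞) := by
  obtain ⟨m, hm⟩ := hv.exists_interior hσ
  have hpres := Measure.measurePreserving_sub_left (volume : Measure (Fin n → ℝ)) w
  have hcover : outerRegion v 𝔞 t w ⊆ (fun x => w - x) ⁻¹' (polytope v a ∩ t • newton 𝔞) ∪
      (frontier (outerRegion v 𝔞 t w) ∪ (fun x => w - x) ⁻¹' frontier (t • newton 𝔞)) := by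
    intro x hx
    by_cases h1 : x ∈ interior (outerRegion v 𝔞 t w)
    · by_cases h2 : w - x ∈ interior (t • newton 𝔞)
      · left
        -- At an interior point x - δ m still has nonnegative heights, so x has positive ones and
        -- the upper bound for w - x is strict.
        obtain ⟨δ, hδ, -, hmem⟩ := exists_pos_add_sub_smul_mem h1 (toReal m)
        refine ⟨fun i => ⟨dotProduct_nonneg_of_mem_closure hv ht hx.2 i, ?_⟩,
          interior_subset h2⟩
        have h3 := hmem.1 i
        have h4 : (0 : ℝ) < (m ⬝ᵥ v i : ℤ) := by exact_mod_cast hm i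
        rw [sub_dotProduct, smul_dotProduct, toReal_dotProduct_toReal, smul_eq_mul] at h3
        rw [sub_dotProduct, hw]
        have h5 := mul_pos hδ h4
        linarith
      · exact Or.inr (Or.inr ⟨hx.2, h2⟩)
    · exact Or.inr (Or.inl ⟨subset_closure hx, h1⟩)
  have hnull : volume (frontier (t • newton 𝔞)) = 0 :=
    ((convex_newton 𝔞).smul t).addHaar_frontier volume
  refine (measure_mono hcover).trans ((measure_union_le _ _).trans ?_)
  rw [measure_union_null ((convex_outerRegion w).addHaar_frontier volume)
    (by rw [hpres.measure_preimage isClosed_frontier.measurableSet.nullMeasurableSet, hnull]),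
    add_zero]
  rw [hpres.measure_preimage (((convex_polytope v a).inter
    ((convex_newton 𝔞).smul t)).nullMeasurableSet volume)]

/-- Integrality sharpens the bound q to q - 1, and division by q - 1 then matches both ceilings
exactly. With b/(q-1) in t Newt(𝔞) and u/q of smaller height than u/(q-1), the remainder w - u/q -
b/(q-1) lies in the dual cone, so no error term is needed. -/
theorem inv_smul_toReal_mem_outerRegion (hv : IsPrimitiveGenerators σ v)
    (hσ : (σ : ConvexCone ℝ (Fin n → ℝ)).Salient) (h𝔞 : IsMonomialIdeal 𝔞) (ht : 0 < t)
    {w : Fin n → ℝ} (hw : ∀ i, w ⬝ᵥ toReal (v i) = 1 - (a i : ℝ)) {q : ℕ} (hq : 1 < q)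
    {u : dualMonoid σ} (hu : u ∈ splittingExponents v q (fun i => ⌈((q : ℚ) - 1) * a i⌉)
      (𝔞 ^ ⌈((q : ℝ) - 1) * t⌉₊)) :
    (q : ℝ)⁻¹ • toReal (u : Fin n → ℤ) ∈ outerRegion v 𝔞 t w := by
  obtain ⟨b, hb, hub⟩ := hu
  have hq1 : (1 : ℝ) < q := by exact_mod_cast hq
  have hq0 : (0 : ℝ) < q := by linarith
  have hu0 : ∀ i, (0 : ℝ) ≤ ((u : Fin n → ℤ) ⬝ᵥ v i : ℤ) := fun i => by
    exact_mod_cast hv.dotProduct_nonneg i u u.2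
  refine ⟨fun i => ?_, ?_⟩
  · rw [smul_dotProduct, toReal_dotProduct_toReal, smul_eq_mul]
    exact mul_nonneg (by positivity) (hu0 i)
  · have hpos : 0 < ((q : ℝ) - 1) * t := mul_pos (by linarith) ht
    obtain ⟨L, hL⟩ : ∃ L, ⌈((q : ℝ) - 1) * t⌉₊ = L + 1 :=
      Nat.exists_eq_succ_of_ne_zero (Nat.ceil_pos.2 hpos).ne'
    rw [hL] at hb
    have hbN := smul_newton_subset hpos (by simpa [hL] using Nat.le_ceil (((q : ℝ) - 1) * t))
      (toReal_mem_smul_newton h𝔞 L hb)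
    have hz : ((q : ℝ) - 1)⁻¹ • toReal (b : Fin n → ℤ) ∈ t • newton 𝔞 := by
      rw [mul_smul] at hbN
      rwa [← Set.mem_smul_set_iff_inv_smul_mem₀ (by linarith : (q : ℝ) - 1 ≠ 0)]
    have h := add_mem_closure_smul_newton hv hσ ht hz
      (x := w - (q : ℝ)⁻¹ • toReal (u : Fin n → ℤ) - ((q : ℝ) - 1)⁻¹ • toReal (b : Fin n → ℤ)) ?_
    · rwa [add_sub_cancel] at h
    · intro i
      have h1 := hub i
      rw [add_dotProduct] at h1
      beta_reduce at h1
      have h2 : (((u : Fin n → ℤ) ⬝ᵥ v i : ℤ) : ℝ) + ((b : Fin n → ℤ) ⬝ᵥ v i : ℤ)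
          + (⌈((q : ℚ) - 1) * a i⌉ : ℤ) ≤ q - 1 := by
        have : (u : Fin n → ℤ) ⬝ᵥ v i + (b : Fin n → ℤ) ⬝ᵥ v i + ⌈((q : ℚ) - 1) * a i⌉
          ≤ (q : ℤ) - 1 := by omega
        exact_mod_cast this
      have h3 : ((q : ℝ) - 1) * a i ≤ (⌈((q : ℚ) - 1) * a i⌉ : ℤ) := by
        exact_mod_cast Int.le_ceil (((q : ℚ) - 1) * a i)
      simp only [sub_dotProduct, smul_dotProduct, toReal_dotProduct_toReal, smul_eq_mul, hw]
      set U : ℝ := (((u : Fin n → ℤ) ⬝ᵥ v i : ℤ) : ℝ)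
      set B : ℝ := (((b : Fin n → ℤ) ⬝ᵥ v i : ℤ) : ℝ)
      have h4 : (q : ℝ)⁻¹ * U ≤ ((q : ℝ) - 1)⁻¹ * U := by
        refine mul_le_mul_of_nonneg_right ?_ (hu0 i)
        exact inv_anti₀ (by linarith) (by linarith)
      have h5 : ((q : ℝ) - 1)⁻¹ * (U + B + ((q : ℝ) - 1) * a i) ≤ ((q : ℝ) - 1)⁻¹ * (q - 1) :=
        mul_le_mul_of_nonneg_left (by linarith) (inv_nonneg.2 (by linarith))
      rw [inv_mul_cancel₀ (by linarith), mul_add, mul_add, inv_mul_cancel_left₀ (by linarith)] at h5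
      linarith

end UpperBound

/-! ### The lower bound for the number of splitting exponents -/

section LowerBound

variable {k : Type*} [Field k] {n r : ℕ} {σ : PointedCone ℝ (Fin n → ℝ)}
  {v : Fin r → Fin n → ℤ} {a : Fin r → ℚ} {𝔞 : Ideal (ToricRing k σ)} {t : ℝ}

theorem monomial_sum_nsmul_mem_pow (F : Finset (dualMonoid σ)) (hF : ∀ b ∈ F, monomial k σ b ∈ 𝔞)
    (c : dualMonoid σ → ℕ) : monomial k σ (∑ b ∈ F, c b • b) ∈ 𝔞 ^ (∑ b ∈ F, c b) := by
  classical
  have hsmul : ∀ (m : ℕ) (b : dualMonoid σ), monomial k σ b ∈ 𝔞 →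
      monomial k σ (m • b) ∈ 𝔞 ^ m := by
    intro m b hb
    induction m with
    | zero => simp
    | succ m ih =>
      rw [succ_nsmul, monomial_add, pow_succ]
      exact Ideal.mul_mem_mul ih hb
  induction F using Finset.induction_on with
  | empty => simp
  | insert b F hbF ih =>
    rw [Finset.sum_insert hbF, Finset.sum_insert hbF, monomial_add, pow_add]
    exact Ideal.mul_mem_mul (hsmul _ _ (hF b (Finset.mem_insert_self b F)))
      (ih fun d hd => hF d (Finset.mem_insert_of_mem hd))

/-- The witness rounds the weights up, b = ∑ ⌈L c_b⌉ b, so the total exponent is at least L.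
Rounding L and the weights adds at most 2 to each multiplicity, and the ceiling in the divisor adds
less than 1. The slack q ε covers both. -/
theorem mem_splittingExponents_of_weights (hv : IsPrimitiveGenerators σ v) (ht : 0 < t)
    (ha : ∀ i, 0 ≤ a i) {F : Finset (dualMonoid σ)} (hF : ∀ b ∈ F, monomial k σ b ∈ 𝔞)
    {c : dualMonoid σ → ℝ} (hc : ∀ b ∈ F, 0 ≤ c b) (hc1 : ∑ b ∈ F, c b = 1) {ε : ℝ} {q : ℕ}
    (hq : 0 < q)
    (hε : ∀ i, 2 * ∑ b ∈ F, (((b : Fin n → ℤ) ⬝ᵥ v i : ℤ) : ℝ) + 1 ≤ q * ε)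
    {u : dualMonoid σ}
    (hu : ∀ i, ((q : ℝ)⁻¹ • toReal (u : Fin n → ℤ) +
      t • ∑ b ∈ F, c b • toReal (b : Fin n → ℤ)) ⬝ᵥ toReal (v i) ≤ 1 - a i - ε) :
    u ∈ splittingExponents v q (fun i => ⌈((q : ℚ) - 1) * a i⌉)
      (𝔞 ^ ⌈((q : ℝ) - 1) * t⌉₊) := by
  have hq0 : (0 : ℝ) < q := by exact_mod_cast hq
  have hq1 : (1 : ℝ) ≤ q := by exact_mod_cast hq
  set L : ℕ := ⌈((q : ℝ) - 1) * t⌉₊ with hL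
  have hLle : (L : ℝ) ≤ q * t + 1 := by
    have h := Nat.ceil_lt_add_one (mul_nonneg (sub_nonneg.2 hq1) ht.le)
    rw [← hL] at h
    nlinarith
  set N : dualMonoid σ → ℕ := fun b => ⌈(L : ℝ) * c b⌉₊ with hN
  refine ⟨∑ b ∈ F, N b • b, ?_, fun i => ?_⟩
  · refine Ideal.pow_le_pow_right ?_ (monomial_sum_nsmul_mem_pow F hF N)
    have : (L : ℝ) ≤ ((∑ b ∈ F, N b : ℕ) : ℝ) := by
      calc (L : ℝ) = ∑ b ∈ F, (L : ℝ) * c b := by rw [← Finset.mul_sum, hc1, mul_one]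
        _ ≤ ∑ b ∈ F, (N b : ℝ) := Finset.sum_le_sum fun b _ => Nat.le_ceil _
        _ = _ := by push_cast; rfl
    exact_mod_cast this
  · have hbv : ∀ b : dualMonoid σ, (0 : ℝ) ≤ (((b : Fin n → ℤ) ⬝ᵥ v i : ℤ) : ℝ) := fun b => by
      exact_mod_cast hv.dotProduct_nonneg i b b.2
    have hcoe : ((∑ b ∈ F, N b • b : dualMonoid σ) : Fin n → ℤ) =
        ∑ b ∈ F, N b • (b : Fin n → ℤ) := by
      push_cast
      rfl
    have hsum : ((((∑ b ∈ F, N b • b : dualMonoid σ) : Fin n → ℤ) ⬝ᵥ v i : ℤ) : ℝ) =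
        ∑ b ∈ F, (N b : ℝ) * (((b : Fin n → ℤ) ⬝ᵥ v i : ℤ) : ℝ) := by
      rw [hcoe, sum_dotProduct, Int.cast_sum]
      refine Finset.sum_congr rfl fun b _ => ?_
      rw [smul_dotProduct, nsmul_eq_mul, Int.cast_mul, Int.cast_natCast]
    have hle : ∑ b ∈ F, (N b : ℝ) * (((b : Fin n → ℤ) ⬝ᵥ v i : ℤ) : ℝ) ≤
        q * t * ∑ b ∈ F, c b * (((b : Fin n → ℤ) ⬝ᵥ v i : ℤ) : ℝ) +
          2 * ∑ b ∈ F, (((b : Fin n → ℤ) ⬝ᵥ v i : ℤ) : ℝ) := by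
      rw [Finset.mul_sum, Finset.mul_sum, ← Finset.sum_add_distrib]
      refine Finset.sum_le_sum fun b hb => ?_
      have h1 : (N b : ℝ) ≤ L * c b + 1 :=
        (Nat.ceil_lt_add_one (mul_nonneg (Nat.cast_nonneg _) (hc b hb))).le
      have h2 : c b ≤ 1 := hc1 ▸ Finset.single_le_sum hc hb
      have h3 : (L : ℝ) * c b ≤ q * t * c b + 1 := by
        nlinarith [mul_le_mul_of_nonneg_right hLle (hc b hb)]
      calc (N b : ℝ) * (((b : Fin n → ℤ) ⬝ᵥ v i : ℤ) : ℝ)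
          ≤ (q * t * c b + 2) * (((b : Fin n → ℤ) ⬝ᵥ v i : ℤ) : ℝ) :=
            mul_le_mul_of_nonneg_right (by linarith) (hbv b)
        _ = _ := by ring
    have hu' := hu i
    rw [add_dotProduct, smul_dotProduct, smul_dotProduct, sum_dotProduct,
      toReal_dotProduct_toReal, smul_eq_mul, smul_eq_mul] at hu'
    simp only [smul_dotProduct, toReal_dotProduct_toReal, smul_eq_mul] at hu'
    have hu2 := mul_le_mul_of_nonneg_left hu' hq0.le
    rw [mul_add, mul_inv_cancel_left₀ hq0.ne'] at hu2
    have hceil : ((⌈((q : ℚ) - 1) * a i⌉ : ℤ) : ℝ) < ((q : ℝ) - 1) * a i + 1 := by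
      have := Int.ceil_lt_add_one (((q : ℚ) - 1) * a i)
      exact_mod_cast this
    have hai : (0 : ℝ) ≤ a i := by exact_mod_cast ha i
    have hfin : ((((u : Fin n → ℤ) + ((∑ b ∈ F, N b • b : dualMonoid σ) : Fin n → ℤ)) ⬝ᵥ v i +
        ⌈((q : ℚ) - 1) * a i⌉ : ℤ) : ℝ) < ((q : ℤ) : ℝ) := by
      rw [add_dotProduct, Int.cast_add, Int.cast_add, hsum, Int.cast_natCast]
      have := hε i
      nlinarith
    exact_mod_cast hfin

/-- Exponents of monomials of `𝔞` in a box. -/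
def boundedExponents (𝔞 : Ideal (ToricRing k σ)) (N : ℕ) : Set (dualMonoid σ) :=
  {b | monomial k σ b ∈ 𝔞 ∧ ∀ j, |(b : Fin n → ℤ) j| ≤ N}

theorem finite_boundedExponents (𝔞 : Ideal (ToricRing k σ)) (N : ℕ) :
    (boundedExponents 𝔞 N).Finite := by
  refine Set.Finite.of_finite_image (f := Subtype.val)
    ((Set.finite_Icc (fun _ => -(N : ℤ) : Fin n → ℤ) (fun _ => (N : ℤ))).subset ?_)
    Subtype.val_injective.injOn
  rintro _ ⟨b, hb, rfl⟩
  exact ⟨fun j => (abs_le.1 (hb.2 j)).1, fun j => (abs_le.1 (hb.2 j)).2⟩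

/-- An increasing sequence of regions that exhausts the reflection of `P ∩ t • Newt(𝔞)` up to
measure zero. -/
def innerRegion (v : Fin r → Fin n → ℤ) (a : Fin r → ℚ) (𝔞 : Ideal (ToricRing k σ)) (t : ℝ)
    (N : ℕ) : Set (Fin n → ℝ) :=
  {x | (∀ i, 0 ≤ x ⬝ᵥ toReal (v i)) ∧
    ∃ z ∈ convexHull ℝ ((fun b : dualMonoid σ => toReal (b : Fin n → ℤ)) '' boundedExponents 𝔞 N),
      ∀ i, (x + t • z) ⬝ᵥ toReal (v i) ≤ 1 - a i - ((N : ℝ) + 1)⁻¹}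

theorem convexHull_boundedExponents_subset (𝔞 : Ideal (ToricRing k σ)) (N : ℕ) :
    convexHull ℝ ((fun b : dualMonoid σ => toReal (b : Fin n → ℤ)) '' boundedExponents 𝔞 N) ⊆
      newton 𝔞 := by
  refine convexHull_mono ?_
  rintro _ ⟨b, hb, rfl⟩
  exact ⟨b, hb.1, rfl⟩

theorem convex_innerRegion (N : ℕ) : Convex ℝ (innerRegion v a 𝔞 t N) := by
  rintro x ⟨hx, z, hz, hxz⟩ y ⟨hy, w, hw, hyw⟩ α β hα hβ hαβ
  refine ⟨fun i => convex_setOf_le_dotProduct _ 0 (hx i) (hy i) hα hβ hαβ, α • z + β • w,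
    convex_convexHull ℝ _ hz hw hα hβ hαβ, fun i => ?_⟩
  have h := convex_setOf_dotProduct_le (toReal (v i)) _ (hxz i) (hyw i) hα hβ hαβ
  rw [Set.mem_ofPred_eq] at h
  convert h using 2
  rw [smul_add, smul_add, smul_add, smul_comm α t, smul_comm β t]
  abel

theorem isBounded_innerRegion (hv : IsPrimitiveGenerators σ v)
    (hfull : Submodule.span ℝ (σ : Set (Fin n → ℝ)) = ⊤) (ht : 0 < t) (ha : ∀ i, 0 ≤ a i)
    (N : ℕ) : Bornology.IsBounded (innerRegion v a 𝔞 t N) := by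
  refine (hv.isBounded_setOf_abs_dotProduct_le hfull 1).subset ?_
  rintro x ⟨hx, z, hz, hxz⟩ i
  have h1 := mul_nonneg ht.le (dotProduct_nonneg_of_mem_newton hv
    (convexHull_boundedExponents_subset 𝔞 N hz) i)
  have h2 : (0 : ℝ) ≤ a i := by exact_mod_cast ha i
  have h3 := hxz i
  have h4 : (0 : ℝ) ≤ ((N : ℝ) + 1)⁻¹ := by positivity
  rw [add_dotProduct, smul_dotProduct, smul_eq_mul] at h3
  rw [abs_of_nonneg (hx i)]
  linarith

theorem monotone_innerRegion : Monotone (innerRegion v a 𝔞 t) := by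
  rintro N N' hN x ⟨hx, z, hz, hxz⟩
  have hN' : (N : ℝ) ≤ N' := by exact_mod_cast hN
  refine ⟨hx, z, convexHull_mono (Set.image_mono ?_) hz, fun i => (hxz i).trans ?_⟩
  · rintro b ⟨hb, hbN⟩
    exact ⟨hb, fun j => (hbN j).trans (by exact_mod_cast hN)⟩
  · have := inv_anti₀ (by positivity : (0 : ℝ) < (N : ℝ) + 1) (by linarith : (N : ℝ) + 1 ≤ N' + 1)
    linarith

/-- A convex combination involves finitely many exponents, and the sum of all their absolute
coordinates bounds a box containing them. -/
theorem exists_mem_convexHull_boundedExponents {y : Fin n → ℝ} (hy : y ∈ newton 𝔞) :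
    ∃ N, y ∈ convexHull ℝ
      ((fun b : dualMonoid σ => toReal (b : Fin n → ℤ)) '' boundedExponents 𝔞 N) := by
  rw [newton, convexHull_eq_union_convexHull_finite_subsets] at hy
  simp only [Set.mem_iUnion] at hy
  obtain ⟨T, hT, hyT⟩ := hy
  have hT' : ∀ x ∈ T, ∃ u : dualMonoid σ, monomial k σ u ∈ 𝔞 ∧ x = toReal (u : Fin n → ℤ) :=
    fun x hx => hT hx
  choose! b hb using hT'
  refine ⟨∑ x ∈ T, ∑ j, ((b x : Fin n → ℤ) j).natAbs, convexHull_mono ?_ hyT⟩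
  intro x hx
  refine ⟨b x, ⟨(hb x hx).1, fun j => ?_⟩, (hb x hx).2.symm⟩
  have h1 : ((b x : Fin n → ℤ) j).natAbs ≤ ∑ j, ((b x : Fin n → ℤ) j).natAbs :=
    Finset.single_le_sum (f := fun j => ((b x : Fin n → ℤ) j).natAbs)
      (fun _ _ => Nat.zero_le _) (Finset.mem_univ j)
  have h2 : ∑ j, ((b x : Fin n → ℤ) j).natAbs ≤ ∑ x ∈ T, ∑ j, ((b x : Fin n → ℤ) j).natAbs :=
    Finset.single_le_sum (f := fun x => ∑ j, ((b x : Fin n → ℤ) j).natAbs)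
      (fun _ _ => Nat.zero_le _) hx
  rw [Int.abs_eq_natAbs]
  exact_mod_cast h1.trans h2

/-- If w - x is interior to P ∩ t Newt(𝔞), then w - x - δ m = t y with y in the Newton polyhedron.
The height of x + t y falls short of 1 - a_i by at least δ, because m has integral height at least 1
on each ray. So x enters some inner region. -/
theorem volume_le_iSup_innerRegion (hv : IsPrimitiveGenerators σ v)
    (hσ : (σ : ConvexCone ℝ (Fin n → ℝ)).Salient)
    {w : Fin n → ℝ} (hw : ∀ i, w ⬝ᵥ toReal (v i) = 1 - (a i : ℝ)) :
    volume (polytope v a ∩ t • newton 𝔞) ≤ ⨆ N, volume (interior (innerRegion v a 𝔞 t N)) := by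
  obtain ⟨m, hm⟩ := hv.exists_interior hσ
  have hpres := Measure.measurePreserving_sub_left (volume : Measure (Fin n → ℝ)) w
  refine (volume_le_volume_interior ((convex_polytope v a).inter
    ((convex_newton 𝔞).smul t))).trans ?_
  rw [← hpres.measure_preimage isOpen_interior.measurableSet.nullMeasurableSet]
  have hcover : (fun x => w - x) ⁻¹' interior (polytope v a ∩ t • newton 𝔞) ⊆
      ⋃ N, innerRegion v a 𝔞 t N := by
    intro x hx
    obtain ⟨δ, hδ, -, -, y, hy, hyδ⟩ := exists_pos_add_sub_smul_mem hx (toReal m)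
    obtain ⟨N, hN⟩ := exists_mem_convexHull_boundedExponents hy
    obtain ⟨N', hN'⟩ := exists_nat_one_div_lt hδ
    have hyδ' : t • y = w - x - δ • toReal m := hyδ
    refine Set.mem_iUnion.2 ⟨max N N', fun i => ?_, y,
      convexHull_mono (Set.image_mono ?_) hN, fun i => ?_⟩
    · have h := ((interior_subset hx).1 i).2
      rw [sub_dotProduct, hw] at h
      linarith
    · rintro b ⟨hb, hbN⟩
      exact ⟨hb, fun j => (hbN j).trans (by exact_mod_cast le_max_left N N')⟩
    · rw [hyδ', sub_sub, ← add_sub_assoc, add_sub_add_left_eq_sub, sub_dotProduct, hw,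
        smul_dotProduct, toReal_dotProduct_toReal, smul_eq_mul]
      have h1 : (1 : ℝ) ≤ (m ⬝ᵥ v i : ℤ) := by exact_mod_cast hm i
      have h2 : (((max N N' : ℕ) : ℝ) + 1)⁻¹ ≤ ((N' : ℝ) + 1)⁻¹ := by
        refine inv_anti₀ (by positivity) ?_
        have : (N' : ℝ) ≤ ((max N N' : ℕ) : ℝ) := by exact_mod_cast le_max_right N N'
        linarith
      rw [one_div] at hN'
      nlinarith
  refine (measure_mono hcover).trans ?_
  rw [monotone_innerRegion.measure_iUnion]
  exact iSup_mono fun N => volume_le_volume_interior (convex_innerRegion N)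

theorem eventually_mem_splittingExponents (hv : IsPrimitiveGenerators σ v) (ht : 0 < t)
    (ha : ∀ i, 0 ≤ a i) (N : ℕ) : ∀ᶠ q : ℕ in atTop, ∀ u : Fin n → ℤ,
      (q : ℝ)⁻¹ • toReal u ∈ innerRegion v a 𝔞 t N → ∃ hu : u ∈ dualMonoid σ,
        ⟨u, hu⟩ ∈ splittingExponents v q (fun i => ⌈((q : ℚ) - 1) * a i⌉)
          (𝔞 ^ ⌈((q : ℝ) - 1) * t⌉₊) := by
  classical
  set F := (finite_boundedExponents 𝔞 N).toFinset with hF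
  -- At a fixed level N the available exponents form the finite set F, so one threshold for q
  -- absorbs the rounding errors at all rays and for all u.
  obtain ⟨Q, hQ⟩ := exists_nat_ge
    (((N : ℝ) + 1) * ∑ i, (2 * ∑ b ∈ F, (((b : Fin n → ℤ) ⬝ᵥ v i : ℤ) : ℝ) + 1))
  filter_upwards [eventually_gt_atTop 0, eventually_ge_atTop Q] with q hq hqQ u hu
  obtain ⟨hu0, z, hz, hxz⟩ := hu
  have hq0 : (0 : ℝ) < q := by exact_mod_cast hq
  have hmem : u ∈ dualMonoid σ := by
    rw [hv.mem_dualMonoid]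
    intro i
    have h := hu0 i
    rw [smul_dotProduct, toReal_dotProduct_toReal, smul_eq_mul] at h
    have := nonneg_of_mul_nonneg_right h (inv_pos.2 hq0)
    exact_mod_cast this
  refine ⟨hmem, ?_⟩
  have himage : (fun b : dualMonoid σ => toReal (b : Fin n → ℤ)) '' boundedExponents 𝔞 N =
      ((F.image fun b : dualMonoid σ => toReal (b : Fin n → ℤ) : Finset (Fin n → ℝ)) :
        Set (Fin n → ℝ)) := by
    rw [Finset.coe_image, hF, Set.Finite.coe_toFinset]
  have hinj : Set.InjOn (fun b : dualMonoid σ => toReal (b : Fin n → ℤ)) (F : Set _) :=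
    fun b _ b' _ h => Subtype.ext (toReal_injective h)
  rw [himage, Finset.mem_convexHull'] at hz
  obtain ⟨c, hc0, hc1, rfl⟩ := hz
  rw [Finset.sum_image hinj] at hc1
  rw [Finset.sum_image hinj] at hxz
  refine mem_splittingExponents_of_weights hv ht ha (F := F)
    (c := fun b => c (toReal (b : Fin n → ℤ))) (ε := ((N : ℝ) + 1)⁻¹)
    (fun b hb => ((finite_boundedExponents 𝔞 N).mem_toFinset.1 hb).1)
    (fun b hb => hc0 _ (Finset.mem_image_of_mem _ hb)) hc1 hq (fun i => ?_) hxz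
  have h0 : ∀ i, 0 ≤ 2 * ∑ b ∈ F, (((b : Fin n → ℤ) ⬝ᵥ v i : ℤ) : ℝ) + 1 := fun i => by
    have : 0 ≤ ∑ b ∈ F, (((b : Fin n → ℤ) ⬝ᵥ v i : ℤ) : ℝ) := Finset.sum_nonneg fun b _ => by
      exact_mod_cast hv.dotProduct_nonneg i b b.2
    linarith
  have h1 := Finset.single_le_sum
    (f := fun i => 2 * ∑ b ∈ F, (((b : Fin n → ℤ) ⬝ᵥ v i : ℤ) : ℝ) + 1)
    (fun i _ => h0 i) (Finset.mem_univ i)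
  have h2 : (Q : ℝ) ≤ q := by exact_mod_cast hqQ
  have hN0 : (0 : ℝ) < (N : ℝ) + 1 := by positivity
  rw [← div_eq_mul_inv, le_div_iff₀ hN0, mul_comm]
  exact (mul_le_mul_of_nonneg_left h1 hN0.le).trans (hQ.trans h2)

end LowerBound

/-! ### The limit -/

section Limit

variable {k : Type*} [Field k] {n r : ℕ} {σ : PointedCone ℝ (Fin n → ℝ)}
  {v : Fin r → Fin n → ℤ} {a : Fin r → ℚ} {𝔞 : Ideal (ToricRing k σ)} {t : ℝ}

theorem mem_splittingExponents_of_add_mem (hv : IsPrimitiveGenerators σ v) {q : ℕ} {E : Fin r → ℤ}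
    {J : Ideal (ToricRing k σ)} (u d : dualMonoid σ) (h : u + d ∈ splittingExponents v q E J) :
    u ∈ splittingExponents v q E J := by
  obtain ⟨b, hb, hub⟩ := h
  refine ⟨b, hb, fun i => ?_⟩
  have h1 := hub i
  have h2 := hv.dotProduct_nonneg i d d.2
  simp only [AddSubmonoid.coe_add, add_dotProduct] at h1 ⊢
  omega

theorem finite_splittingExponents (hv : IsPrimitiveGenerators σ v)
    (hσ : (σ : ConvexCone ℝ (Fin n → ℝ)).Salient)
    (hfull : Submodule.span ℝ (σ : Set (Fin n → ℝ)) = ⊤) (h𝔞 : IsMonomialIdeal 𝔞) (ht : 0 < t)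
    (ha : ∀ i, 0 ≤ a i) {w : Fin n → ℝ} (hw : ∀ i, w ⬝ᵥ toReal (v i) = 1 - (a i : ℝ)) {q : ℕ}
    (hq : 1 < q) :
    (splittingExponents v q (fun i => ⌈((q : ℚ) - 1) * a i⌉)
      (𝔞 ^ ⌈((q : ℝ) - 1) * t⌉₊)).Finite := by
  refine Set.Finite.of_finite_image (f := Subtype.val)
    ((finite_setOf_inv_smul_toReal_mem (isBounded_outerRegion (𝔞 := 𝔞) hv hfull ht ha hw)
      (q := q) (by positivity)).subset ?_) Subtype.val_injective.injOn
  rintro _ ⟨u, hu, rfl⟩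
  exact inv_smul_toReal_mem_outerRegion hv hσ h𝔞 ht hw hq hu

/-- A squeeze: the lattice count of the outer region bounds the limsup, and that of each inner
region bounds the liminf. The supremum over N is taken only after the limit in e, so the threshold
on q may depend on N. -/
theorem tendsto_ncard_splittingExponents_div (hv : IsPrimitiveGenerators σ v)
    (hσ : (σ : ConvexCone ℝ (Fin n → ℝ)).Salient)
    (hfull : Submodule.span ℝ (σ : Set (Fin n → ℝ)) = ⊤) (h𝔞 : IsMonomialIdeal 𝔞) (ht : 0 < t)
    (ha : ∀ i, 0 ≤ a i) {w : Fin n → ℝ} (hw : ∀ i, w ⬝ᵥ toReal (v i) = 1 - (a i : ℝ)) {p : ℕ}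
    (hp : 1 < p) :
    Tendsto (fun e : ℕ => ((splittingExponents v (p ^ e)
        (fun i => ⌈(((p ^ e : ℕ) : ℚ) - 1) * a i⌉)
        (𝔞 ^ ⌈(((p ^ e : ℕ) : ℝ) - 1) * t⌉₊)).ncard : ℝ≥0∞) / (p : ℝ≥0∞) ^ (e * n))
      atTop (𝓝 (volume (polytope v a ∩ t • newton 𝔞))) := by
  have hpe := tendsto_pow_atTop_atTop_of_one_lt hp
  refine tendsto_of_le_liminf_of_limsup_le ?_ ?_
  · refine (volume_le_iSup_innerRegion hv hσ hw).trans (iSup_le fun N => ?_)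
    have hconv := (convex_innerRegion (v := v) (a := a) (𝔞 := 𝔞) (t := t) N).interior
    have hlim := tendsto_ncard_lattice_div
      ((isBounded_innerRegion (𝔞 := 𝔞) hv hfull ht ha N).subset interior_subset)
      isOpen_interior.measurableSet (hconv.addHaar_frontier volume) hp
    rw [← hlim.liminf_eq]
    refine liminf_le_liminf ?_
    filter_upwards [hpe.eventually (eventually_mem_splittingExponents (𝔞 := 𝔞) hv ht ha N),
      hpe.eventually (eventually_gt_atTop 1)] with e he he1
    gcongr
    rw [← Set.ncard_image_of_injective (splittingExponents v (p ^ e) _ _)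
      (Subtype.val_injective (p := fun u => u ∈ dualMonoid σ))]
    refine Set.ncard_le_ncard ?_
      ((finite_splittingExponents hv hσ hfull h𝔞 ht ha hw he1).image _)
    intro u hu
    obtain ⟨hu1, hu2⟩ := he u (interior_subset (by simpa using hu))
    exact ⟨⟨u, hu1⟩, hu2, rfl⟩
  · refine le_trans ?_ (volume_outerRegion_le (𝔞 := 𝔞) hv hσ ht hw)
    have hlim := tendsto_ncard_lattice_div (isBounded_outerRegion (𝔞 := 𝔞) hv hfull ht ha hw)
      (isClosed_outerRegion w).measurableSet ((convex_outerRegion w).addHaar_frontier volume) hp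
    rw [← hlim.limsup_eq]
    refine limsup_le_limsup ?_
    filter_upwards [hpe.eventually (eventually_gt_atTop 1)] with e he1
    gcongr
    rw [← Set.ncard_image_of_injective (splittingExponents v (p ^ e) _ _)
      (Subtype.val_injective (p := fun u => u ∈ dualMonoid σ))]
    refine Set.ncard_le_ncard ?_ (finite_setOf_inv_smul_toReal_mem
      (isBounded_outerRegion (𝔞 := 𝔞) hv hfull ht ha hw) (by positivity))
    rintro _ ⟨u, hu, rfl⟩
    have := inv_smul_toReal_mem_outerRegion hv hσ h𝔞 ht hw he1 hu
    simpa using this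

theorem length_quotient_splittingIdeal (hv : IsPrimitiveGenerators σ v)
    (hσ : (σ : ConvexCone ℝ (Fin n → ℝ)).Salient)
    (hfull : Submodule.span ℝ (σ : Set (Fin n → ℝ)) = ⊤) (p : ℕ) [Fact p.Prime] [CharP k p]
    [PerfectField k] (e : ℕ) (ha : ∀ i, 0 ≤ a i) {J : Ideal (ToricRing k σ)}
    (hJ : IsMonomialIdeal J) (hfin : (splittingExponents v (p ^ e)
      (fun i => ⌈((p : ℚ) ^ e - 1) * a i⌉) J).Finite) :
    Module.length (ToricRing k σ) (ToricRing k σ ⧸ splittingIdeal (maxIdeal k σ) (p ^ e)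
      (fun P => ⌈((p : ℚ) ^ e - 1) * toricDivisor k σ v a P⌉) J) =
    (splittingExponents v (p ^ e) (fun i => ⌈((p : ℚ) ^ e - 1) * a i⌉) J).ncard := by
  have hp1 : (1 : ℚ) ≤ (p : ℚ) ^ e := one_le_pow₀ (by exact_mod_cast (Fact.out : p.Prime).one_le)
  have hE0 : ∀ P : PrimeDivisor (ToricRing k σ), IsNontoric P →
      ⌈((p : ℚ) ^ e - 1) * toricDivisor k σ v a P⌉ = 0 := fun P hP => by
    rw [toricDivisor_of_isNontoric hv hσ a hP, mul_zero, Int.ceil_zero]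
  have hE : ∀ P : PrimeDivisor (ToricRing k σ),
      0 ≤ ⌈((p : ℚ) ^ e - 1) * toricDivisor k σ v a P⌉ := fun P =>
    Int.ceil_nonneg (mul_nonneg (sub_nonneg.2 hp1)
      (Finset.sum_nonneg fun i _ => by split_ifs <;> simp [ha i]))
  have hT : ∀ u d : dualMonoid σ, u + d ∈ (hfin.toFinset : Set (dualMonoid σ)) →
      u ∈ (hfin.toFinset : Set (dualMonoid σ)) := by
    rw [Set.Finite.coe_toFinset]
    exact mem_splittingExponents_of_add_mem hv
  have hideal : splittingIdeal (maxIdeal k σ) (p ^ e)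
      (fun P => ⌈((p : ℚ) ^ e - 1) * toricDivisor k σ v a P⌉) J =
        cofaceIdeal (k := k) (hfin.toFinset : Set (dualMonoid σ)) hT := by
    ext f
    rw [mem_splittingIdeal hv hσ p hfull hE0 hE hJ]
    simp only [toricDivisor_rayDivisor hv hσ]
    change _ ↔ ∀ u ∈ (hfin.toFinset : Set (dualMonoid σ)), f.coeff u = 0
    rw [Set.Finite.coe_toFinset]
  rw [hideal, length_quotient_cofaceIdeal hv hfull _ _ (Set.ncard_eq_toFinset_card _ hfin).symm]

end Limit

end FSig

end

/-! ### The F-signature formula -/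

theorem mainTheorem4 (p : ℕ) [Fact p.Prime] (k : Type*) [Field k] [CharP k p] [PerfectField k]
    (n r : ℕ) (σ : PointedCone ℝ (Fin n → ℝ)) (v : Fin r → Fin n → ℤ)
    (hv : FSig.IsPrimitiveGenerators σ v)
    (hσ : (σ : ConvexCone ℝ (Fin n → ℝ)).Salient)
    (hfull : Submodule.span ℝ (σ : Set (Fin n → ℝ)) = ⊤)
    (a : Fin r → ℚ) (ha : ∀ i, 0 ≤ a i)
    (hD : FSig.IsQGorenstein k (FSig.toricDivisor k σ v a))
    (𝔞 : Ideal (FSig.ToricRing k σ)) (h𝔞 : FSig.IsMonomialIdeal 𝔞)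
    (t : ℝ) (ht : 0 < t) :
    FSig.HasFSignature p (FSig.maxIdeal k σ) (FSig.toricDivisor k σ v a) 𝔞 t
      (volume (FSig.polytope v a ∩ t • FSig.newton 𝔞)) := by
  have hdim := FSig.IsQGorenstein.ringKrullDim_eq hv hσ hD
  obtain ⟨w, hw⟩ := FSig.IsQGorenstein.exists_dotProduct_eq hv hσ hfull hdim hD
  have hp : 1 < p := (Fact.out : p.Prime).one_lt
  refine ⟨n, hdim, (FSig.tendsto_ncard_splittingExponents_div hv hσ hfull h𝔞 ht ha hw
    hp).congr' ?_⟩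
  -- The level e = 0 is discarded: there q - 1 = 0, and the finiteness of the exponent set is only
  -- known for q > 1.
  filter_upwards [(tendsto_pow_atTop_atTop_of_one_lt hp).eventually (eventually_gt_atTop 1)]
    with e he
  have hfin := FSig.finite_splittingExponents hv hσ hfull h𝔞 ht ha hw he
  simp only [Nat.cast_pow] at hfin ⊢
  rw [FSig.length_quotient_splittingIdeal hv hσ hfull p e ha (h𝔞.pow _) hfin]
  simp
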